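/- **Setting.** Let $D$ be a finite set, $r\ge 0$, and $\mathbf R:D^r\to\mathbb Z_{\ge 0}$ (a valued relation). The *complete uniform instance* $C$ on $n$ variables has as clauses all ordered $r$-tuples $x=(x_1,\dots,x_r)$ of distinct elements of $[n]$, each with weight $1$. A *reweighting* $\widehat C$ of $C$ assigns a weight $w_x\ge 0$ to every clause $x$; its size $|\widehat C|$ is the number of clauses with $w_x\neq 0$. For $\psi\in D^n$ put $\mathrm{sat}_{\mathbf R,\widehat C}(\psi)=\sum_x w_x\,\mathbf R(\psi_{x_1},\dots,\psi_{x_r})$. $\widehat C$ is a $(1\pm\varepsilon)$ *sparsifier* of $C$ if $\mathrm{sat}_{\mathbf R,\widehat C}(\psi)\in[(1-\varepsilon)\,\mathrm{sat}_{\mathbf R,C}(\psi),(1+\varepsilon)\,\mathrm{sat}_{\mathbf R,C}(\psi)]$ for every $\psi\in D^n$. Let $\mathrm{Hist}^D_r=\{h\in\mathbb Z_{\ge0}^D:\sum_d h_d=r\}$; let $\mathrm{hist}(t)\in \mathrm{Hist}^D_r$ count the occurrences of each $d\in D$ in $t$. The *symmetrization* $\mathbf S=\mathrm{Sym}(\mathbf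 R):\mathrm{Hist}^D_r\to\mathbb Z_{\ge0}$ is $\mathbf S(h)=\prod_{d}h_d!\sum_{t\in D^r,\,\mathrm{hist}(t)=h}\mathbf R(t)$, and $\operatorname{supp}\mathbf S=\{h:\mathbf S(h)\ne0\}$. For $E\subseteq D$ write $g\preceq_{\overline E}h$ if $g_e\le h_e$ for all $e\in D\setminus E$. * $\mathbf R$ is *$k$-plentiful* if for all $d\in D$ and $h\in\operatorname{supp}\mathbf S$ there is $g\in\operatorname{supp}\mathbf S$ with $g\preceq_{\overline{\{d\}}}h$ and $g_d\ge k$; it is *precisely $k$-plentiful* if it is $k$-plentiful but not $(k+1)$-plentiful. * $h\in\operatorname{supp}\mathbf S$ is *$(d,k)$-tight* if $h_d=k$ and the only $g\in\operatorname{supp}\mathbf S$ with $g\preceq_{\overline{\{d\}}}h$ is $h$. * For $d\in E\subseteq D$, $h\in\operatorname{supp}\mathbf S$ is *$(d,E)$-rigid* if $h_e=0$ for all $e\in E\setminus\{d\}$ and every $g\in\operatorname{supp}\mathbf S$ with $g\preceq_{\overline E}h$ has $\sum_{e\in E}g_e=h_d$. * If $\mathbf R$ is precisely $k$-plentiful,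 $\mathbf S$ is *marginally uniform* if for all $d\in E\subseteq D$ and every $h$ that is $(d,k)$-tight and $(d,E)$-rigid, the marginal predicate $g\mapsto\mathbf S(g\sqcup_E h)$ is constant on $\mathrm{Hist}^E_k$, where $g\sqcup_E h$ equals $g$ on $E$ and $h$ on $D\setminus E$. *Bundled sampling* with $\ell\ge 1$ samples: draw $T_1,\dots,T_\ell$ independently and uniformly (with replacement) from $\binom{[n]}{r}$. The sampled symmetric instance $\widehat C_{\mathrm{sym}}$ gives each $T\in\binom{[n]}r$ the weight $w_T=\binom nr\ell^{-1}\,|\{i:T_i=T\}|$ and has value $\mathrm{sat}_{\mathbf S,\widehat C_{\mathrm{sym}}}(\psi)=\sum_T w_T\,\mathbf S(\mathrm{hist}(\psi|_T))$; the bundled reweighting $\widehat C$ of $C$ gives each of the $r!$ clauses $x$ with $\{x_1,\dots,x_r\}=T$ the weight $w_T$. **Theorem.** Let $\mathbf R:D^r\to\mathbb Z_{\ge0}$ be precisely $k$-plentiful (so $k\le r$). All constants $a,\kappa,\delta,\varepsilon_0,N$ below are positive (except that $a \ge 0$) and may depend on $\mathbf R$ (and on the number $c$ where indicated), but not on $n$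 or $\varepsilon$. If $\mathrm{Sym}(\mathbf R)$ is marginally uniform: 1. (Upper bound by bundled sampling.) There is $a$ such that for every integer $c\ge0$ there are $\kappa,N$ (depending also on $c$) such that for all $n\ge N$ and $\varepsilon\in(0,1)$ there is an integer $$1\le \ell\le \kappa\,\frac{n^{r-k}}{\varepsilon^3}\,\log^a(n^{r-k}+2)=\widetilde O_{\mathbf R}(n^{r-k}/\varepsilon^3)$$ for which, with probability at least $1-n^{-c}$ over the bundled sampling with $\ell$ samples, $\widehat C$ is a $(1\pm\varepsilon)$ sparsifier of $C$, and likewise $\mathrm{sat}_{\mathbf S,\widehat C_{\mathrm{sym}}}(\psi)\in[(1-\varepsilon)\,\mathrm{sat}_{\mathbf R,C}(\psi),(1+\varepsilon)\,\mathrm{sat}_{\mathbf R,C}(\psi)]$ for all $\psi\in D^n$. In particular there are $a,\kappa,N$ such that for all $n\ge N$ and $\varepsilon\in(0,1)$, $C$ has a $(1\pm\varepsilon)$ sparsifier of size at most $\kappa\, n^{r-k}\varepsilon^{-3}\log^a(n^{r-k}+2)$. 2. (Lower bound.) There are $\delta,N$ such that for all $n\ge N$ and $\varepsilon\in(0,1)$,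 every $(1\pm\varepsilon)$ sparsifier of $C$ has size at least $\delta\, n^{r-k}$. If $\mathrm{Sym}(\mathbf R)$ is not marginally uniform: 3. There are $\kappa,N$ such that for all $n\ge N$ and $\varepsilon\in(0,1)$, $C$ has a $(1\pm\varepsilon)$ sparsifier of size at most $\kappa\, n^{r-k+1}/\varepsilon^2$. 4. There are $\varepsilon_0,\delta,N$ such that for all $n\ge N$ and $\varepsilon\in(0,\varepsilon_0)$, every $(1\pm\varepsilon)$ sparsifier of $C$ has size at least $\delta\, n^{r-k+1}$. -/

import Mathlib

open scoped NNReal Nat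

namespace UniformCSP

/-! ### Histograms and symmetric valued relations -/

/-- `Hist D r`: the `D`-histograms of arity `r`. -/
abbrev Hist (D : Type*) [Fintype D] (r : ℕ) : Type _ := {h : D → ℕ // ∑ d, h d = r}

/-- A valued relation of arity `r` over the domain `D`. -/
abbrev ValuedRel (D : Type*) (r : ℕ) : Type _ := (Fin r → D) → ℕ

/-- A symmetric valued relation of arity `r` over the domain `D`. -/
abbrev SymRel (D : Type*) [Fintype D] (r : ℕ) : Type _ := Hist D r → ℕ

section

variable {D : Type*} [Fintype D] {r : ℕ}

/-- The histogram of the values that `ψ` takes on a finite set `T` of size `r`. -/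
def histOn [DecidableEq D] {α : Type*} (ψ : α → D) (T : Finset α) (hT : T.card = r) : Hist D r :=
  ⟨fun d => (T.filter fun i => ψ i = d).card, by
    rw [← hT]
    exact (Finset.card_eq_sum_card_fiberwise
      (fun i _ => Finset.mem_coe.2 (Finset.mem_univ (ψ i)))).symm⟩

/-- The histogram of a tuple: `hist t d` is the number of occurrences of `d` in `t`. -/
def hist [DecidableEq D] (t : Fin r → D) : Hist D r := histOn t Finset.univ (by simp)

/-- The symmetrization of a valued relation. -/
def Sym [DecidableEq D] (R : ValuedRel D r) : SymRel D r :=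
  fun h => (∏ d, (h.1 d)!) * ∑ t ∈ Finset.univ.filter (fun t : Fin r → D => hist t = h), R t

/-- `LeOff E g h`: the coordinates of `g` outside `E` are at most those of `h`
(this is `g ≺ h` on the complement of `E`). -/
def LeOff (E : Finset D) (g h : Hist D r) : Prop := ∀ e, e ∉ E → g.1 e ≤ h.1 e

/-- `S` is `k`-plentiful: for each `d` and each `h` in the support there is `g` in the support
with `g d ≥ k`, and with `g e ≤ h e` for all `e ≠ d`. -/
def Plentiful (S : SymRel D r) (k : ℕ) : Prop :=
  ∀ (d : D) (h : Hist D r), S h ≠ 0 → ∃ g : Hist D r, S g ≠ 0 ∧ LeOff {d} g h ∧ k ≤ g.1 d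

/-- `S` is precisely `k`-plentiful. -/
def PreciselyPlentiful (S : SymRel D r) (k : ℕ) : Prop :=
  Plentiful S k ∧ ¬ Plentiful S (k + 1)

/-- `h` is `(d, k)`-tight: it lies in the support, the only `g` in the support that is at most `h`
off `d` is `h` itself, and `h d = k`. -/
def Tight (S : SymRel D r) (d : D) (k : ℕ) (h : Hist D r) : Prop :=
  S h ≠ 0 ∧ (∀ g : Hist D r, S g ≠ 0 → LeOff {d} g h → g = h) ∧ h.1 d = k

/-- `h` is `(d, E)`-rigid, where `d ∈ E`. -/
def Rigid (S : SymRel D r) (d : D) (E : Finset D) (h : Hist D r) : Prop :=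
  S h ≠ 0 ∧ d ∈ E ∧ (∀ e ∈ E, e ≠ d → h.1 e = 0) ∧
    ∀ g : Hist D r, S g ≠ 0 → LeOff E g h → ∑ e ∈ E, g.1 e = h.1 d

theorem sum_eq_of_tight_of_rigid {S : SymRel D r} {d : D} {k : ℕ} {E : Finset D} {h : Hist D r}
    (ht : Tight S d k h) (hr : Rigid S d E h) : ∑ e ∈ E, h.1 e = k := by
  rw [← ht.2.2]
  exact hr.2.2.2 h hr.1 (fun _ _ => le_rfl)

/-- The histogram that agrees with `g` on `E` and with `h` outside `E`. -/
def glue [DecidableEq D] {k : ℕ} (h : Hist D r) (E : Finset D) (hE : ∑ e ∈ E, h.1 e = k)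
    (g : Hist E k) : Hist D r :=
  ⟨fun e => if he : e ∈ E then g.1 ⟨e, he⟩ else h.1 e, by
    have h1 := Finset.sum_add_sum_compl E h.1
    have h2 := Finset.sum_add_sum_compl E (fun e => if he : e ∈ E then g.1 ⟨e, he⟩ else h.1 e)
    have h3 : ∑ e ∈ E, (if he : e ∈ E then g.1 ⟨e, he⟩ else h.1 e) = k := by
      rw [← Finset.sum_coe_sort E]
      exact (Finset.sum_congr rfl fun e _ => by simp).trans g.2
    have h4 : ∑ e ∈ Eᶜ, (if he : e ∈ E then g.1 ⟨e, he⟩ else h.1 e) = ∑ e ∈ Eᶜ, h.1 e :=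
      Finset.sum_congr rfl fun e he => by simp [Finset.mem_compl.1 he]
    exact h2.symm.trans ((congrArg₂ (· + ·) (h3.trans hE.symm) h4).trans (h1.trans h.2))⟩

/-- The marginal predicate of `S` induced by `h` and `E`. -/
def marginal [DecidableEq D] {k : ℕ} (S : SymRel D r) (h : Hist D r) (E : Finset D)
    (hE : ∑ e ∈ E, h.1 e = k) : SymRel E k :=
  fun g => S (glue h E hE g)

/-- A symmetric valued relation is uniform if it is constant. -/
def Uniform {E : Type*} [Fintype E] {k : ℕ} (S : SymRel E k) : Prop := ∀ g g', S g = S g'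

/-- Marginal uniformity of a precisely `k`-plentiful `S`: all its marginal predicates
are uniform. -/
def MarginallyUniform [DecidableEq D] (S : SymRel D r) (k : ℕ) : Prop :=
  ∀ (d : D) (E : Finset D) (h : Hist D r) (ht : Tight S d k h) (hr : Rigid S d E h),
    Uniform (marginal S h E (sum_eq_of_tight_of_rigid ht hr))

end

/-! ### Instances and sparsifiers -/

/-- A reweighting of the complete uniform instance on `n` variables. Its clauses are the ordered
`r`-tuples of distinct variables; a clause of weight `0` is absent. -/
abbrev Instance (n r : ℕ) : Type := (Fin r ↪ Fin n) → ℝ≥0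

/-- The complete uniform instance: every clause has weight `1`. -/
def complete (n r : ℕ) : Instance n r := fun _ => 1

/-- The number of clauses that are present in an instance. -/
noncomputable def numConstraints {n r : ℕ} (C : Instance n r) : ℕ :=
  (Finset.univ.filter fun x => C x ≠ 0).card

/-- The value of the assignment `ψ`. -/
noncomputable def sat {D : Type*} {n r : ℕ} (R : ValuedRel D r) (C : Instance n r)
    (ψ : Fin n → D) : ℝ :=
  ∑ x : Fin r ↪ Fin n, (C x : ℝ) * (R (fun i => ψ (x i)) : ℝ)

/-- `C'` is a `(1 ± ε)`-sparsifier of the complete uniform instance of `R`. -/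
def IsSparsifier {D : Type*} {n r : ℕ} (R : ValuedRel D r) (ε : ℝ) (C' : Instance n r) : Prop :=
  ∀ ψ : Fin n → D,
    sat R C' ψ ∈ Set.Icc ((1 - ε) * sat R (complete n r) ψ) ((1 + ε) * sat R (complete n r) ψ)

/-- The clauses of the complete symmetric instance: the `r`-element sets of variables. -/
abbrev RSet (n r : ℕ) : Type := {T : Finset (Fin n) // T.card = r}

/-- A reweighting of the complete symmetric instance. -/
abbrev SymInstance (n r : ℕ) : Type := RSet n r → ℝ≥0

/-- The value of the assignment `ψ` in a symmetric instance. -/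
noncomputable def symSat {D : Type*} [Fintype D] [DecidableEq D] {n r : ℕ} (S : SymRel D r)
    (C : SymInstance n r) (ψ : Fin n → D) : ℝ :=
  ∑ T : RSet n r, (C T : ℝ) * (S (histOn ψ T.1 T.2) : ℝ)

/-- The symmetric instance made of `ℓ` sampled sets, each sample carrying
weight `(n choose r) / ℓ`. -/
noncomputable def sampleInstance {n r ℓ : ℕ} (ω : Fin ℓ → RSet n r) : SymInstance n r :=
  fun T => ((n.choose r : ℝ≥0) / (ℓ : ℝ≥0)) * ((Finset.univ.filter fun i => ω i = T).card : ℝ≥0)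

/-- The set of variables of a clause. -/
def varSet {n r : ℕ} (x : Fin r ↪ Fin n) : RSet n r := ⟨Finset.univ.map x, by simp⟩

/-- Bundling: each set `T` is replaced by all `r!` ordered clauses on `T`, with the weight
of `T`. -/
def bundle {n r : ℕ} (C : SymInstance n r) : Instance n r := fun x => C (varSet x)

open Classical in
/-- The probability of an event when `ℓ` sets of `r` variables are drawn independently and
uniformly, with replacement, from the `r`-element sets of variables
(that is, `ω` is uniform on `Fin ℓ → RSet n r`). -/
noncomputable def sampleProb (n r ℓ : ℕ) (A : (Fin ℓ → RSet n r) → Prop) : ℝ :=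
  ((Finset.univ.filter A).card : ℝ) / (Fintype.card (Fin ℓ → RSet n r) : ℝ)

end UniformCSP

/-!
Grouping the clauses by their sets of variables turns the value of an assignment `ψ` into
`∑ g, S g * #{T | ψ has histogram g on T}`, where `S = Sym R`; by `sat_bundle` the same holds for
bundled reweightings. Everything is therefore about the frequencies of histograms on sets, and
these are products of binomial coefficients of the color counts of `ψ` (`card_filter_histOn_eq`).

*Upper bound without marginal uniformity.* If `ψ` has positive value and `d` is a color of linear
size, plentifulness provides a fitting histogram of the support with at least `k` entries `d`, so
the value is at least of order `n ^ (k - r)` times the number of sets. By Bernstein's inequality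
(`sampleProb_deviation`), `n ^ (r - k) / ε ^ 2` samples, times `n` for the union bound over all
assignments, suffice.

*Upper bound with marginal uniformity.* The union bound over the assignments with `m` variables
of a color other than `d` only costs a factor of order `m log n` (`sum_pow_complexity_le`).
Let `p` be the probability scale of the value of `ψ`. Colors used at most `Y ≈ p n ^ (r - k) / ε`
times are cheap; let `E` consist of `d` and of the other, abundant, colors. If `Y` reaches `n`
nothing is left to do. Otherwise the histograms of the support that reach the order of the value
have exactly `k` entries in `E`, all of them `d`, and they are tight and rigid
(`tight_and_rigid_of_fits`), so that by marginal uniformity `S` does not change when entries `d`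
are replaced by other colors of `E`. Recoloring `E` by `d` thus preserves their contribution
(`abs_sum_sub_le_of_collapse`), and lowers the number of variables with color other than `d` to the
order of `Y`; this is affordable with `n ^ (r - k) log n / ε ^ 3` samples. The other histograms of
the support have frequency at most of order `p Y / n` (`prob_collapse_le`): either this is below
`ε p`, and a crude bound does, or the variance in Bernstein's inequality is small enough for a
union bound over all assignments. This is `abs_sum_sub_le_value`. For `k = r`, marginal uniformity
makes `S` constant, and the total weight is always exact.

*Lower bounds.* Let `h` be rigid for `d` and `E`. Color a set `U` of `r - k` variables as `h` does
outside `E`, and the other variables arbitrarily by `E`. Only sets that contain `U` contribute to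
the value of such a planted assignment (`Rigid.subset_of_ne_zero`). As the value can be positive,
a sparsifier has a clause around each `U`, and double counting gives `n ^ (r - k)` clauses. If
a marginal predicate `Q` of `S` is not constant, the sparsifier has linearly many clauses around
each `U`: otherwise nearly all variables are untouched by them, and random colorings of the
untouched variables with distribution `α` change the value, which is close to the polynomial
`average Q α` in `α`, but not its estimate. This polynomial is not constant
(`uniform_of_average_eq`).
-/

namespace UniformCSP

/-! ### Symmetrization of the value of an assignment -/

section Symmetrization

variable {D : Type*} [Fintype D] [DecidableEq D] {n r : ℕ}

instance : Fintype (Hist D r) :=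
  Fintype.subtype (Finset.piAntidiag Finset.univ r) fun h => by simp

theorem histOn_varSet (ψ : Fin n → D) (x : Fin r ↪ Fin n) :
    histOn ψ (varSet x).1 (varSet x).2 = hist (fun i => ψ (x i)) := by
  apply Subtype.ext
  funext d
  change (Finset.filter (fun i => ψ i = d) (Finset.univ.map x)).card = _
  rw [Finset.filter_map, Finset.card_map]
  rfl

theorem exists_embedding_of_histOn_eq_hist (ψ : Fin n → D) (T : RSet n r) (t : Fin r → D)
    (h : histOn ψ T.1 T.2 = hist t) :
    ∃ x : Fin r ↪ Fin n, varSet x = T ∧ (fun i => ψ (x i)) = t := by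
  have key : ∀ c : D, Nonempty ({a : Fin r // t a = c} ≃ {b : T.1 // ψ b.1 = c}) := by
    intro c
    apply Fintype.card_eq.1
    have h1 := congrFun (congrArg Subtype.val h) c
    change (Finset.filter (fun i => ψ i = c) T.1).card
      = (Finset.filter (fun i => t i = c) Finset.univ).card at h1
    rw [Fintype.card_subtype, Fintype.card_subtype, ← h1]
    have h2 : (Finset.filter (fun i => ψ i = c) T.1) =
        (Finset.filter (fun b : T.1 => ψ b.1 = c) Finset.univ).map
          (Function.Embedding.subtype _) := by
      ext i
      simp [and_comm]
    rw [h2, Finset.card_map]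
  let e : Fin r ≃ T.1 := Equiv.ofFiberEquiv fun c => (key c).some
  have he : ∀ i, ψ (e i).1 = t i := fun i =>
    Equiv.ofFiberEquiv_map (f := t) (g := fun b : T.1 => ψ b.1) (fun c => (key c).some) i
  refine ⟨e.toEmbedding.trans (Function.Embedding.subtype _), ?_, funext he⟩
  apply Subtype.ext
  ext i
  simp only [varSet, Finset.mem_map, Finset.mem_univ, true_and]
  constructor
  · rintro ⟨j, rfl⟩
    exact (e j).2
  · intro hi
    exact ⟨e.symm ⟨i, hi⟩, by simp⟩

/-- Each tuple with the histogram of `ψ` on `T` is read off by the same number of orderings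
of `T`: they form a torsor under the permutations that preserve the tuple. -/
theorem card_orderings (ψ : Fin n → D) (T : RSet n r) (t : Fin r → D)
    (h : histOn ψ T.1 T.2 = hist t) :
    (Finset.univ.filter fun x : Fin r ↪ Fin n => varSet x = T ∧ (fun i => ψ (x i)) = t).card
      = ∏ d, ((hist t).1 d)! := by
  obtain ⟨x₀, hx₀, ht₀⟩ := exists_embedding_of_histOn_eq_hist ψ T t h
  have hfib : ∀ d, Fintype.card {a // t a = d} = (hist t).1 d := fun d => Fintype.card_subtype _
  have h1 := DomMulAct.stabilizer_card t
  simp only [hfib] at h1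
  rw [← h1, ← Fintype.card_subtype]
  symm
  apply Fintype.card_congr
  refine Equiv.ofBijective
    (fun σ => ⟨σ.1.toEmbedding.trans x₀, ?_, ?_⟩) ⟨?_, ?_⟩
  · rw [← hx₀]
    apply Subtype.ext
    simp [varSet, ← Finset.map_map]
  · funext i
    have h2 := congrFun σ.2 i
    have h3 := congrFun ht₀ (σ.1 i)
    simpa using h3.trans h2
  · intro σ τ hστ
    apply Subtype.ext
    ext i
    have h2 := congrArg Subtype.val hστ
    have h3 := DFunLike.congr_fun h2 i
    exact congrArg Fin.val (x₀.injective h3)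
  · rintro ⟨x, hx, ht⟩
    have hmem : ∀ i, ∃ j, x₀ j = x i := by
      intro i
      have h2 : x i ∈ (varSet x₀).1 := by
        rw [hx₀, ← hx]
        simp [varSet]
      simpa [varSet] using h2
    choose f hf using hmem
    have hinj : Function.Injective f := by
      intro i j hij
      apply x.injective
      rw [← hf, ← hf, hij]
    refine ⟨⟨Equiv.ofBijective f (Finite.injective_iff_bijective.1 hinj), ?_⟩, ?_⟩
    · funext i
      have h3 := congrFun ht₀ (f i)
      have h4 := congrFun ht i
      simp only [Function.comp_apply, Equiv.ofBijective_apply]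
      rw [← h3, hf, h4]
    · apply Subtype.ext
      ext i
      simp [hf]

theorem sum_orderings (R : ValuedRel D r) (ψ : Fin n → D) (T : RSet n r) :
    ∑ x ∈ Finset.univ.filter (fun x : Fin r ↪ Fin n => varSet x = T), R (fun i => ψ (x i))
      = Sym R (histOn ψ T.1 T.2) := by
  rw [← Finset.sum_fiberwise _ (fun x : Fin r ↪ Fin n => fun i => ψ (x i))]
  unfold Sym
  rw [Finset.mul_sum, Finset.sum_filter]
  refine Finset.sum_congr rfl fun t _ => ?_
  rw [Finset.filter_filter]
  split_ifs with h
  · rw [Finset.sum_congr rfl (g := fun _ => R t)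
      (fun x hx => by rw [(Finset.mem_filter.1 hx).2.2]), Finset.sum_const,
      card_orderings ψ T t h.symm, h, smul_eq_mul]
  · apply Finset.sum_eq_zero
    intro x hx
    obtain ⟨h1, h2⟩ := (Finset.mem_filter.1 hx).2
    exact absurd (by rw [← h2, ← h1, histOn_varSet]) h

/-- A bundled instance and the symmetric instance it comes from give the same values. -/
theorem sat_bundle (R : ValuedRel D r) (w : SymInstance n r) (ψ : Fin n → D) :
    sat R (bundle w) ψ = symSat (Sym R) w ψ := by
  unfold sat symSat
  rw [← Finset.sum_fiberwise _ (varSet (n := n) (r := r))]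
  refine Finset.sum_congr rfl fun T _ => ?_
  rw [← sum_orderings, Nat.cast_sum, Finset.mul_sum]
  refine Finset.sum_congr rfl fun x hx => ?_
  rw [bundle, (Finset.mem_filter.1 hx).2]

theorem sat_complete (R : ValuedRel D r) (ψ : Fin n → D) :
    sat R (complete n r) ψ = ∑ T : RSet n r, (Sym R (histOn ψ T.1 T.2) : ℝ) := by
  have h := sat_bundle R (fun _ => 1) ψ
  change sat R (complete n r) ψ = _ at h
  rw [h]
  simp [symSat]

theorem sym_hist_ne_zero (R : ValuedRel D r) (t : Fin r → D) (h : R t ≠ 0) :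
    Sym R (hist t) ≠ 0 := by
  unfold Sym
  apply mul_ne_zero
  · exact Finset.prod_ne_zero_iff.2 fun d _ => Nat.factorial_ne_zero _
  · intro h0
    exact h (Finset.sum_eq_zero_iff.1 h0 t (by simp))

/-! ### Counting the sets with a given histogram -/

/-- The number of variables to which `ψ` gives the value `d`. -/
def colorCount (ψ : Fin n → D) (d : D) : ℕ := (Finset.univ.filter fun i => ψ i = d).card

theorem sum_colorCount (ψ : Fin n → D) : ∑ d, colorCount ψ d = n := by
  have h := Finset.card_eq_sum_card_fiberwise (s := Finset.univ) (t := Finset.univ) (f := ψ)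
    (fun i _ => Finset.mem_coe.2 (Finset.mem_univ (ψ i)))
  rw [Finset.card_univ, Fintype.card_fin] at h
  exact h.symm

theorem colorCount_le {D : Type*} [DecidableEq D] (ψ : Fin n → D) (d : D) : colorCount ψ d ≤ n :=
  (Finset.card_filter_le _ _).trans (by simp)

theorem card_filter_histOn_eq (ψ : Fin n → D) (g : Hist D r) :
    (Finset.univ.filter fun T : RSet n r => histOn ψ T.1 T.2 = g).card
      = ∏ d, (colorCount ψ d).choose (g.1 d) := by
  have hfil : ∀ (T : D → Finset (Fin n)), (∀ d, ∀ i ∈ T d, ψ i = d) → ∀ d,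
      (Finset.univ.biUnion T).filter (fun i => ψ i = d) = T d := by
    intro T hT d
    ext i
    simp only [Finset.mem_filter, Finset.mem_biUnion, Finset.mem_univ, true_and]
    constructor
    · rintro ⟨⟨e, he⟩, hi⟩
      have := hT e i he
      rw [← hi, this]
      exact he
    · exact fun hi => ⟨⟨d, hi⟩, hT d i hi⟩
  have h : ∏ d, (colorCount ψ d).choose (g.1 d) = (Fintype.piFinset fun d =>
      Finset.powersetCard (g.1 d) (Finset.univ.filter fun i => ψ i = d)).card := by
    rw [Fintype.card_piFinset]
    exact Finset.prod_congr rfl fun d _ => (Finset.card_powersetCard _ _).symm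
  rw [h]
  refine Finset.card_bij (fun T _ => fun d => T.1.filter fun i => ψ i = d) ?_ ?_ ?_
  · intro T hT
    rw [Fintype.mem_piFinset]
    intro d
    rw [Finset.mem_powersetCard]
    refine ⟨Finset.filter_subset_filter _ (Finset.subset_univ _), ?_⟩
    rw [← (Finset.mem_filter.1 hT).2]
    rfl
  · intro T _ T' _ hTT'
    apply Subtype.ext
    ext i
    have h1 := congrFun hTT' (ψ i)
    have h2 := Finset.ext_iff.1 h1 i
    simpa using h2
  · intro T hT
    have hT' : ∀ d, T d ⊆ (Finset.univ.filter fun i => ψ i = d) ∧ (T d).card = g.1 d :=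
      fun d => Finset.mem_powersetCard.1 (Fintype.mem_piFinset.1 hT d)
    have hc : ∀ d, ∀ i ∈ T d, ψ i = d := fun d i hi =>
      (Finset.mem_filter.1 ((hT' d).1 hi)).2
    have hcard : (Finset.univ.biUnion T).card = r := by
      rw [Finset.card_biUnion, ← g.2]
      · exact Finset.sum_congr rfl fun d _ => (hT' d).2
      · intro d _ e _ hde
        exact Finset.disjoint_left.2 fun i hi hi' => hde ((hc d i hi).symm.trans (hc e i hi'))
    refine ⟨⟨_, hcard⟩, ?_, funext fun d => hfil T hc d⟩
    rw [Finset.mem_filter]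
    refine ⟨Finset.mem_univ _, Subtype.ext (funext fun d => ?_)⟩
    change ((Finset.univ.biUnion T).filter (fun i => ψ i = d)).card = _
    rw [hfil T hc d, (hT' d).2]

theorem card_RSet : Fintype.card (RSet n r) = n.choose r := by
  have := Fintype.card_finset_len (α := Fin n) r
  rwa [Fintype.card_fin] at this

end Symmetrization

theorem pow_le_pow_mul_choose {n r g : ℕ} (hg : g ≤ n) (hr : g ≤ r) :
    n ^ g ≤ r ^ g * (g ! * n.choose g) := by
  rcases Nat.eq_zero_or_pos g with rfl | hpos
  · simp
  have h1 : (n + 1 - g) ^ g ≤ g ! * n.choose g := by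
    rw [← Nat.descFactorial_eq_factorial_mul_choose]
    exact n.pow_sub_le_descFactorial g
  have h2 : n ≤ g * (n + 1 - g) := by
    obtain ⟨m, rfl⟩ := Nat.exists_eq_add_of_le hg
    have h3 : g + m + 1 - g = m + 1 := by omega
    rw [h3]
    nlinarith
  calc n ^ g ≤ (r * (n + 1 - g)) ^ g := Nat.pow_le_pow_left (h2.trans (Nat.mul_le_mul_right _ hr)) g
    _ = r ^ g * (n + 1 - g) ^ g := mul_pow _ _ _
    _ ≤ _ := Nat.mul_le_mul_left _ h1

section Mass

variable {D : Type*} [Fintype D] [DecidableEq D] {n r : ℕ}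

theorem prod_pow_le_card (ψ : Fin n → D) (g : Hist D r) (hg : ∀ d, g.1 d ≤ colorCount ψ d) :
    ∏ d, colorCount ψ d ^ g.1 d ≤ r ^ r * r ! *
      (Finset.univ.filter fun T : RSet n r => histOn ψ T.1 T.2 = g).card := by
  rw [card_filter_histOn_eq]
  have hgr : ∀ d, g.1 d ≤ r := fun d => by
    conv_rhs => rw [← g.2]
    exact Finset.single_le_sum (f := g.1) (fun _ _ => Nat.zero_le _) (Finset.mem_univ d)
  calc ∏ d, colorCount ψ d ^ g.1 d
      ≤ ∏ d, r ^ g.1 d * ((g.1 d)! * (colorCount ψ d).choose (g.1 d)) :=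
        Finset.prod_le_prod' fun d _ => pow_le_pow_mul_choose (hg d) (hgr d)
    _ = r ^ r * (∏ d, (g.1 d)!) * ∏ d, (colorCount ψ d).choose (g.1 d) := by
        rw [Finset.prod_mul_distrib, Finset.prod_mul_distrib, Finset.prod_pow_eq_pow_sum, g.2,
          mul_assoc]
    _ ≤ _ := by
        gcongr
        have h := Nat.prod_factorial_dvd_factorial_sum Finset.univ g.1
        rw [g.2] at h
        exact Nat.le_of_dvd (Nat.factorial_pos r) h

theorem card_le_prod_pow (ψ : Fin n → D) (g : Hist D r) :
    (Finset.univ.filter fun T : RSet n r => histOn ψ T.1 T.2 = g).card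
      ≤ ∏ d, colorCount ψ d ^ g.1 d := by
  rw [card_filter_histOn_eq]
  exact Finset.prod_le_prod' fun d _ => Nat.choose_le_pow _ _

/-- The total weight under `w` of the sets on which `ψ` has histogram `g`. -/
noncomputable def mass (w : RSet n r → ℝ) (ψ : Fin n → D) (g : Hist D r) : ℝ :=
  ∑ T ∈ Finset.univ.filter (fun T : RSet n r => histOn ψ T.1 T.2 = g), w T

/-- The probability that `ψ` has histogram `g` on a uniformly random set of `r` variables. -/
noncomputable def prob (ψ : Fin n → D) (g : Hist D r) : ℝ :=
  ((Finset.univ.filter fun T : RSet n r => histOn ψ T.1 T.2 = g).card : ℝ) / (n.choose r : ℝ)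

theorem mass_const (ψ : Fin n → D) (g : Hist D r) :
    mass (fun _ => 1 / (n.choose r : ℝ)) ψ g = prob ψ g := by
  simp [mass, prob, div_eq_mul_inv]

theorem prob_nonneg (ψ : Fin n → D) (g : Hist D r) : 0 ≤ prob ψ g := by
  unfold prob
  positivity

theorem mass_nonneg {w : RSet n r → ℝ} (hw : ∀ T, 0 ≤ w T) (ψ : Fin n → D) (g : Hist D r) :
    0 ≤ mass w ψ g := Finset.sum_nonneg fun T _ => hw T

theorem sum_mul_eq_sum_mass (S : SymRel D r) (w : RSet n r → ℝ) (ψ : Fin n → D) :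
    ∑ T : RSet n r, w T * (S (histOn ψ T.1 T.2) : ℝ) = ∑ g, (S g : ℝ) * mass w ψ g := by
  rw [← Finset.sum_fiberwise _ (fun T : RSet n r => histOn ψ T.1 T.2)]
  refine Finset.sum_congr rfl fun g _ => ?_
  rw [mass, Finset.mul_sum]
  refine Finset.sum_congr rfl fun T hT => ?_
  rw [(Finset.mem_filter.1 hT).2, mul_comm]

/-- If `g` does not fit into the color counts of `ψ`, no set has histogram `g`. -/
theorem filter_histOn_eq_empty (ψ : Fin n → D) (g : Hist D r)
    (hg : ¬ ∀ d, g.1 d ≤ colorCount ψ d) :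
    (Finset.univ.filter fun T : RSet n r => histOn ψ T.1 T.2 = g) = ∅ := by
  rw [Finset.filter_eq_empty_iff]
  rintro T - rfl
  exact hg fun d => Finset.card_le_card (Finset.filter_subset_filter _ (Finset.subset_univ _))

theorem mass_eq_zero (w : RSet n r → ℝ) (ψ : Fin n → D) (g : Hist D r)
    (hg : ¬ ∀ d, g.1 d ≤ colorCount ψ d) : mass w ψ g = 0 := by
  rw [mass, filter_histOn_eq_empty ψ g hg, Finset.sum_empty]

theorem prob_eq_zero (ψ : Fin n → D) (g : Hist D r)
    (hg : ¬ ∀ d, g.1 d ≤ colorCount ψ d) : prob ψ g = 0 := by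
  rw [prob, filter_histOn_eq_empty ψ g hg]
  simp

theorem le_prob (ψ : Fin n → D) (g : Hist D r) (hg : ∀ d, g.1 d ≤ colorCount ψ d) (hn : r ≤ n) :
    ∏ d, (colorCount ψ d : ℝ) ^ g.1 d ≤ (r ^ r * r ! : ℕ) * (prob ψ g * (n : ℝ) ^ r) := by
  have h1 : (0 : ℝ) < n.choose r := by exact_mod_cast Nat.choose_pos hn
  have h2 : (n.choose r : ℝ) ≤ (n : ℝ) ^ r := by exact_mod_cast Nat.choose_le_pow n r
  have h3 : (∏ d, (colorCount ψ d : ℝ) ^ g.1 d) ≤ (r ^ r * r ! : ℕ) *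
      ((Finset.univ.filter fun T : RSet n r => histOn ψ T.1 T.2 = g).card : ℝ) := by
    exact_mod_cast prod_pow_le_card ψ g hg
  refine h3.trans (mul_le_mul_of_nonneg_left ?_ (Nat.cast_nonneg _))
  calc _ = prob ψ g * n.choose r := by rw [prob, div_mul_cancel₀ _ h1.ne']
    _ ≤ _ := mul_le_mul_of_nonneg_left h2 (prob_nonneg _ _)

theorem prob_mul_pow_le (ψ : Fin n → D) (g : Hist D r) (hn : r ≤ n) :
    prob ψ g * (n : ℝ) ^ r ≤ (r ^ r * r ! : ℕ) * ∏ d, (colorCount ψ d : ℝ) ^ g.1 d := by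
  have h1 : (0 : ℝ) < n.choose r := by exact_mod_cast Nat.choose_pos hn
  have h2 : ((n : ℝ) ^ r) ≤ (r ^ r * r ! : ℕ) * n.choose r := by
    have := pow_le_pow_mul_choose hn le_rfl
    rw [← mul_assoc] at this
    exact_mod_cast this
  have h3 : ((Finset.univ.filter fun T : RSet n r => histOn ψ T.1 T.2 = g).card : ℝ)
      ≤ ∏ d, (colorCount ψ d : ℝ) ^ g.1 d := by
    exact_mod_cast card_le_prod_pow ψ g
  calc prob ψ g * (n : ℝ) ^ r ≤ prob ψ g * ((r ^ r * r ! : ℕ) * n.choose r) :=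
        mul_le_mul_of_nonneg_left h2 (prob_nonneg _ _)
    _ = (r ^ r * r ! : ℕ) *
        ((Finset.univ.filter fun T : RSet n r => histOn ψ T.1 T.2 = g).card : ℝ) := by
        rw [prob]
        field_simp
    _ ≤ _ := mul_le_mul_of_nonneg_left h3 (Nat.cast_nonneg _)

end Mass

/-! ### Concentration of the sampled frequencies -/

section Sampling

variable {n r ℓ : ℕ}

theorem card_samples : (Fintype.card (Fin ℓ → RSet n r) : ℝ) = (n.choose r : ℝ) ^ ℓ := by
  rw [Fintype.card_fun, card_RSet, Fintype.card_fin, Nat.cast_pow]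

theorem card_samples_pos (hn : r ≤ n) : (0 : ℝ) < Fintype.card (Fin ℓ → RSet n r) := by
  rw [card_samples]
  exact pow_pos (by exact_mod_cast Nat.choose_pos hn) _

theorem one_sub_sum_le_sampleProb {ι : Type*} (s : Finset ι) (hn : r ≤ n)
    (P : ι → (Fin ℓ → RSet n r) → Prop) (A : (Fin ℓ → RSet n r) → Prop)
    (h : ∀ ω, (∀ i ∈ s, P i ω) → A ω) :
    1 - ∑ i ∈ s, sampleProb n r ℓ (fun ω => ¬ P i ω) ≤ sampleProb n r ℓ A := by
  classical
  have hpos := card_samples_pos (ℓ := ℓ) hn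
  unfold sampleProb
  rw [← Finset.sum_div, le_div_iff₀ hpos, sub_mul, div_mul_cancel₀ _ hpos.ne', one_mul,
    sub_le_iff_le_add]
  have h1 : (Finset.univ : Finset (Fin ℓ → RSet n r)) ⊆
      Finset.univ.filter A ∪ s.biUnion fun i => Finset.univ.filter fun ω => ¬ P i ω := by
    intro ω _
    by_cases hA : A ω
    · exact Finset.mem_union_left _ (by simpa using hA)
    · apply Finset.mem_union_right
      have : ∃ i ∈ s, ¬ P i ω := by
        by_contra! hc
        exact hA (h ω hc)
      simpa using this
  have h2 := (Finset.card_le_card h1).trans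
    ((Finset.card_union_le _ _).trans (Nat.add_le_add_left Finset.card_biUnion_le _))
  rw [Finset.card_univ] at h2
  calc (Fintype.card (Fin ℓ → RSet n r) : ℝ) ≤ _ := Nat.cast_le.2 h2
    _ = _ := by
      rw [Nat.cast_add, Nat.cast_sum]
      congr!

theorem exp_le_one_add_add_sq {θ : ℝ} (hθ : |θ| ≤ 1) : Real.exp θ - 1 ≤ θ + θ ^ 2 := by
  have := (abs_le.1 (Real.abs_exp_sub_one_sub_id_le hθ)).2
  linarith

/-- Exponential Markov inequality for the number of samples that fall into `A`. -/
theorem sampleProb_le_exp (hn : r ≤ n) (A : Finset (RSet n r)) {θ : ℝ} (hθ : |θ| ≤ 1) (b : ℝ) :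
    sampleProb n r ℓ (fun ω => b ≤ θ * ((Finset.univ.filter fun i => ω i ∈ A).card : ℝ))
      ≤ Real.exp (ℓ * ((A.card : ℝ) / (n.choose r : ℝ)) * (θ + θ ^ 2) - b) := by
  classical
  have hN : (0 : ℝ) < n.choose r := by exact_mod_cast Nat.choose_pos hn
  have hpos := card_samples_pos (ℓ := ℓ) hn
  have hmgf : ∑ ω : Fin ℓ → RSet n r,
      Real.exp (θ * ((Finset.univ.filter fun i => ω i ∈ A).card : ℝ)) =
      ((n.choose r : ℝ) + A.card * (Real.exp θ - 1)) ^ ℓ := by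
    have h1 : ∑ T : RSet n r, (if T ∈ A then Real.exp θ else 1) =
        (n.choose r : ℝ) + A.card * (Real.exp θ - 1) := by
      have h2 : ∀ T : RSet n r, (if T ∈ A then Real.exp θ else 1) =
          1 + if T ∈ A then Real.exp θ - 1 else 0 := by
        intro T
        split_ifs <;> ring
      rw [Finset.sum_congr rfl fun T _ => h2 T, Finset.sum_add_distrib, Finset.sum_ite_mem]
      simp
      ring
    rw [← h1, Fintype.sum_pow]
    refine Finset.sum_congr rfl fun ω _ => ?_
    rw [Finset.prod_ite, Finset.prod_const, Finset.prod_const_one, mul_one, ← Real.exp_nat_mul,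
      mul_comm]
  have h1 : (((Finset.univ.filter fun ω : Fin ℓ → RSet n r =>
      b ≤ θ * ((Finset.univ.filter fun i => ω i ∈ A).card : ℝ)).card : ℝ)) ≤
      ((n.choose r : ℝ) + A.card * (Real.exp θ - 1)) ^ ℓ * Real.exp (-b) := by
    rw [← hmgf, Finset.sum_mul, Finset.card_filter, Nat.cast_sum]
    refine Finset.sum_le_sum fun ω _ => ?_
    rw [← Real.exp_add]
    split_ifs with h
    · rw [Nat.cast_one]
      exact Real.one_le_exp (by linarith)
    · rw [Nat.cast_zero]
      positivity
  have h2 : 0 ≤ 1 + (A.card : ℝ) / n.choose r * (Real.exp θ - 1) := by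
    have h3 : (A.card : ℝ) / n.choose r ≤ 1 := by
      rw [div_le_one hN]
      have := Finset.card_le_univ A
      rw [card_RSet] at this
      exact_mod_cast this
    have h4 : 0 ≤ (A.card : ℝ) / n.choose r := by positivity
    nlinarith [Real.exp_pos θ]
  unfold sampleProb
  rw [div_le_iff₀ hpos, card_samples]
  have h5 : ((n.choose r : ℝ) + A.card * (Real.exp θ - 1)) ^ ℓ ≤
      (n.choose r : ℝ) ^ ℓ * Real.exp (ℓ * ((A.card : ℝ) / (n.choose r : ℝ)) * (θ + θ ^ 2)) := by
    have h6 : (n.choose r : ℝ) + A.card * (Real.exp θ - 1) =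
        n.choose r * (1 + (A.card : ℝ) / n.choose r * (Real.exp θ - 1)) := by
      field_simp
    rw [h6, mul_pow]
    apply mul_le_mul_of_nonneg_left _ (by positivity)
    rw [mul_assoc, Real.exp_nat_mul]
    apply pow_le_pow_left₀ h2
    have h7 : (A.card : ℝ) / n.choose r * (Real.exp θ - 1) ≤
        (A.card : ℝ) / n.choose r * (θ + θ ^ 2) :=
      mul_le_mul_of_nonneg_left (exp_le_one_add_add_sq hθ) (by positivity)
    have h8 := Real.add_one_le_exp ((A.card : ℝ) / n.choose r * (θ + θ ^ 2))
    linarith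
  calc _ ≤ ((n.choose r : ℝ) + A.card * (Real.exp θ - 1)) ^ ℓ * Real.exp (-b) := by
        convert h1
    _ ≤ ((n.choose r : ℝ) ^ ℓ *
        Real.exp (ℓ * ((A.card : ℝ) / (n.choose r : ℝ)) * (θ + θ ^ 2))) * Real.exp (-b) :=
        mul_le_mul_of_nonneg_right h5 (Real.exp_pos _).le
    _ = _ := by
        rw [sub_eq_add_neg, Real.exp_add]
        ring

/-- The choice of the exponent in the Chernoff bound. -/
theorem exists_exponent {μ s : ℝ} (hμ : 0 ≤ μ) (hs : 0 < s) :
    ∃ θ : ℝ, 0 < θ ∧ θ ≤ 1 ∧ μ * θ ^ 2 - θ * (2 * (√(μ * s) + s)) ≤ -s := by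
  rcases le_or_gt μ s with h | h
  · refine ⟨1, one_pos, le_rfl, ?_⟩
    nlinarith [Real.sqrt_nonneg (μ * s)]
  · have hμ' : 0 < μ := hs.trans h
    refine ⟨√(s / μ), Real.sqrt_pos.2 (by positivity), ?_, ?_⟩
    · rw [Real.sqrt_le_one]
      exact (div_le_one hμ').2 h.le
    · have h1 : √(s / μ) ^ 2 = s / μ := Real.sq_sqrt (by positivity)
      have h2 : √(s / μ) * √(μ * s) = s := by
        rw [← Real.sqrt_mul (by positivity)]
        have : s / μ * (μ * s) = s ^ 2 := by field_simp
        rw [this, Real.sqrt_sq hs.le]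
      have h3 : μ * (s / μ) = s := by field_simp
      have h4 : 0 ≤ √(s / μ) * s := by positivity
      nlinarith

/-- The relative frequencies of the sampled sets. -/
noncomputable def freq (ω : Fin ℓ → RSet n r) (T : RSet n r) : ℝ :=
  ((Finset.univ.filter fun i => ω i = T).card : ℝ) / (ℓ : ℝ)

theorem freq_nonneg (ω : Fin ℓ → RSet n r) (T : RSet n r) : 0 ≤ freq ω T := by
  unfold freq
  positivity

variable {D : Type*} [Fintype D] [DecidableEq D]

theorem mass_freq (ω : Fin ℓ → RSet n r) (ψ : Fin n → D) (g : Hist D r) :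
    mass (freq ω) ψ g = ((Finset.univ.filter fun i => ω i ∈
      Finset.univ.filter fun T : RSet n r => histOn ψ T.1 T.2 = g).card : ℝ) / (ℓ : ℝ) := by
  classical
  unfold mass freq
  rw [← Finset.sum_div, ← Nat.cast_sum]
  congr 2
  rw [Finset.card_eq_sum_card_fiberwise (f := ω) (t := Finset.univ.filter fun T : RSet n r =>
    histOn ψ T.1 T.2 = g) (fun i hi => by simpa using hi)]
  refine Finset.sum_congr rfl fun T hT => ?_
  congr 1
  ext i
  simp only [Finset.mem_filter, Finset.mem_univ, true_and]
  constructor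
  · rintro rfl
    exact ⟨(Finset.mem_filter.1 hT).2, rfl⟩
  · exact fun h => h.2

/-- Bernstein's inequality for the frequency of a histogram. -/
theorem sampleProb_deviation (hn : r ≤ n) (hℓ : 1 ≤ ℓ) (ψ : Fin n → D) (g : Hist D r) {s : ℝ}
    (hs : 0 < s) :
    sampleProb n r ℓ
      (fun ω => ¬ |mass (freq ω) ψ g - prob ψ g| ≤ 2 * (√(prob ψ g * s) + s))
      ≤ 2 * Real.exp (-(ℓ * s)) := by
  obtain ⟨θ, h0, h1, hθ⟩ := exists_exponent (prob_nonneg ψ g) hs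
  have hℓ' : (0 : ℝ) < ℓ := by exact_mod_cast hℓ
  set τ := 2 * (√(prob ψ g * s) + s) with hτ
  set A := Finset.univ.filter fun T : RSet n r => histOn ψ T.1 T.2 = g with hA
  have hprob : (A.card : ℝ) / (n.choose r : ℝ) = prob ψ g := rfl
  have hup := sampleProb_le_exp (ℓ := ℓ) hn A (θ := θ) (by rw [abs_of_pos h0]; exact h1)
    (θ * (ℓ * (prob ψ g + τ)))
  have hlo := sampleProb_le_exp (ℓ := ℓ) hn A (θ := -θ) (by rw [abs_neg, abs_of_pos h0]; exact h1)
    (-θ * (ℓ * (prob ψ g - τ)))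
  rw [hprob] at hup hlo
  have hcard := card_samples_pos (ℓ := ℓ) hn
  have hunion : sampleProb n r ℓ (fun ω => ¬ |mass (freq ω) ψ g - prob ψ g| ≤ τ) ≤
      sampleProb n r ℓ (fun ω => θ * (ℓ * (prob ψ g + τ)) ≤
        θ * ((Finset.univ.filter fun i => ω i ∈ A).card : ℝ)) +
      sampleProb n r ℓ (fun ω => -θ * (ℓ * (prob ψ g - τ)) ≤
        -θ * ((Finset.univ.filter fun i => ω i ∈ A).card : ℝ)) := by
    classical
    unfold sampleProb
    rw [← add_div]
    apply div_le_div_of_nonneg_right _ hcard.le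
    rw [← Nat.cast_add, Nat.cast_le]
    refine le_trans (Finset.card_le_card ?_) (Finset.card_union_le _ _)
    intro ω hω
    simp only [Finset.mem_filter, Finset.mem_univ, true_and, Finset.mem_union] at hω ⊢
    rw [not_le, lt_abs, mass_freq, ← hA] at hω
    rcases hω with h | h
    · left
      apply mul_le_mul_of_nonneg_left _ h0.le
      rw [lt_sub_iff_add_lt, lt_div_iff₀ hℓ'] at h
      simp only [hA, Finset.mem_filter, Finset.mem_univ, true_and] at h ⊢
      nlinarith
    · right
      apply mul_le_mul_of_nonpos_left _ (by linarith)
      have h' : ((Finset.univ.filter fun i => ω i ∈ A).card : ℝ) / ℓ < prob ψ g - τ := by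
        linarith
      rw [div_lt_iff₀ hℓ'] at h'
      simp only [hA, Finset.mem_filter, Finset.mem_univ, true_and] at h' ⊢
      nlinarith
  have e1 : ℓ * prob ψ g * (θ + θ ^ 2) - θ * (ℓ * (prob ψ g + τ)) ≤ -(ℓ * s) := by
    nlinarith
  have e2 : ℓ * prob ψ g * (-θ + (-θ) ^ 2) - -θ * (ℓ * (prob ψ g - τ)) ≤ -(ℓ * s) := by
    nlinarith
  have := Real.exp_le_exp.2 e1
  have := Real.exp_le_exp.2 e2
  linarith

theorem two_mul_sqrt_add_le {μ s y : ℝ} (hy : 0 ≤ y) (h1 : μ * s ≤ y ^ 2) (h2 : s ≤ y) :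
    2 * (√(μ * s) + s) ≤ 4 * y := by
  have := Real.sqrt_le_sqrt h1
  rw [Real.sqrt_sq hy] at this
  linarith

/-- The value of the sampled instance, through the frequencies of the histograms. -/
theorem symSat_sampleInstance (S : SymRel D r) (ω : Fin ℓ → RSet n r) (ψ : Fin n → D) :
    symSat S (sampleInstance ω) ψ = n.choose r * ∑ g, (S g : ℝ) * mass (freq ω) ψ g := by
  rw [← sum_mul_eq_sum_mass, Finset.mul_sum, symSat]
  refine Finset.sum_congr rfl fun T _ => ?_
  simp only [sampleInstance, freq]
  push_cast
  ring

theorem sat_complete_eq (R : ValuedRel D r) (hn : r ≤ n) (ψ : Fin n → D) :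
    sat R (complete n r) ψ = n.choose r * ∑ g, (Sym R g : ℝ) * prob ψ g := by
  have hN : (0 : ℝ) < n.choose r := by exact_mod_cast Nat.choose_pos hn
  simp_rw [← mass_const ψ]
  rw [sat_complete, ← sum_mul_eq_sum_mass, Finset.mul_sum]
  refine Finset.sum_congr rfl fun T _ => ?_
  field_simp

/-- Closeness of the weighted frequencies gives closeness of the values, for the bundled and for
the symmetric instance. -/
theorem isSparsifier_and_of_abs_sub_le (R : ValuedRel D r) (hn : r ≤ n) (ω : Fin ℓ → RSet n r)
    {ε : ℝ} (h : ∀ ψ : Fin n → D, |∑ g, (Sym R g : ℝ) * mass (freq ω) ψ g -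
      ∑ g, (Sym R g : ℝ) * prob ψ g| ≤ ε * ∑ g, (Sym R g : ℝ) * prob ψ g) :
    IsSparsifier R ε (bundle (sampleInstance ω)) ∧
      ∀ ψ : Fin n → D, symSat (Sym R) (sampleInstance ω) ψ ∈
        Set.Icc ((1 - ε) * sat R (complete n r) ψ) ((1 + ε) * sat R (complete n r) ψ) := by
  have hN : (0 : ℝ) < n.choose r := by exact_mod_cast Nat.choose_pos hn
  have key : ∀ ψ : Fin n → D, symSat (Sym R) (sampleInstance ω) ψ ∈
      Set.Icc ((1 - ε) * sat R (complete n r) ψ) ((1 + ε) * sat R (complete n r) ψ) := by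
    intro ψ
    have h1 := abs_le.1 (h ψ)
    rw [symSat_sampleInstance, sat_complete_eq R hn, Set.mem_Icc]
    constructor <;> nlinarith [h1.1, h1.2]
  exact ⟨fun ψ => by rw [sat_bundle]; exact key ψ, key⟩

theorem numConstraints_bundle_le (ω : Fin ℓ → RSet n r) :
    numConstraints (bundle (sampleInstance ω)) ≤ r ! * ℓ := by
  classical
  unfold numConstraints
  have h1 : (Finset.univ.filter fun x : Fin r ↪ Fin n => bundle (sampleInstance ω) x ≠ 0) ⊆
      Finset.univ.biUnion fun i : Fin ℓ =>
        Finset.univ.filter fun x : Fin r ↪ Fin n => varSet x = ω i := by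
    intro x hx
    have hx' := (Finset.mem_filter.1 hx).2
    simp only [bundle, sampleInstance] at hx'
    have h2 := Nat.cast_ne_zero.1 (right_ne_zero_of_mul hx')
    obtain ⟨i, hi⟩ := Finset.card_ne_zero.1 h2
    simp only [Finset.mem_biUnion, Finset.mem_filter, Finset.mem_univ, true_and]
    exact ⟨i, (Finset.mem_filter.1 hi).2.symm⟩
  refine (Finset.card_le_card h1).trans (Finset.card_biUnion_le.trans ?_)
  -- The orderings of a set are the tuples on which the constant assignment is read off.
  have h2 : ∀ T : RSet n r,
      (Finset.univ.filter fun x : Fin r ↪ Fin n => varSet x = T).card = r ! := by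
    intro T
    have h := card_orderings (fun _ : Fin n => ()) T (fun _ => ()) (by
      apply Subtype.ext
      funext d
      simp [hist, histOn, T.2])
    simp only [and_true, Finset.univ_unique, Finset.prod_singleton] at h
    rw [h]
    simp [hist, histOn]
  rw [Finset.sum_congr rfl fun i _ => h2 (ω i)]
  simp [mul_comm]

end Sampling

/-! ### Tight and rigid histograms, merging of colors -/

section Combinatorics

variable {D : Type*} [Fintype D] {r k : ℕ}

theorem Hist.apply_le (g : Hist D r) (d : D) : g.1 d ≤ r := by
  conv_rhs => rw [← g.2]
  exact Finset.single_le_sum (f := g.1) (fun _ _ => Nat.zero_le _) (Finset.mem_univ d)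

variable [DecidableEq D]

theorem LeOff.sum_le {E : Finset D} {g h : Hist D r} (hgh : LeOff E g h) :
    ∑ e ∈ E, h.1 e ≤ ∑ e ∈ E, g.1 e := by
  have h1 := Finset.sum_add_sum_compl E g.1
  have h2 := Finset.sum_add_sum_compl E h.1
  have h3 : ∑ e ∈ Eᶜ, g.1 e ≤ ∑ e ∈ Eᶜ, h.1 e :=
    Finset.sum_le_sum fun e he => hgh e (Finset.mem_compl.1 he)
  have := g.2
  have := h.2
  omega

theorem LeOff.eq_of_sum_le {E : Finset D} {g h : Hist D r} (hgh : LeOff E g h)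
    (hs : ∑ e ∈ E, g.1 e ≤ ∑ e ∈ E, h.1 e) : ∀ e, e ∉ E → g.1 e = h.1 e := by
  have h1 := Finset.sum_add_sum_compl E g.1
  have h2 := Finset.sum_add_sum_compl E h.1
  have h3 : ∑ e ∈ Eᶜ, g.1 e ≤ ∑ e ∈ Eᶜ, h.1 e :=
    Finset.sum_le_sum fun e he => hgh e (Finset.mem_compl.1 he)
  have h4 := g.2
  have h5 := h.2
  have h6 : ∑ e ∈ Eᶜ, g.1 e = ∑ e ∈ Eᶜ, h.1 e := by omega
  intro e he
  exact (Finset.sum_eq_sum_iff_of_le fun e he => hgh e (Finset.mem_compl.1 he)).1 h6 e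
    (Finset.mem_compl.2 he)

theorem LeOff.eq_of_apply_le {d : D} {g h : Hist D r} (hgh : LeOff {d} g h)
    (hs : g.1 d ≤ h.1 d) : g = h := by
  have h1 := hgh.eq_of_sum_le (by simpa using hs)
  have h2 := hgh.sum_le
  simp only [Finset.sum_singleton] at h2
  apply Subtype.ext
  funext e
  by_cases he : e = d
  · rw [he]
    omega
  · exact h1 e (by simpa using he)

/-- If `h` and `d` refute `(k + 1)`-plentifulness, the histogram which `k`-plentifulness provides
for them is tight. -/
theorem PreciselyPlentiful.exists_tight {S : SymRel D r} (hS : PreciselyPlentiful S k) :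
    ∃ (d : D) (h : Hist D r), Tight S d k h := by
  obtain ⟨h1, h2⟩ := hS
  unfold Plentiful at h2
  push Not at h2
  obtain ⟨d, h, hh, hmax⟩ := h2
  obtain ⟨g, hg, hgh, hgk⟩ := h1 d h hh
  have hgd : g.1 d = k := by
    have := hmax g hg hgh
    omega
  refine ⟨d, g, hg, fun g' hg' hle => ?_, hgd⟩
  apply hle.eq_of_apply_le
  have := hmax g' hg' fun e he => (hle e he).trans (hgh e he)
  omega

theorem PreciselyPlentiful.le {S : SymRel D r} (hS : PreciselyPlentiful S k) : k ≤ r := by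
  obtain ⟨d, h, ht⟩ := hS.exists_tight
  rw [← ht.2.2]
  exact h.apply_le d

/-- When the colors in `E` are abundant and no fitting histogram of the support exceeds `k` at
`d`, the fitting histograms with value `k` at `d` are tight and rigid, as soon as they vanish on
the rest of `E`. -/
theorem tight_and_rigid_of_fits {S : SymRel D r} (hS : Plentiful S k) {N : D → ℕ} {d : D}
    {E : Finset D} (hd : d ∈ E) (hE : ∀ e ∈ E, r ≤ N e)
    (hA : ∀ g : Hist D r, S g ≠ 0 → (∀ e, g.1 e ≤ N e) → g.1 d ≤ k)
    (hB : ∀ g : Hist D r, S g ≠ 0 → (∀ e, g.1 e ≤ N e) → g.1 d = k →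
      ∀ e ∈ E, e ≠ d → g.1 e = 0)
    {h : Hist D r} (hh : S h ≠ 0) (hfit : ∀ e, h.1 e ≤ N e) (hk : h.1 d = k) :
    Tight S d k h ∧ Rigid S d E h := by
  have hfit' : ∀ (F : Finset D), F ⊆ E → ∀ g g' : Hist D r, (∀ e, g'.1 e ≤ N e) → LeOff F g g' →
      ∀ e, g.1 e ≤ N e := by
    intro F hF g g' hg' hle e
    by_cases he : e ∈ F
    · exact (g.apply_le e).trans (hE e (hF he))
    · exact (hle e he).trans (hg' e)
  have hdE : {d} ⊆ E := by simpa using hd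
  refine ⟨⟨hh, fun g hg hle => ?_, hk⟩, hh, hd, hB h hh hfit hk, fun g hg hle => ?_⟩
  · apply hle.eq_of_apply_le
    rw [hk]
    exact hA g hg (hfit' _ hdE g h hfit hle)
  · have hgfit := hfit' E le_rfl g h hfit hle
    obtain ⟨g', hg', hle', hk'⟩ := hS d g hg
    have hg'fit := hfit' _ hdE g' g hgfit hle'
    have hg'k : g'.1 d = k := le_antisymm (hA g' hg' hg'fit) hk'
    have hzero := hB g' hg' hg'fit hg'k
    have hsum : ∀ f : Hist D r, (∀ e ∈ E, e ≠ d → f.1 e = 0) → ∑ e ∈ E, f.1 e = f.1 d :=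
      fun f hf => Finset.sum_eq_single_of_mem d hd hf
    have hle'' : LeOff E g' h := fun e he =>
      (hle' e (by simpa using fun h : e = d => he (h ▸ hd))).trans (hle e he)
    have h1 := hle.sum_le
    rw [hsum h (hB h hh hfit hk)] at h1
    -- Outside `E`, `g'` agrees with `h`, and `g` lies between the two.
    have h2 := hle''.eq_of_sum_le (by rw [hsum g' hzero, hsum h (hB h hh hfit hk), hg'k, hk])
    have h3 : ∑ e ∈ Eᶜ, g.1 e = ∑ e ∈ Eᶜ, h.1 e := by
      refine Finset.sum_congr rfl fun e he => ?_
      rw [Finset.mem_compl] at he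
      have := h2 e he
      have := hle e he
      have := hle' e (by simpa using fun h : e = d => he (h ▸ hd))
      omega
    have h4 := Finset.sum_add_sum_compl E g.1
    have h5 := Finset.sum_add_sum_compl E h.1
    have h6 := g.2
    have h7 := h.2
    have h8 := hsum h (hB h hh hfit hk)
    omega

/-- The histogram obtained by recoloring the colors in `E` with `d`. -/
def collapse (d : D) (E : Finset D) (hd : d ∈ E) (g : Hist D r) : Hist D r :=
  ⟨fun e => if e = d then ∑ e ∈ E, g.1 e else if e ∈ E then 0 else g.1 e, by
    conv_rhs => rw [← g.2, ← Finset.sum_add_sum_compl E g.1]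
    rw [← Finset.sum_add_sum_compl E]
    congr 1
    · rw [Finset.sum_eq_single_of_mem d hd]
      · simp
      · intro e he hed
        simp [he, hed]
    · refine Finset.sum_congr rfl fun e he => ?_
      rw [Finset.mem_compl] at he
      have : e ≠ d := fun h => he (h ▸ hd)
      simp [he, this]⟩

theorem collapse_self {d : D} {E : Finset D} (hd : d ∈ E) (g : Hist D r) :
    (collapse d E hd g).1 d = ∑ e ∈ E, g.1 e := by simp [collapse]

theorem collapse_of_mem {d e : D} {E : Finset D} (hd : d ∈ E) (he : e ∈ E) (hed : e ≠ d)
    (g : Hist D r) : (collapse d E hd g).1 e = 0 := by simp [collapse, he, hed]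

theorem collapse_of_notMem {d e : D} {E : Finset D} (hd : d ∈ E) (he : e ∉ E) (g : Hist D r) :
    (collapse d E hd g).1 e = g.1 e := by
  have : e ≠ d := fun h => he (h ▸ hd)
  simp [collapse, he, this]

/-- The assignment obtained by recoloring the colors in `E` with `d`. -/
def collapseAssign {n : ℕ} (d : D) (E : Finset D) (ψ : Fin n → D) (i : Fin n) : D :=
  if ψ i ∈ E then d else ψ i

theorem histOn_collapseAssign {n : ℕ} {d : D} {E : Finset D} (hd : d ∈ E) (ψ : Fin n → D)
    (T : RSet n r) : histOn (collapseAssign d E ψ) T.1 T.2 = collapse d E hd (histOn ψ T.1 T.2) := by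
  apply Subtype.ext
  funext e
  change (T.1.filter fun i => collapseAssign d E ψ i = e).card = _
  by_cases hed : e = d
  · subst hed
    rw [collapse_self]
    change _ = ∑ e ∈ E, (T.1.filter fun i => ψ i = e).card
    have h1 : (T.1.filter fun i => collapseAssign e E ψ i = e) = T.1.filter fun i => ψ i ∈ E := by
      refine Finset.filter_congr fun i _ => ?_
      unfold collapseAssign
      split_ifs with h
      · simp [h]
      · simp only [h, iff_false]
        exact fun h' => h (h' ▸ hd)
    rw [h1, Finset.card_eq_sum_card_fiberwise (f := ψ) (t := E)
      (fun i hi => Finset.mem_coe.2 (Finset.mem_filter.1 (Finset.mem_coe.1 hi)).2)]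
    refine Finset.sum_congr rfl fun c hc => ?_
    rw [Finset.filter_filter]
    congr 1
    refine Finset.filter_congr fun i _ => ?_
    constructor
    · exact fun h => h.2
    · rintro rfl
      exact ⟨hc, rfl⟩
  · by_cases heE : e ∈ E
    · rw [collapse_of_mem hd heE hed, Finset.card_eq_zero, Finset.filter_eq_empty_iff]
      intro i _
      unfold collapseAssign
      split_ifs with h
      · exact fun h' => hed h'.symm
      · exact fun h' => h (h' ▸ heE)
    · rw [collapse_of_notMem hd heE]
      change _ = (T.1.filter fun i => ψ i = e).card
      congr 1
      refine Finset.filter_congr fun i _ => ?_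
      unfold collapseAssign
      split_ifs with h
      · constructor
        · exact fun h' => absurd h'.symm hed
        · exact fun h' => absurd (h' ▸ h) heE
      · rfl

/-- Marginal uniformity: `S` does not distinguish the histograms that collapse to the same
tight and rigid one. -/
theorem MarginallyUniform.eq_of_collapse_eq {S : SymRel D r} (hu : MarginallyUniform S k) {d : D}
    {E : Finset D} (hd : d ∈ E) {h : Hist D r} (ht : Tight S d k h) (hr : Rigid S d E h)
    {g : Hist D r} (hg : collapse d E hd g = h) : S g = S h := by
  have hsum := sum_eq_of_tight_of_rigid ht hr
  have hglue : ∀ (f : Hist D r) (hf : ∑ e ∈ E, f.1 e = k), (∀ e, e ∉ E → f.1 e = h.1 e) →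
      glue h E hsum ⟨fun e => f.1 e.1, by rw [Finset.sum_coe_sort E f.1, hf]⟩ = f := by
    intro f hf hoff
    apply Subtype.ext
    funext e
    simp only [glue]
    split_ifs with he
    · rfl
    · exact (hoff e he).symm
  have hgE : ∑ e ∈ E, g.1 e = k := by
    rw [← collapse_self hd, hg, ht.2.2]
  have hoff : ∀ e, e ∉ E → g.1 e = h.1 e := fun e he => by
    rw [← hg, collapse_of_notMem hd he]
  have := hu d E h ht hr ⟨fun e => g.1 e.1, by rw [Finset.sum_coe_sort E g.1, hgE]⟩
    ⟨fun e => h.1 e.1, by rw [Finset.sum_coe_sort E h.1, hsum]⟩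
  unfold marginal at this
  rwa [hglue g hgE hoff, hglue h hsum fun _ _ => rfl] at this

variable {n : ℕ}

theorem mass_collapseAssign {d : D} {E : Finset D} (hd : d ∈ E) (w : RSet n r → ℝ)
    (ψ : Fin n → D) (h : Hist D r) : mass w (collapseAssign d E ψ) h =
      ∑ g ∈ Finset.univ.filter (fun g => collapse d E hd g = h), mass w ψ g := by
  unfold mass
  rw [← Finset.sum_fiberwise_of_maps_to (s := Finset.univ.filter fun T : RSet n r =>
      histOn (collapseAssign d E ψ) T.1 T.2 = h) (g := fun T => histOn ψ T.1 T.2)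
      (t := Finset.univ.filter (fun g => collapse d E hd g = h))]
  · refine Finset.sum_congr rfl fun g hg => Finset.sum_congr ?_ fun _ _ => rfl
    rw [Finset.filter_filter]
    refine Finset.filter_congr fun T _ => ?_
    rw [histOn_collapseAssign hd]
    constructor
    · exact fun h => h.2
    · rintro rfl
      exact ⟨(Finset.mem_filter.1 hg).2, rfl⟩
  · intro T hT
    rw [Finset.mem_filter] at hT ⊢
    rw [← histOn_collapseAssign hd]
    exact ⟨Finset.mem_univ _, hT.2⟩

theorem mass_le_mass_collapseAssign {d : D} {E : Finset D} (hd : d ∈ E) {w : RSet n r → ℝ}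
    (hw : ∀ T, 0 ≤ w T) (ψ : Fin n → D) (g : Hist D r) :
    mass w ψ g ≤ mass w (collapseAssign d E ψ) (collapse d E hd g) := by
  rw [mass_collapseAssign hd]
  exact Finset.single_le_sum (f := fun g => mass w ψ g) (fun g _ => mass_nonneg hw ψ g)
    (by simp)

theorem prob_le_prob_collapseAssign {d : D} {E : Finset D} (hd : d ∈ E)
    (ψ : Fin n → D) (g : Hist D r) :
    prob ψ g ≤ prob (collapseAssign d E ψ) (collapse d E hd g) := by
  rw [← mass_const, ← mass_const]
  exact mass_le_mass_collapseAssign hd (fun _ => by positivity) ψ g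

/-- Deviations may be measured after merging the colors of `E` wherever `S` does not
distinguish them. -/
theorem abs_sum_sub_le_of_collapse {d : D} {E : Finset D} (hd : d ∈ E) (S : SymRel D r)
    (w : RSet n r → ℝ) (ψ : Fin n → D) (H : Finset (Hist D r))
    (hH : ∀ h ∈ H, ∀ g, collapse d E hd g = h → S g = S h) {b : ℝ}
    (h1 : ∀ h ∈ H, |mass w (collapseAssign d E ψ) h - prob (collapseAssign d E ψ) h| ≤ b)
    (h2 : ∀ g, S g ≠ 0 → collapse d E hd g ∉ H → |mass w ψ g - prob ψ g| ≤ b) (hb : 0 ≤ b) :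
    |∑ g, (S g : ℝ) * mass w ψ g - ∑ g, (S g : ℝ) * prob ψ g| ≤ 2 * ((∑ g, (S g : ℝ)) * b) := by
  have e1 : ∑ g, (S g : ℝ) * mass w ψ g - ∑ g, (S g : ℝ) * prob ψ g =
      ∑ g, (S g : ℝ) * (mass w ψ g - prob ψ g) := by
    rw [← Finset.sum_sub_distrib]
    exact Finset.sum_congr rfl fun g _ => by ring
  have e2 : ∑ g ∈ Finset.univ.filter (fun g => collapse d E hd g ∈ H),
      (S g : ℝ) * (mass w ψ g - prob ψ g) =
      ∑ h ∈ H, (S h : ℝ) *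
        (mass w (collapseAssign d E ψ) h - prob (collapseAssign d E ψ) h) := by
    rw [← Finset.sum_fiberwise_of_maps_to (g := collapse d E hd) (t := H)
      (fun g hg => (Finset.mem_filter.1 hg).2)]
    refine Finset.sum_congr rfl fun h hh => ?_
    rw [← mass_const, mass_collapseAssign hd, mass_collapseAssign hd, ← Finset.sum_sub_distrib,
      Finset.mul_sum, Finset.filter_filter]
    have e3 : (Finset.univ.filter fun g => collapse d E hd g ∈ H ∧ collapse d E hd g = h) =
        Finset.univ.filter fun g => collapse d E hd g = h := by
      refine Finset.filter_congr fun g _ => ?_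
      constructor
      · exact fun h => h.2
      · exact fun hg => ⟨hg ▸ hh, hg⟩
    rw [e3]
    refine Finset.sum_congr rfl fun g hg => ?_
    rw [hH h hh g (Finset.mem_filter.1 hg).2, mass_const]
  have b1 : |∑ h ∈ H, (S h : ℝ) *
      (mass w (collapseAssign d E ψ) h - prob (collapseAssign d E ψ) h)| ≤
      (∑ g, (S g : ℝ)) * b := by
    rw [Finset.sum_mul]
    refine (Finset.abs_sum_le_sum_abs _ _).trans ((Finset.sum_le_sum fun h hh => ?_).trans
      (Finset.sum_le_sum_of_subset_of_nonneg (Finset.subset_univ H)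
        fun h _ _ => mul_nonneg (Nat.cast_nonneg (S h)) hb))
    rw [abs_mul, Nat.abs_cast]
    exact mul_le_mul_of_nonneg_left (h1 h hh) (Nat.cast_nonneg _)
  have b2 : |∑ g ∈ Finset.univ.filter (fun g => ¬ collapse d E hd g ∈ H),
      (S g : ℝ) * (mass w ψ g - prob ψ g)| ≤ (∑ g, (S g : ℝ)) * b := by
    rw [Finset.sum_mul]
    refine (Finset.abs_sum_le_sum_abs _ _).trans ((Finset.sum_le_sum fun g hg => ?_).trans
      (Finset.sum_le_sum_of_subset_of_nonneg (Finset.subset_univ _)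
        fun h _ _ => mul_nonneg (Nat.cast_nonneg (S h)) hb))
    rw [abs_mul, Nat.abs_cast]
    by_cases hg0 : S g = 0
    · simp [hg0]
    · exact mul_le_mul_of_nonneg_left (h2 g hg0 (Finset.mem_filter.1 hg).2) (Nat.cast_nonneg _)
  rw [e1, ← Finset.sum_filter_add_sum_filter_not Finset.univ
    (fun g => collapse d E hd g ∈ H), e2]
  refine (abs_add_le _ _).trans ?_
  linarith

/-! ### Bounds on the value of an assignment -/

theorem exists_large_color [Nonempty D] (ψ : Fin n → D) :
    ∃ d, n ≤ Fintype.card D * colorCount ψ d := by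
  obtain ⟨d, _, hd⟩ := Finset.exists_max_image Finset.univ (colorCount ψ) Finset.univ_nonempty
  refine ⟨d, ?_⟩
  conv_lhs => rw [← sum_colorCount ψ]
  rw [← Finset.card_univ, ← smul_eq_mul]
  exact Finset.sum_le_card_nsmul _ _ _ fun e he => hd e he

/-- The expected value of `S` on a uniformly random set. -/
noncomputable def value (S : SymRel D r) (ψ : Fin n → D) : ℝ := ∑ g, (S g : ℝ) * prob ψ g

theorem value_nonneg (S : SymRel D r) (ψ : Fin n → D) : 0 ≤ value S ψ :=
  Finset.sum_nonneg fun g _ => mul_nonneg (Nat.cast_nonneg _) (prob_nonneg ψ g)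

theorem sum_prob_le_value {S : SymRel D r} (ψ : Fin n → D) (G : Finset (Hist D r))
    (hG : ∀ g ∈ G, S g ≠ 0) : ∑ g ∈ G, prob ψ g ≤ value S ψ := by
  refine (Finset.sum_le_sum fun g hg => ?_).trans
    (Finset.sum_le_sum_of_subset_of_nonneg (Finset.subset_univ G)
      fun g _ _ => mul_nonneg (Nat.cast_nonneg _) (prob_nonneg ψ g))
  have h1 : (1 : ℝ) ≤ S g := by exact_mod_cast Nat.one_le_iff_ne_zero.2 (hG g hg)
  have := prob_nonneg ψ g
  nlinarith

theorem prob_le_value {S : SymRel D r} (ψ : Fin n → D) {g : Hist D r} (hg : S g ≠ 0) :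
    prob ψ g ≤ value S ψ := by
  have := sum_prob_le_value ψ {g} (S := S) (by simpa using hg)
  simpa using this

/-- The factor lost when the value of an assignment is bounded below by the monomial in the color
counts of a fitting histogram, one of whose colors is used at least `n / |D|` times. -/
def boundConst (D : Type*) [Fintype D] (r : ℕ) : ℕ := r ^ r * r ! * Fintype.card D ^ r

theorem le_value {S : SymRel D r} (hn : r ≤ n) {ψ : Fin n → D} {d : D}
    (hd : n ≤ Fintype.card D * colorCount ψ d) {h : Hist D r} (hh : S h ≠ 0)
    (hfit : ∀ e, h.1 e ≤ colorCount ψ e) :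
    (n : ℝ) ^ h.1 d * ∏ e ∈ Finset.univ.erase d, (colorCount ψ e : ℝ) ^ h.1 e ≤
      boundConst D r * (value S ψ * (n : ℝ) ^ r) := by
  have h1 := le_prob ψ h hfit hn
  have h2 : (n : ℝ) ^ h.1 d ≤ (Fintype.card D : ℝ) ^ r * (colorCount ψ d : ℝ) ^ h.1 d := by
    have h3 : (1 : ℝ) ≤ Fintype.card D := by
      exact_mod_cast Fintype.card_pos_iff.2 ⟨d⟩
    have h4 : (n : ℝ) ≤ Fintype.card D * colorCount ψ d := by exact_mod_cast hd
    calc (n : ℝ) ^ h.1 d ≤ (Fintype.card D * colorCount ψ d : ℝ) ^ h.1 d :=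
          pow_le_pow_left₀ (Nat.cast_nonneg _) h4 _
      _ = (Fintype.card D : ℝ) ^ h.1 d * (colorCount ψ d : ℝ) ^ h.1 d := mul_pow _ _ _
      _ ≤ _ := by
          gcongr
          exact h.apply_le d
  have h5 : 0 ≤ ∏ e ∈ Finset.univ.erase d, (colorCount ψ e : ℝ) ^ h.1 e :=
    Finset.prod_nonneg fun e _ => by positivity
  calc _ ≤ ((Fintype.card D : ℝ) ^ r * (colorCount ψ d : ℝ) ^ h.1 d) *
        ∏ e ∈ Finset.univ.erase d, (colorCount ψ e : ℝ) ^ h.1 e :=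
        mul_le_mul_of_nonneg_right h2 h5
    _ = (Fintype.card D : ℝ) ^ r * ∏ e, (colorCount ψ e : ℝ) ^ h.1 e := by
        rw [mul_assoc, Finset.mul_prod_erase Finset.univ (fun e => (colorCount ψ e : ℝ) ^ h.1 e)
          (Finset.mem_univ d)]
    _ ≤ (Fintype.card D : ℝ) ^ r * ((r ^ r * r ! : ℕ) * (prob ψ h * (n : ℝ) ^ r)) :=
        mul_le_mul_of_nonneg_left h1 (by positivity)
    _ ≤ (Fintype.card D : ℝ) ^ r * ((r ^ r * r ! : ℕ) * (value S ψ * (n : ℝ) ^ r)) := by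
        gcongr
        exact prob_le_value ψ hh
    _ = _ := by
        rw [boundConst]
        push_cast
        ring

theorem one_le_prod_of_fits {ψ : Fin n → D} {h : Hist D r} (hfit : ∀ e, h.1 e ≤ colorCount ψ e)
    (s : Finset D) : 1 ≤ ∏ e ∈ s, (colorCount ψ e : ℝ) ^ h.1 e := by
  exact_mod_cast Finset.one_le_prod'' fun e => by
    rcases Nat.eq_zero_or_pos (h.1 e) with h0 | h0
    · simp [h0]
    · exact Nat.one_le_pow _ _ (h0.trans_le (hfit e))

theorem pow_le_value {S : SymRel D r} (hn : r ≤ n) {ψ : Fin n → D} {d : D}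
    (hd : n ≤ Fintype.card D * colorCount ψ d) {h : Hist D r} (hh : S h ≠ 0)
    (hfit : ∀ e, h.1 e ≤ colorCount ψ e) :
    (n : ℝ) ^ h.1 d ≤ boundConst D r * (value S ψ * (n : ℝ) ^ r) :=
  (le_mul_of_one_le_right (by positivity) (one_le_prod_of_fits hfit _)).trans
    (le_value hn hd hh hfit)

/-- A large color can be made to occur `k` times. -/
theorem Plentiful.exists_fits {S : SymRel D r} (hS : Plentiful S k) {N : D → ℕ} {d : D}
    (hd : r ≤ N d) {h : Hist D r} (hh : S h ≠ 0) (hfit : ∀ e, h.1 e ≤ N e) :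
    ∃ g : Hist D r, S g ≠ 0 ∧ LeOff {d} g h ∧ k ≤ g.1 d ∧ ∀ e, g.1 e ≤ N e := by
  obtain ⟨g, hg, hle, hk⟩ := hS d h hh
  refine ⟨g, hg, hle, hk, fun e => ?_⟩
  by_cases he : e = d
  · rw [he]
    exact (g.apply_le d).trans hd
  · exact (hle e (by simpa using he)).trans (hfit e)

end Combinatorics

/-! ### Marginal uniformity: the frequencies determine the values -/

section Deterministic

variable {D : Type*} [Fintype D] [DecidableEq D] {n r k : ℕ}

/-- The number of variables, plus one, whose color differs from `d`: up to a logarithmic factor,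
the entropy of the assignments of this kind. -/
def complexity (d : D) (χ : Fin n → D) : ℕ := 1 + (Finset.univ.filter fun i => χ i ≠ d).card

theorem complexity_le {D : Type*} [DecidableEq D] (d : D) (χ : Fin n → D) :
    complexity d χ ≤ 1 + n := by
  unfold complexity
  gcongr
  exact (Finset.card_filter_le _ _).trans (by simp)

theorem complexity_collapseAssign_le (d : D) {E : Finset D} (ψ : Fin n → D)
    {Y : ℝ} (hY : ∀ e, e ∉ E → (colorCount ψ e : ℝ) ≤ Y) (h1 : 1 ≤ Y) :
    (complexity d (collapseAssign d E ψ) : ℝ) ≤ (1 + Fintype.card D) * Y := by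
  have e1 : (Finset.univ.filter fun i => collapseAssign d E ψ i ≠ d).card ≤
      ∑ e ∈ Eᶜ, colorCount ψ e := by
    have e2 : (Finset.univ.filter fun i => collapseAssign d E ψ i ≠ d) ⊆
        Finset.univ.filter fun i => ψ i ∈ Eᶜ := by
      intro i hi
      simp only [Finset.mem_filter, Finset.mem_univ, true_and, Finset.mem_compl] at hi ⊢
      intro h
      exact hi (by simp [collapseAssign, h])
    refine (Finset.card_le_card e2).trans ?_
    rw [Finset.card_eq_sum_card_fiberwise (f := ψ) (t := Eᶜ)
      (fun i hi => Finset.mem_coe.2 (Finset.mem_filter.1 (Finset.mem_coe.1 hi)).2)]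
    exact Finset.sum_le_sum fun e _ => Finset.card_le_card
      (Finset.filter_subset_filter _ (Finset.filter_subset _ _))
  have e3 : (∑ e ∈ Eᶜ, (colorCount ψ e : ℝ)) ≤ Fintype.card D * Y := by
    calc (∑ e ∈ Eᶜ, (colorCount ψ e : ℝ)) ≤ ∑ e ∈ Eᶜ, Y :=
          Finset.sum_le_sum fun e he => hY e (Finset.mem_compl.1 he)
      _ = (Eᶜ.card : ℝ) * Y := by rw [Finset.sum_const, nsmul_eq_mul]
      _ ≤ _ := by
          gcongr
          exact Finset.card_le_univ _
  have e4 : ((Finset.univ.filter fun i => collapseAssign d E ψ i ≠ d).card : ℝ) ≤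
      ∑ e ∈ Eᶜ, (colorCount ψ e : ℝ) := by exact_mod_cast e1
  unfold complexity
  push_cast
  linarith

theorem colorCount_collapseAssign {D : Type*} [DecidableEq D] {d e : D} {E : Finset D}
    (hd : d ∈ E) (he : e ∉ E)
    (ψ : Fin n → D) : colorCount (collapseAssign d E ψ) e = colorCount ψ e := by
  unfold colorCount
  congr 1
  refine Finset.filter_congr fun i _ => ?_
  unfold collapseAssign
  split_ifs with h
  · constructor
    · rintro rfl
      exact absurd hd he
    · rintro rfl
      exact absurd h he
  · rfl

/-- A collapsed histogram that exceeds `h` outside `E` is rare: each excess replaces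
a factor `n` by a factor `Y`. -/
theorem prob_collapse_le (hn : r ≤ n) {d : D} {E : Finset D} (hd : d ∈ E) (ψ : Fin n → D)
    {Y : ℝ} (hY : ∀ e, e ∉ E → (colorCount ψ e : ℝ) ≤ Y) (hYn : Y ≤ n) (hY0 : 0 ≤ Y)
    {g h : Hist D r} (hfit : ∀ e, h.1 e ≤ colorCount ψ e)
    (hzero : ∀ e ∈ E, e ≠ d → h.1 e = 0) (hle : LeOff {d} h g)
    (hne : collapse d E hd g ≠ h) :
    1 ≤ h.1 d ∧ prob (collapseAssign d E ψ) (collapse d E hd g) * (n : ℝ) ^ r ≤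
      (r ^ r * r ! : ℕ) * ((n : ℝ) ^ (h.1 d - 1) *
        (∏ e ∈ Finset.univ.erase d, (colorCount ψ e : ℝ) ^ h.1 e) * Y) := by
  have hleE : ∀ e ∈ Eᶜ, h.1 e ≤ g.1 e := fun e he => by
    rw [Finset.mem_compl] at he
    exact hle e (by simpa using fun h : e = d => he (h ▸ hd))
  have hsumh : ∑ e ∈ E, h.1 e = h.1 d := Finset.sum_eq_single_of_mem d hd hzero
  -- The excess of `g` over `h` outside `E`.
  obtain ⟨j, hj⟩ : ∃ j, ∑ e ∈ Eᶜ, (g.1 e - h.1 e) = j := ⟨_, rfl⟩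
  have hsplit : ∑ e ∈ Eᶜ, (g.1 e - h.1 e) + ∑ e ∈ Eᶜ, h.1 e = ∑ e ∈ Eᶜ, g.1 e := by
    rw [← Finset.sum_add_distrib]
    exact Finset.sum_congr rfl fun e he => Nat.sub_add_cancel (hleE e he)
  have hg := Finset.sum_add_sum_compl E g.1
  have hh := Finset.sum_add_sum_compl E h.1
  have hg2 := g.2
  have hh2 := h.2
  have hkj : ∑ e ∈ E, g.1 e + j = h.1 d := by omega
  have hjpos : 1 ≤ j := by
    by_contra hj0
    have hj0 : j = 0 := by omega
    apply hne
    apply Subtype.ext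
    funext e
    by_cases hed : e = d
    · rw [hed, collapse_self]
      omega
    by_cases he : e ∈ E
    · rw [collapse_of_mem hd he hed, hzero e he hed]
    · rw [collapse_of_notMem hd he]
      have h1 := (Finset.sum_eq_zero_iff.1 (hj.trans hj0)) e (Finset.mem_compl.2 he)
      have h2 := hleE e (Finset.mem_compl.2 he)
      omega
  refine ⟨by omega, (prob_mul_pow_le _ _ hn).trans ?_⟩
  apply mul_le_mul_of_nonneg_left _ (Nat.cast_nonneg _)
  have e1 : ∏ e, (colorCount (collapseAssign d E ψ) e : ℝ) ^ (collapse d E hd g).1 e ≤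
      (n : ℝ) ^ (∑ e ∈ E, g.1 e) * ∏ e ∈ Eᶜ, (colorCount ψ e : ℝ) ^ g.1 e := by
    rw [← Finset.prod_mul_prod_compl E]
    apply mul_le_mul
    · rw [Finset.prod_eq_single_of_mem d hd]
      · rw [collapse_self]
        apply pow_le_pow_left₀ (Nat.cast_nonneg _)
        exact_mod_cast colorCount_le _ _
      · intro e he hed
        rw [collapse_of_mem hd he hed, pow_zero]
    · apply le_of_eq
      refine Finset.prod_congr rfl fun e he => ?_
      rw [Finset.mem_compl] at he
      rw [colorCount_collapseAssign hd he, collapse_of_notMem hd he]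
    · exact Finset.prod_nonneg fun e _ => by positivity
    · positivity
  have e2 : ∏ e ∈ Eᶜ, (colorCount ψ e : ℝ) ^ g.1 e ≤
      Y ^ j * ∏ e ∈ Eᶜ, (colorCount ψ e : ℝ) ^ h.1 e := by
    rw [← hj, ← Finset.prod_pow_eq_pow_sum, ← Finset.prod_mul_distrib]
    refine Finset.prod_le_prod (fun e _ => by positivity) fun e he => ?_
    have h1 : g.1 e = (g.1 e - h.1 e) + h.1 e := (Nat.sub_add_cancel (hleE e he)).symm
    conv_lhs => rw [h1, pow_add]
    gcongr
    exact hY e (Finset.mem_compl.1 he)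
  have e3 : ∏ e ∈ Eᶜ, (colorCount ψ e : ℝ) ^ h.1 e ≤
      ∏ e ∈ Finset.univ.erase d, (colorCount ψ e : ℝ) ^ h.1 e := by
    have h1 : Finset.univ.erase d = E.erase d ∪ Eᶜ := by
      ext e
      simp only [Finset.mem_erase, Finset.mem_univ, and_true, Finset.mem_union,
        Finset.mem_compl]
      constructor
      · intro h
        by_cases he : e ∈ E
        · exact Or.inl ⟨h, he⟩
        · exact Or.inr he
      · rintro (h | h)
        · exact h.1
        · exact fun h' => h (h' ▸ hd)
    have h2 : Disjoint (E.erase d) Eᶜ :=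
      Finset.disjoint_of_subset_left (Finset.erase_subset _ _) disjoint_compl_right
    rw [h1, Finset.prod_union h2]
    exact le_mul_of_one_le_left (Finset.prod_nonneg fun e _ => by positivity)
      (one_le_prod_of_fits hfit _)
  have e4 : (n : ℝ) ^ (∑ e ∈ E, g.1 e) * Y ^ j ≤ (n : ℝ) ^ (h.1 d - 1) * Y := by
    have h1 : h.1 d - 1 = (∑ e ∈ E, g.1 e) + (j - 1) := by omega
    have h2 : Y ^ j = Y ^ (j - 1) * Y := by rw [← pow_succ]; congr 1; omega
    rw [h1, h2, pow_add, mul_assoc]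
    gcongr
  have h0 : 0 ≤ ∏ e ∈ Eᶜ, (colorCount ψ e : ℝ) ^ h.1 e :=
    Finset.prod_nonneg fun e _ => by positivity
  calc _ ≤ (n : ℝ) ^ (∑ e ∈ E, g.1 e) * ∏ e ∈ Eᶜ, (colorCount ψ e : ℝ) ^ g.1 e := e1
    _ ≤ (n : ℝ) ^ (∑ e ∈ E, g.1 e) * (Y ^ j * ∏ e ∈ Eᶜ, (colorCount ψ e : ℝ) ^ h.1 e) := by
        gcongr
    _ = ((n : ℝ) ^ (∑ e ∈ E, g.1 e) * Y ^ j) * ∏ e ∈ Eᶜ, (colorCount ψ e : ℝ) ^ h.1 e := by ring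
    _ ≤ ((n : ℝ) ^ (h.1 d - 1) * Y) * ∏ e ∈ Finset.univ.erase d, (colorCount ψ e : ℝ) ^ h.1 e :=
        mul_le_mul e4 e3 h0 (by positivity)
    _ = _ := by ring

theorem abs_sub_le_of_le_of_abs_sub_le {a b A B q t : ℝ} (ha : 0 ≤ a) (hb : 0 ≤ b) (haA : a ≤ A)
    (hbB : b ≤ B) (hB : B ≤ q) (hAB : |A - B| ≤ t) (ht : 0 ≤ t) : |a - b| ≤ q + t := by
  have := abs_le.1 hAB
  rw [abs_le]
  constructor <;> linarith

/-- The choice of the constant that rules the number of samples. -/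
theorem exists_sampling_const {c m C₁ C₂ : ℝ} (hc : 0 < c) (hm : 0 ≤ m) (h1 : 0 ≤ C₁)
    (h2 : 0 ≤ C₂) : ∃ η : ℝ, 0 < η ∧ 4 * (1 + m) * C₁ * η ≤ c ^ 2 ∧ 2 * C₂ * η ≤ c ^ 2 ∧
      2 * C₁ * η ≤ c ^ 2 := by
  have hpos : 0 < 4 * (1 + m) * C₁ + 2 * C₂ + 1 := by positivity
  obtain ⟨η, hη⟩ : ∃ η, η = c ^ 2 / (4 * (1 + m) * C₁ + 2 * C₂ + 1) := ⟨_, rfl⟩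
  have hη0 : 0 < η := by rw [hη]; positivity
  have hηeq : η * (4 * (1 + m) * C₁ + 2 * C₂ + 1) = c ^ 2 := by
    rw [hη]
    field_simp
  have e1 : 0 ≤ η * C₁ := by positivity
  have e2 : 0 ≤ η * C₂ := by positivity
  have e3 : 0 ≤ m * (η * C₁) := by positivity
  refine ⟨η, hη0, ?_, ?_, ?_⟩ <;> nlinarith

set_option maxHeartbeats 1000000 in
/-- The frequencies of histograms of all assignments `χ`, when known up to the error of
Bernstein's inequality at the confidence that the complexity of `χ` calls for, determine the value
of every assignment up to a factor `1 ± ε`. The colors that occur more than `Y` times form the set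
`E`, where `Y` is of the order of the value times `n ^ (r - k) / ε`. The histograms that attain
the order of the value are then tight and rigid for `E`, and marginal uniformity allows to merge
the colors in `E`, which makes the complexity drop to the order of `Y`. The other histograms of
the support are rare enough for the bound `1 + n` on the complexity. -/
theorem abs_sum_sub_le_value_of_const {S : SymRel D r} (hk : k < r) (hS : Plentiful S k)
    (hu : MarginallyUniform S k) {m K K' B c C₁ C₂ η : ℝ} (hm : m = Fintype.card D)
    (hK : K = (r ^ r * r ! : ℕ)) (hK' : K' = boundConst D r) (hB : B = ∑ g, (S g : ℝ))
    (hc : c = 1 / (8 * (B + 1))) (hC₁ : C₁ = r * K') (hC₂ : C₂ = K * K' * C₁) (hη0 : 0 < η)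
    (hη1 : 4 * (1 + m) * C₁ * η ≤ c ^ 2) (hη2 : 2 * C₂ * η ≤ c ^ 2)
    (hη3 : 2 * C₁ * η ≤ c ^ 2) {n : ℕ} (hn : r ≤ n) (hmn : Fintype.card D * r ≤ n) {ε : ℝ}
    (hε0 : 0 < ε) (hε1 : ε < 1) {w : RSet n r → ℝ} (hw : ∀ T, 0 ≤ w T)
    (hdev : ∀ (d : D) (χ : Fin n → D) (g : Hist D r), |mass w χ g - prob χ g| ≤
        2 * (√(prob χ g * (η * ε ^ 3 / (n : ℝ) ^ (r - k) * complexity d χ)) +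
          η * ε ^ 3 / (n : ℝ) ^ (r - k) * complexity d χ)) (ψ : Fin n → D) :
    |∑ g, (S g : ℝ) * mass w ψ g - ∑ g, (S g : ℝ) * prob ψ g| ≤
        ε * ∑ g, (S g : ℝ) * prob ψ g := by
  have hB0 : 0 ≤ B := by
    rw [hB]
    exact Finset.sum_nonneg fun g _ => Nat.cast_nonneg _
  have hc0 : 0 < c := by
    rw [hc]
    positivity
  have hc1 : c ≤ 1 := by
    rw [hc, div_le_one (by positivity)]
    linarith
  have hm0 : 0 ≤ m := hm ▸ Nat.cast_nonneg _
  have hK0 : 0 ≤ K := hK ▸ Nat.cast_nonneg _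
  have hK'0 : 0 ≤ K' := hK' ▸ Nat.cast_nonneg _
  have hC₁0 : 0 ≤ C₁ := by
    rw [hC₁]
    positivity
  have hC₂0 : 0 ≤ C₂ := by
    rw [hC₂]
    positivity
  have hcc : c ^ 2 ≤ c := by
    rw [sq]
    exact mul_le_of_le_one_left hc0.le hc1
  have hεε : ε ^ 2 ≤ ε := by
    rw [sq]
    exact mul_le_of_le_one_left hε0.le hε1.le
  have hr1 : 1 ≤ r := by omega
  have hr1' : (1 : ℝ) ≤ r := by exact_mod_cast hr1
  have hn1 : 1 ≤ n := hr1.trans hn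
  have hn1' : (1 : ℝ) ≤ n := by exact_mod_cast hn1
  have hn0 : (0 : ℝ) < n := by linarith
  -- If no histogram of the support fits, both values vanish.
  by_cases hex : ∃ h : Hist D r, S h ≠ 0 ∧ ∀ e, h.1 e ≤ colorCount ψ e
  swap
  · have hz : ∀ g : Hist D r, (S g : ℝ) * mass w ψ g = 0 ∧ (S g : ℝ) * prob ψ g = 0 := by
      intro g
      by_cases hg : S g = 0
      · simp [hg]
      · have hg' : ¬ ∀ e, g.1 e ≤ colorCount ψ e := fun h => hex ⟨g, hg, h⟩
        rw [mass_eq_zero w ψ g hg', prob_eq_zero ψ g hg']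
        simp
    rw [Finset.sum_eq_zero fun g _ => (hz g).1, Finset.sum_eq_zero fun g _ => (hz g).2]
    simp
  obtain ⟨h₀, hh₀, hfit₀⟩ := hex
  have hne : Nonempty D := by
    by_contra hemp
    rw [not_nonempty_iff] at hemp
    have := h₀.2
    simp at this
    omega
  obtain ⟨d, hd⟩ := exists_large_color ψ
  have hm1 : 0 < Fintype.card D := Fintype.card_pos
  have hrd : r ≤ colorCount ψ d := Nat.le_of_mul_le_mul_left (hmn.trans hd) hm1
  change |_ - value S ψ| ≤ ε * value S ψ
  obtain ⟨p, hp⟩ : ∃ x : ℝ, x = value S ψ := ⟨_, rfl⟩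
  rw [← hp]
  have hp0 : 0 ≤ p := hp ▸ value_nonneg S ψ
  -- Powers of `n`: `X = n ^ (r - k)` and `Z = n ^ (r - k - 1)`.
  obtain ⟨X, hX⟩ : ∃ x : ℝ, x = (n : ℝ) ^ (r - k) := ⟨_, rfl⟩
  rw [← hX] at hdev
  obtain ⟨Z, hZ⟩ : ∃ x : ℝ, x = (n : ℝ) ^ (r - k - 1) := ⟨_, rfl⟩
  have hZ0 : 0 < Z := by rw [hZ]; positivity
  have hX0 : 0 < X := by rw [hX]; positivity
  have hXZ : X = n * Z := by
    rw [hX, hZ, ← pow_succ']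
    congr 1
    omega
  have hnX : (n : ℝ) ^ r = (n : ℝ) ^ k * X := by
    rw [hX, ← pow_add]
    congr 1
    omega
  have hnk : (0 : ℝ) < (n : ℝ) ^ k := by positivity
  obtain ⟨s₀, hs₀⟩ : ∃ x : ℝ, x = η * ε ^ 3 / X := ⟨_, rfl⟩
  rw [← hs₀] at hdev
  have hs₀0 : 0 ≤ s₀ := by rw [hs₀]; positivity
  obtain ⟨y, hy⟩ : ∃ x : ℝ, x = c * ε * p := ⟨_, rfl⟩
  have hy0 : 0 ≤ y := by rw [hy]; positivity
  have hyB : 2 * (B * (4 * y)) ≤ ε * p := by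
    have h1 : 8 * (B + 1) * c = 1 := by
      rw [hc]
      field_simp
    have h2 : 0 ≤ ε * p := by positivity
    have h3 : 2 * (B * (4 * y)) = (8 * (B + 1) * c - 8 * c) * (ε * p) := by
      rw [hy]
      ring
    rw [h3, h1]
    have h4 : 0 ≤ c * (ε * p) := by positivity
    linarith
  rw [hB] at hyB
  -- The error for an arbitrary assignment, from the trivial bound on the complexity.
  have hsn : ∀ χ : Fin n → D, s₀ * complexity d χ ≤ 2 * η * ε ^ 3 / Z := by
    intro χ
    have h1 : (complexity d χ : ℝ) ≤ 2 * n := by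
      have : (complexity d χ : ℝ) ≤ 1 + n := by exact_mod_cast complexity_le d χ
      linarith
    calc s₀ * complexity d χ ≤ s₀ * (2 * n) := mul_le_mul_of_nonneg_left h1 hs₀0
      _ = _ := by
        rw [hs₀, hXZ]
        field_simp
  have hs0 : ∀ χ : Fin n → D, 0 ≤ s₀ * complexity d χ := fun χ => by positivity
  rcases le_or_gt ε (C₁ * p * Z) with hcheap | hexp
  · have hs : s₀ * complexity d ψ ≤ 2 * C₁ * η * (ε ^ 2 * p) := by
      refine (hsn ψ).trans ?_
      rw [div_le_iff₀ hZ0]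
      calc 2 * η * ε ^ 3 = 2 * η * ε ^ 2 * ε := by ring
        _ ≤ 2 * η * ε ^ 2 * (C₁ * p * Z) := mul_le_mul_of_nonneg_left hcheap (by positivity)
        _ = _ := by ring
    have hε2p : 0 ≤ ε ^ 2 * p := by positivity
    have hs' : s₀ * complexity d ψ ≤ c ^ 2 * (ε ^ 2 * p) :=
      hs.trans (mul_le_mul_of_nonneg_right hη3 hε2p)
    have hsy : s₀ * complexity d ψ ≤ y := by
      refine hs'.trans ?_
      calc c ^ 2 * (ε ^ 2 * p) ≤ c * (ε * p) := by
            apply mul_le_mul hcc _ hε2p hc0.le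
            exact mul_le_mul_of_nonneg_right hεε hp0
        _ = y := by rw [hy]; ring
    have hbound : ∀ g, S g ≠ 0 → |mass w ψ g - prob ψ g| ≤ 4 * y := by
      intro g hg
      refine (hdev d ψ g).trans (two_mul_sqrt_add_le hy0 ?_ hsy)
      calc prob ψ g * (s₀ * complexity d ψ) ≤ p * (c ^ 2 * (ε ^ 2 * p)) :=
            mul_le_mul (hp ▸ prob_le_value ψ hg) hs' (hs0 ψ) hp0
        _ = y ^ 2 := by rw [hy]; ring
    have := abs_sum_sub_le_of_collapse (Finset.mem_singleton_self d) S w ψ ∅ (by simp)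
      (by simp) (fun g hg _ => hbound g hg) (b := 4 * y) (by positivity)
    change |_ - value S ψ| ≤ _ at this
    rw [← hp] at this
    exact this.trans hyB
  -- Now the value is small.
  obtain ⟨Y, hY⟩ : ∃ x : ℝ, x = C₁ * p * X / ε := ⟨_, rfl⟩
  have hYn : Y ≤ n := by
    rw [hY, hXZ, div_le_iff₀ hε0]
    calc C₁ * p * (n * Z) = n * (C₁ * p * Z) := by ring
      _ ≤ n * ε := mul_le_mul_of_nonneg_left hexp.le hn0.le
  have hP : ∀ h : Hist D r, S h ≠ 0 → (∀ e, h.1 e ≤ colorCount ψ e) → h.1 d = k →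
      ∏ e ∈ Finset.univ.erase d, (colorCount ψ e : ℝ) ^ h.1 e ≤ K' * p * X := by
    intro h hh hfit hhk
    have h1 := le_value hn hd hh hfit
    rw [hhk, hnX, ← hK', ← hp] at h1
    have h2 : (n : ℝ) ^ k * ∏ e ∈ Finset.univ.erase d, (colorCount ψ e : ℝ) ^ h.1 e ≤
        (n : ℝ) ^ k * (K' * p * X) := h1.trans (le_of_eq (by ring))
    exact le_of_mul_le_mul_left h2 hnk
  have hYP : r * (K' * p * X) = ε * Y := by
    rw [hY, hC₁]
    field_simp
  have hA : ∀ g : Hist D r, S g ≠ 0 → (∀ e, g.1 e ≤ colorCount ψ e) → g.1 d ≤ k := by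
    intro g hg hfit
    by_contra hgk
    have h1 := pow_le_value hn hd hg hfit
    rw [← hK', ← hp] at h1
    have h2 : (n : ℝ) ^ (k + 1) ≤ (n : ℝ) ^ g.1 d := pow_le_pow_right₀ hn1' (by omega)
    have h3 : (n : ℝ) ^ (k + 1) * 1 ≤ (n : ℝ) ^ (k + 1) * (K' * p * Z) := by
      rw [mul_one]
      refine h2.trans (h1.trans (le_of_eq ?_))
      rw [hnX, hXZ]
      ring
    have h4 := le_of_mul_le_mul_left h3 (by positivity)
    have h5 : 0 ≤ K' * p * Z := by positivity
    have h6 : K' * p * Z ≤ C₁ * p * Z := by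
      calc K' * p * Z ≤ r * (K' * p * Z) := le_mul_of_one_le_left h5 hr1'
        _ = C₁ * p * Z := by rw [hC₁]; ring
    linarith
  have hex' : ∀ g : Hist D r, S g ≠ 0 → (∀ e, g.1 e ≤ colorCount ψ e) → ∃ h : Hist D r,
      S h ≠ 0 ∧ LeOff {d} h g ∧ h.1 d = k ∧ ∀ e, h.1 e ≤ colorCount ψ e := by
    intro g hg hfit
    obtain ⟨h, hh, hle, hkh, hfit'⟩ := hS.exists_fits hrd hg hfit
    exact ⟨h, hh, hle, le_antisymm (hA h hh hfit') hkh, hfit'⟩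
  have hrY : (r : ℝ) ≤ Y := by
    obtain ⟨h, hh, hle, hkh, hfit'⟩ := hex' h₀ hh₀ hfit₀
    have h1 := (one_le_prod_of_fits hfit' (Finset.univ.erase d)).trans (hP h hh hfit' hkh)
    have h2 : (r : ℝ) * 1 ≤ ε * Y := by
      rw [← hYP]
      exact mul_le_mul_of_nonneg_left h1 (by linarith)
    have h3 : 0 ≤ Y := by rw [hY]; positivity
    linarith [mul_le_of_le_one_left h3 hε1.le]
  have hY1 : 1 ≤ Y := hr1'.trans hrY
  have hY0 : 0 ≤ Y := by linarith
  obtain ⟨E, hE⟩ : ∃ E : Finset D,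
      E = insert d (Finset.univ.filter fun e => Y < colorCount ψ e) := ⟨_, rfl⟩
  have hdE : d ∈ E := hE ▸ Finset.mem_insert_self _ _
  have hElarge : ∀ e ∈ E, r ≤ colorCount ψ e := by
    intro e he
    rcases Finset.mem_insert.1 (hE ▸ he) with rfl | he
    · exact hrd
    · have := (Finset.mem_filter.1 he).2
      exact_mod_cast (hrY.trans this.le)
  have hEsmall : ∀ e, e ∉ E → (colorCount ψ e : ℝ) ≤ Y := by
    intro e he
    by_contra h
    exact he (hE ▸ Finset.mem_insert_of_mem (by simpa using h))
  have hzero : ∀ h : Hist D r, S h ≠ 0 → (∀ e, h.1 e ≤ colorCount ψ e) → h.1 d = k →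
      ∀ e ∈ E, e ≠ d → h.1 e = 0 := by
    intro h hh hfit hhk e he hed
    by_contra h0
    have h1 := hP h hh hfit hhk
    rw [← Finset.mul_prod_erase _ _ (Finset.mem_erase.2 ⟨hed, Finset.mem_univ e⟩)] at h1
    have h2 := one_le_prod_of_fits hfit ((Finset.univ.erase d).erase e)
    have h3 : Y < colorCount ψ e := by
      rcases Finset.mem_insert.1 (hE ▸ he) with h | h
      · exact absurd h hed
      · exact (Finset.mem_filter.1 h).2
    have h4 : (colorCount ψ e : ℝ) ≤ (colorCount ψ e : ℝ) ^ h.1 e :=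
      le_self_pow₀ (by linarith) h0
    have h5 : (colorCount ψ e : ℝ) ≤ K' * p * X := by
      exact (h4.trans (le_mul_of_one_le_right (by positivity) h2)).trans h1
    have h6 : K' * p * X ≤ Y := by
      have h7 : 0 ≤ K' * p * X := by positivity
      calc K' * p * X ≤ r * (K' * p * X) := le_mul_of_one_le_left h7 hr1'
        _ = ε * Y := hYP
        _ ≤ Y := mul_le_of_le_one_left hY0 hε1.le
    linarith
  have htr : ∀ h : Hist D r, S h ≠ 0 → (∀ e, h.1 e ≤ colorCount ψ e) → h.1 d = k →
      Tight S d k h ∧ Rigid S d E h := fun h hh hfit hhk =>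
    tight_and_rigid_of_fits hS hdE hElarge hA hzero hh hfit hhk
  classical
  set H : Finset (Hist D r) := Finset.univ.filter fun h =>
    S h ≠ 0 ∧ (∀ e, h.1 e ≤ colorCount ψ e) ∧ h.1 d = k with hH
  obtain ⟨χ, hχ⟩ : ∃ χ, χ = collapseAssign d E ψ := ⟨_, rfl⟩
  have hunif : ∀ h ∈ H, ∀ g, collapse d E hdE g = h → S g = S h := by
    intro h hh g hg
    obtain ⟨h1, h2, h3⟩ := (Finset.mem_filter.1 hh).2
    obtain ⟨ht, hr⟩ := htr h h1 h2 h3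
    exact hu.eq_of_collapse_eq hdE ht hr hg
  -- The error after merging the colors of `E`.
  have hsχ : s₀ * complexity d χ ≤ (c ^ 2 / 4) * (ε ^ 2 * p) := by
    have h1 := complexity_collapseAssign_le d ψ hEsmall hY1
    rw [← hm, ← hχ] at h1
    calc s₀ * complexity d χ ≤ s₀ * ((1 + m) * Y) := mul_le_mul_of_nonneg_left h1 hs₀0
      _ = (4 * (1 + m) * C₁ * η) / 4 * (ε ^ 2 * p) := by
        rw [hs₀, hY]
        field_simp
      _ ≤ _ := by
        have h2 : 0 ≤ ε ^ 2 * p := by positivity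
        have h3 : (4 * (1 + m) * C₁ * η) / 4 ≤ c ^ 2 / 4 := by linarith
        exact mul_le_mul_of_nonneg_right h3 h2
  have hsχ' : s₀ * complexity d χ ≤ y / 2 := by
    refine hsχ.trans ?_
    have h2 : c ^ 2 / 4 ≤ c / 2 := by linarith
    calc c ^ 2 / 4 * (ε ^ 2 * p) ≤ c / 2 * (ε * p) :=
          mul_le_mul h2 (mul_le_mul_of_nonneg_right hεε hp0) (by positivity) (by positivity)
      _ = y / 2 := by rw [hy]; ring
  have hdevχ : ∀ h, prob χ h ≤ p → |mass w χ h - prob χ h| ≤ 2 * y := by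
    intro h hh
    refine (hdev d χ h).trans ((two_mul_sqrt_add_le (y := y / 2) (by positivity) ?_ hsχ').trans
      (le_of_eq (by ring)))
    calc prob χ h * (s₀ * complexity d χ) ≤ p * (c ^ 2 / 4 * (ε ^ 2 * p)) :=
          mul_le_mul hh hsχ (hs0 χ) hp0
      _ = (y / 2) ^ 2 := by rw [hy]; ring
  have hHprob : ∀ h ∈ H, prob χ h ≤ p := by
    intro h hh
    rw [← mass_const, hχ, mass_collapseAssign hdE]
    simp_rw [mass_const]
    rw [hp]
    apply sum_prob_le_value
    intro g hg
    rw [hunif h hh g (Finset.mem_filter.1 hg).2]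
    exact (Finset.mem_filter.1 hh).2.1
  suffices hrest : ∀ g, S g ≠ 0 → collapse d E hdE g ∉ H → |mass w ψ g - prob ψ g| ≤ 4 * y by
    have := abs_sum_sub_le_of_collapse hdE S w ψ H hunif (b := 4 * y)
      (fun h hh => hχ ▸ (hdevχ h (hHprob h hh)).trans (by linarith)) hrest (by positivity)
    change |_ - value S ψ| ≤ _ at this
    rw [← hp] at this
    exact this.trans hyB
  intro g hg hgH
  by_cases hfit : ∀ e, g.1 e ≤ colorCount ψ e
  swap
  · rw [mass_eq_zero w ψ g hfit, prob_eq_zero ψ g hfit, sub_zero, abs_zero]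
    positivity
  obtain ⟨h, hh, hle, hhk, hhfit⟩ := hex' g hg hfit
  have hne' : collapse d E hdE g ≠ h := fun h' =>
    hgH (by rw [h']; exact Finset.mem_filter.2 ⟨Finset.mem_univ _, hh, hhfit, hhk⟩)
  obtain ⟨hk1, hq_le⟩ := prob_collapse_le hn hdE ψ hEsmall hYn hY0 hhfit (hzero h hh hhfit hhk)
    hle hne'
  obtain ⟨q, hq⟩ : ∃ x : ℝ, x = prob χ (collapse d E hdE g) := ⟨_, rfl⟩
  rw [← hχ, ← hq, ← hK] at hq_le
  have hq0 : 0 ≤ q := hq ▸ prob_nonneg _ _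
  have hpq : prob ψ g ≤ q := by
    rw [hq, hχ]
    exact prob_le_prob_collapseAssign hdE ψ g
  have hmass : mass w ψ g ≤ mass w χ (collapse d E hdE g) := by
    rw [hχ]
    exact mass_le_mass_collapseAssign hdE hw ψ g
  have hq' : q ≤ C₂ * p ^ 2 * Z / ε := by
    rw [hhk] at hq_le hk1
    have h1 : q * ((n : ℝ) ^ k * X) ≤ K * ((n : ℝ) ^ (k - 1) * (K' * p * X) * Y) := by
      rw [← hnX]
      refine hq_le.trans (mul_le_mul_of_nonneg_left ?_ hK0)
      have := hP h hh hhfit hhk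
      gcongr
    have h2 : (n : ℝ) ^ k = (n : ℝ) ^ (k - 1) * n := by
      rw [← pow_succ]
      congr 1
      omega
    have h3 : (0 : ℝ) < (n : ℝ) ^ (k - 1) * n * X := by positivity
    refine le_of_mul_le_mul_right ?_ h3
    rw [← h2]
    refine h1.trans (le_of_eq ?_)
    rw [h2, hY, hC₂]
    field_simp
    rw [hXZ]
    ring
  rcases le_or_gt (C₂ * p * Z) (c * ε ^ 2) with hrare | hfreq
  · -- The histogram is too rare to matter.
    have hqy : q ≤ y := by
      refine hq'.trans ?_
      rw [div_le_iff₀ hε0, hy]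
      calc C₂ * p ^ 2 * Z = p * (C₂ * p * Z) := by ring
        _ ≤ p * (c * ε ^ 2) := mul_le_mul_of_nonneg_left hrare hp0
        _ = _ := by ring
    have hqp : q ≤ p := by
      refine hqy.trans ?_
      rw [hy]
      exact mul_le_of_le_one_left hp0 (mul_le_one₀ hc1 hε0.le hε1.le)
    have h1 := hdevχ (collapse d E hdE g) (by rw [← hq]; exact hqp)
    rw [← hq] at h1
    have h2 := abs_sub_le_of_le_of_abs_sub_le (mass_nonneg hw ψ g) (prob_nonneg ψ g) hmass hpq
      hqy h1 (by linarith)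
    linarith
  · -- The value is large enough for the trivial bound on the complexity.
    have hp1 : 0 < p := by
      rcases hp0.lt_or_eq with h | h
      · exact h
      · rw [← h, mul_zero, zero_mul] at hfreq
        have : 0 < c * ε ^ 2 := by positivity
        linarith
    have hs1 : s₀ * complexity d ψ ≤ y := by
      refine (hsn ψ).trans ?_
      rw [div_le_iff₀ hZ0, hy]
      have h1 : 2 * C₂ * η * (p * Z) ≤ c ^ 2 * (p * Z) :=
        mul_le_mul_of_nonneg_right hη2 (by positivity)
      have h2 : 2 * η * (c * ε ^ 2) ≤ 2 * η * (C₂ * p * Z) :=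
        mul_le_mul_of_nonneg_left hfreq.le (by positivity)
      have h3 : c * (2 * η * ε ^ 2) ≤ c * (c * (p * Z)) := by linarith
      have h4 := le_of_mul_le_mul_left h3 hc0
      calc 2 * η * ε ^ 3 = ε * (2 * η * ε ^ 2) := by ring
        _ ≤ ε * (c * (p * Z)) := mul_le_mul_of_nonneg_left h4 hε0.le
        _ = _ := by ring
    have hs2 : prob ψ g * (s₀ * complexity d ψ) ≤ y ^ 2 := by
      calc prob ψ g * (s₀ * complexity d ψ) ≤ (C₂ * p ^ 2 * Z / ε) * (2 * η * ε ^ 3 / Z) :=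
            mul_le_mul (hpq.trans hq') (hsn ψ) (hs0 ψ) (by positivity)
        _ = 2 * C₂ * η * (ε ^ 2 * p ^ 2) := by
            field_simp
        _ ≤ c ^ 2 * (ε ^ 2 * p ^ 2) := mul_le_mul_of_nonneg_right hη2 (by positivity)
        _ = y ^ 2 := by rw [hy]; ring
    exact (hdev d ψ g).trans (two_mul_sqrt_add_le hy0 hs2 hs1)

theorem abs_sum_sub_le_value {S : SymRel D r} (hk : k < r) (hS : Plentiful S k)
    (hu : MarginallyUniform S k) :
    ∃ η : ℝ, 0 < η ∧ ∀ n : ℕ, r ≤ n → Fintype.card D * r ≤ n → ∀ ε : ℝ, 0 < ε → ε < 1 →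
      ∀ w : RSet n r → ℝ, (∀ T, 0 ≤ w T) →
      (∀ (d : D) (χ : Fin n → D) (g : Hist D r), |mass w χ g - prob χ g| ≤
        2 * (√(prob χ g * (η * ε ^ 3 / (n : ℝ) ^ (r - k) * complexity d χ)) +
          η * ε ^ 3 / (n : ℝ) ^ (r - k) * complexity d χ)) →
      ∀ ψ : Fin n → D, |∑ g, (S g : ℝ) * mass w ψ g - ∑ g, (S g : ℝ) * prob ψ g| ≤
        ε * ∑ g, (S g : ℝ) * prob ψ g := by
  have hB : 0 ≤ ∑ g, (S g : ℝ) := Finset.sum_nonneg fun g _ => Nat.cast_nonneg _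
  obtain ⟨η, hη, h1, h2, h3⟩ := exists_sampling_const (c := 1 / (8 * (∑ g, (S g : ℝ) + 1)))
    (m := Fintype.card D) (C₁ := r * boundConst D r)
    (C₂ := (r ^ r * r ! : ℕ) * boundConst D r * (r * boundConst D r)) (by positivity)
    (by positivity) (by positivity) (by positivity)
  exact ⟨η, hη, fun n hn hmn ε hε0 hε1 w hw hdev ψ => abs_sum_sub_le_value_of_const hk hS hu rfl
    rfl rfl rfl rfl rfl rfl hη h1 h2 h3 hn hmn hε0 hε1 hw hdev ψ⟩

end Deterministic

/-! ### Upper bounds by sampling -/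

section UpperBounds

variable {D : Type*} [Fintype D] [DecidableEq D] {n r k : ℕ}

theorem sum_pow_complexity_le (d : D) {x : ℝ} (hx : 0 ≤ x) (hxn : n * x ≤ 1) :
    ∑ χ : Fin n → D, x ^ complexity d χ ≤ x * Real.exp (Fintype.card D) := by
  have h1 : ∀ χ : Fin n → D, x ^ complexity d χ = x * ∏ i, if χ i ≠ d then x else 1 := by
    intro χ
    rw [complexity, pow_add, pow_one, Finset.prod_ite, Finset.prod_const, Finset.prod_const_one,
      mul_one]
  rw [Finset.sum_congr rfl fun χ _ => h1 χ, ← Finset.mul_sum]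
  apply mul_le_mul_of_nonneg_left _ hx
  rw [← Fintype.sum_pow (fun v : D => if v ≠ d then x else 1)]
  have h2 : ∑ v : D, (if v ≠ d then x else 1) ≤ Fintype.card D * x + 1 := by
    calc ∑ v : D, (if v ≠ d then x else 1) ≤ ∑ v : D, (x + if v = d then 1 else 0) := by
          refine Finset.sum_le_sum fun v _ => ?_
          by_cases hv : v = d <;> simp [hv, hx]
      _ = _ := by simp [Finset.sum_add_distrib]
  have h3 : 0 ≤ ∑ v : D, (if v ≠ d then x else 1) :=
    Finset.sum_nonneg fun v _ => by split_ifs <;> simp [hx]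
  calc _ ≤ Real.exp (Fintype.card D * x) ^ n :=
        pow_le_pow_left₀ h3 (h2.trans (Real.add_one_le_exp _)) n
    _ = Real.exp (Fintype.card D * (n * x)) := by
        rw [← Real.exp_nat_mul]
        congr 1
        ring
    _ ≤ _ := Real.exp_le_exp.2 (mul_le_of_le_one_right (Nat.cast_nonneg _) hxn)

theorem one_le_log_add_two {x : ℝ} (hx : 1 ≤ x) : 1 ≤ Real.log (x + 2) := by
  rw [Real.le_log_iff_exp_le (by linarith)]
  have := Real.exp_one_lt_d9
  linarith

/-- Bundled sampling when `k < r`: a union bound over all assignments, weighted by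
their complexity. -/
theorem exists_sampling_of_lt (R : ValuedRel D r) (hk : k < r) (hS : Plentiful (Sym R) k)
    (hu : MarginallyUniform (Sym R) k) (c : ℕ) :
    ∃ κ : ℝ, 0 < κ ∧ ∃ N : ℕ, ∀ n : ℕ, N ≤ n → ∀ ε : ℝ, 0 < ε → ε < 1 → ∃ ℓ : ℕ, 1 ≤ ℓ ∧
      (ℓ : ℝ) ≤ κ * ((n : ℝ) ^ (r - k) / ε ^ 3) * Real.log ((n : ℝ) ^ (r - k) + 2) ∧
      1 - 1 / (n : ℝ) ^ c ≤ sampleProb n r ℓ (fun ω =>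
        IsSparsifier R ε (bundle (sampleInstance ω)) ∧
        ∀ ψ : Fin n → D, symSat (Sym R) (sampleInstance ω) ψ ∈
          Set.Icc ((1 - ε) * sat R (complete n r) ψ) ((1 + ε) * sat R (complete n r) ψ)) := by
  obtain ⟨η, hη, hdet⟩ := abs_sum_sub_le_value hk hS hu
  obtain ⟨M, hM⟩ := exists_nat_ge
    (2 * Fintype.card D * Fintype.card (Hist D r) * Real.exp (Fintype.card D))
  refine ⟨(c + 1) / η + 1, by positivity, M + r + Fintype.card D * r + 2,
    fun n hn ε hε0 hε1 => ?_⟩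
  have hrn : r ≤ n := by omega
  have hDn : Fintype.card D * r ≤ n := by omega
  have hn2 : (2 : ℝ) ≤ n := by exact_mod_cast (by omega : 2 ≤ n)
  have hn0 : (0 : ℝ) < n := by linarith
  have hMn : (M : ℝ) ≤ n := by exact_mod_cast (by omega : M ≤ n)
  obtain ⟨X, hX⟩ : ∃ X : ℝ, X = (n : ℝ) ^ (r - k) := ⟨_, rfl⟩
  have hXn : (n : ℝ) ≤ X := by
    rw [hX]
    exact le_self_pow₀ (by linarith) (by omega)
  have hX0 : 0 < X := by linarith
  obtain ⟨ℓ, hℓ⟩ : ∃ ℓ : ℕ, ℓ = ⌈(c + 1) * Real.log n * X / (η * ε ^ 3)⌉₊ := ⟨_, rfl⟩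
  have hlog : 0 < Real.log n := Real.log_pos (by linarith)
  have hℓle : (c + 1) * Real.log n * X / (η * ε ^ 3) ≤ ℓ := by
    rw [hℓ]
    exact Nat.le_ceil _
  have hℓ1 : 1 ≤ ℓ := by
    rw [hℓ, Nat.one_le_ceil_iff]
    positivity
  refine ⟨ℓ, hℓ1, ?_, ?_⟩
  · rw [← hX]
    have h1 : (ℓ : ℝ) ≤ (c + 1) * Real.log n * X / (η * ε ^ 3) + 1 := by
      rw [hℓ]
      exact (Nat.ceil_lt_add_one (by positivity)).le
    have h2 : Real.log n ≤ Real.log (X + 2) := Real.log_le_log hn0 (by linarith)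
    have h3 : 1 ≤ X / ε ^ 3 := by
      rw [one_le_div (by positivity)]
      have : ε ^ 3 ≤ 1 := pow_le_one₀ hε0.le hε1.le
      linarith
    have h4 : 1 ≤ Real.log (X + 2) := one_le_log_add_two (by linarith)
    calc (ℓ : ℝ) ≤ (c + 1) / η * (X / ε ^ 3) * Real.log n + 1 * 1 := by
          refine h1.trans (le_of_eq ?_)
          field_simp
      _ ≤ (c + 1) / η * (X / ε ^ 3) * Real.log (X + 2) + X / ε ^ 3 * Real.log (X + 2) := by
          gcongr
      _ = _ := by ring
  · obtain ⟨s₀, hs₀⟩ : ∃ s₀ : ℝ, s₀ = η * ε ^ 3 / X := ⟨_, rfl⟩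
    have hs₀0 : 0 < s₀ := by rw [hs₀]; positivity
    obtain ⟨x, hx⟩ : ∃ x : ℝ, x = 1 / (n : ℝ) ^ (c + 1) := ⟨_, rfl⟩
    have hx0 : 0 < x := by rw [hx]; positivity
    have hnx : n * x = 1 / (n : ℝ) ^ c := by
      rw [hx, pow_succ]
      field_simp
    have hexp : Real.exp (-(ℓ * s₀)) ≤ x := by
      have h1 : (c + 1) * Real.log n ≤ ℓ * s₀ := by
        calc (c + 1) * Real.log n = (c + 1) * Real.log n * X / (η * ε ^ 3) * s₀ := by
              rw [hs₀]
              field_simp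
          _ ≤ _ := mul_le_mul_of_nonneg_right hℓle hs₀0.le
      have h2 : x = Real.exp (-((c + 1) * Real.log n)) := by
        have : ((c : ℝ) + 1) = ((c + 1 : ℕ) : ℝ) := by push_cast; ring
        rw [hx, Real.exp_neg, this, Real.exp_nat_mul, Real.exp_log hn0, one_div]
      rw [h2]
      exact Real.exp_le_exp.2 (by linarith)
    have hunion := one_sub_sum_le_sampleProb (ℓ := ℓ)
      (Finset.univ : Finset (D × (Fin n → D) × Hist D r)) hrn
      (fun i ω => |mass (freq ω) i.2.1 i.2.2 - prob i.2.1 i.2.2| ≤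
        2 * (√(prob i.2.1 i.2.2 * (s₀ * complexity i.1 i.2.1)) + s₀ * complexity i.1 i.2.1))
      (fun ω => IsSparsifier R ε (bundle (sampleInstance ω)) ∧
        ∀ ψ : Fin n → D, symSat (Sym R) (sampleInstance ω) ψ ∈
          Set.Icc ((1 - ε) * sat R (complete n r) ψ) ((1 + ε) * sat R (complete n r) ψ))
      (fun ω hω => isSparsifier_and_of_abs_sub_le R hrn ω
        (hdet n hrn hDn ε hε0 hε1 (freq ω) (freq_nonneg ω) (fun d χ g => by
          rw [← hX, ← hs₀]
          exact hω (d, χ, g) (Finset.mem_univ _))))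
    refine le_trans ?_ hunion
    have hone : ∀ (d : D) (χ : Fin n → D) (g : Hist D r), sampleProb n r ℓ (fun ω =>
        ¬ |mass (freq ω) χ g - prob χ g| ≤
          2 * (√(prob χ g * (s₀ * complexity d χ)) + s₀ * complexity d χ)) ≤
        2 * x ^ complexity d χ := by
      intro d χ g
      have hc : (0 : ℝ) < complexity d χ := by
        have : 0 < complexity d χ := by
          unfold complexity
          omega
        exact_mod_cast this
      refine (sampleProb_deviation hrn hℓ1 χ g (by positivity)).trans ?_
      have h1 : Real.exp (-(ℓ * (s₀ * complexity d χ))) =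
          Real.exp (-(ℓ * s₀)) ^ complexity d χ := by
        rw [← Real.exp_nat_mul]
        congr 1
        ring
      rw [h1]
      gcongr
    have hsum : ∑ i : D × (Fin n → D) × Hist D r, sampleProb n r ℓ (fun ω =>
        ¬ |mass (freq ω) i.2.1 i.2.2 - prob i.2.1 i.2.2| ≤
          2 * (√(prob i.2.1 i.2.2 * (s₀ * complexity i.1 i.2.1)) + s₀ * complexity i.1 i.2.1)) ≤
        n * x := by
      calc _ ≤ ∑ i : D × (Fin n → D) × Hist D r, 2 * x ^ complexity i.1 i.2.1 :=
            Finset.sum_le_sum fun i _ => hone i.1 i.2.1 i.2.2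
        _ = ∑ d : D, Fintype.card (Hist D r) * (2 * ∑ χ : Fin n → D, x ^ complexity d χ) := by
            rw [Fintype.sum_prod_type]
            refine Finset.sum_congr rfl fun d _ => ?_
            rw [Fintype.sum_prod_type, Finset.mul_sum, Finset.mul_sum]
            refine Finset.sum_congr rfl fun χ _ => ?_
            simp
        _ ≤ ∑ d : D, Fintype.card (Hist D r) * (2 * (x * Real.exp (Fintype.card D))) := by
            gcongr
            apply sum_pow_complexity_le _ hx0.le
            rw [hnx, div_le_one (by positivity)]
            exact one_le_pow₀ (by linarith)
        _ = (2 * Fintype.card D * Fintype.card (Hist D r) * Real.exp (Fintype.card D)) * x := by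
            rw [Finset.sum_const, Finset.card_univ, nsmul_eq_mul]
            ring
        _ ≤ n * x := mul_le_mul_of_nonneg_right (hM.trans hMn) hx0.le
    rw [hnx] at hsum
    linarith

theorem sum_mass (w : RSet n r → ℝ) (ψ : Fin n → D) : ∑ g, mass w ψ g = ∑ T, w T := by
  unfold mass
  exact Finset.sum_fiberwise _ _ _

theorem sum_freq {ℓ : ℕ} (hℓ : 1 ≤ ℓ) (ω : Fin ℓ → RSet n r) : ∑ T, freq ω T = 1 := by
  have hℓ' : (ℓ : ℝ) ≠ 0 := by positivity
  unfold freq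
  rw [← Finset.sum_div, div_eq_one_iff_eq hℓ', ← Nat.cast_sum]
  have h := Finset.card_eq_sum_card_fiberwise (s := Finset.univ) (t := Finset.univ) (f := ω)
    (fun i _ => Finset.mem_coe.2 (Finset.mem_univ (ω i)))
  rw [← h]
  simp

/-- When `k = r`, marginal uniformity for the full set of colors says that `S` is constant. -/
theorem MarginallyUniform.eq_of_precise {S : SymRel D r} (hu : MarginallyUniform S r)
    (hS : PreciselyPlentiful S r) : ∃ v, ∀ g, S g = v := by
  obtain ⟨d, h, ht⟩ := hS.exists_tight
  have hr : Rigid S d Finset.univ h := by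
    refine ⟨ht.1, Finset.mem_univ _, fun e _ hed => ?_, fun g _ _ => g.2.trans ht.2.2.symm⟩
    have h1 := h.2
    rw [← Finset.add_sum_erase _ _ (Finset.mem_univ d), ht.2.2] at h1
    have h2 : ∑ e ∈ Finset.univ.erase d, h.1 e = 0 := by omega
    exact Finset.sum_eq_zero_iff.1 h2 e (Finset.mem_erase.2 ⟨hed, Finset.mem_univ _⟩)
  refine ⟨S h, fun g => hu.eq_of_collapse_eq (Finset.mem_univ d) ht hr ?_⟩
  apply LeOff.eq_of_apply_le (d := d)
  · intro e he
    rw [collapse_of_mem _ (Finset.mem_univ e) (by simpa using he)]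
    exact Nat.zero_le _
  · rw [ht.2.2]
    exact Hist.apply_le _ _

/-- A constant relation only sees the total weight, which bundled sampling preserves. -/
theorem isSparsifier_and_of_const (R : ValuedRel D r) {v : ℕ} (hv : ∀ g, Sym R g = v)
    (hn : r ≤ n) {ℓ : ℕ} (hℓ : 1 ≤ ℓ) (ω : Fin ℓ → RSet n r) {ε : ℝ} (hε : 0 ≤ ε) :
    IsSparsifier R ε (bundle (sampleInstance ω)) ∧
      ∀ ψ : Fin n → D, symSat (Sym R) (sampleInstance ω) ψ ∈
        Set.Icc ((1 - ε) * sat R (complete n r) ψ) ((1 + ε) * sat R (complete n r) ψ) := by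
  apply isSparsifier_and_of_abs_sub_le R hn ω
  intro ψ
  have hN : (n.choose r : ℝ) ≠ 0 := by exact_mod_cast (Nat.choose_pos hn).ne'
  have h1 : ∑ g, (Sym R g : ℝ) * mass (freq ω) ψ g = v := by
    rw [Finset.sum_congr rfl fun g _ => by rw [hv g], ← Finset.mul_sum, sum_mass, sum_freq hℓ,
      mul_one]
  have h2 : ∑ g, (Sym R g : ℝ) * prob ψ g = v := by
    simp_rw [← mass_const ψ, hv]
    rw [← Finset.mul_sum, sum_mass, Finset.sum_const, Finset.card_univ, card_RSet, nsmul_eq_mul,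
      mul_one_div_cancel hN, mul_one]
  rw [h1, h2, sub_self, abs_zero]
  positivity

theorem exists_sampling (R : ValuedRel D r) (hR : PreciselyPlentiful (Sym R) k)
    (hu : MarginallyUniform (Sym R) k) (c : ℕ) :
    ∃ κ : ℝ, 0 < κ ∧ ∃ N : ℕ, ∀ n : ℕ, N ≤ n → ∀ ε : ℝ, 0 < ε → ε < 1 → ∃ ℓ : ℕ, 1 ≤ ℓ ∧
      (ℓ : ℝ) ≤ κ * ((n : ℝ) ^ (r - k) / ε ^ 3) * Real.log ((n : ℝ) ^ (r - k) + 2) ∧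
      1 - 1 / (n : ℝ) ^ c ≤ sampleProb n r ℓ (fun ω =>
        IsSparsifier R ε (bundle (sampleInstance ω)) ∧
        ∀ ψ : Fin n → D, symSat (Sym R) (sampleInstance ω) ψ ∈
          Set.Icc ((1 - ε) * sat R (complete n r) ψ) ((1 + ε) * sat R (complete n r) ψ)) := by
  rcases hR.le.lt_or_eq with hk | rfl
  · exact exists_sampling_of_lt R hk hR.1 hu c
  obtain ⟨v, hv⟩ := hu.eq_of_precise hR
  refine ⟨1, one_pos, k, fun n hn ε hε0 hε1 => ⟨1, le_rfl, ?_, ?_⟩⟩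
  · rw [Nat.sub_self, pow_zero, Nat.cast_one, one_mul]
    have h1 := one_le_log_add_two le_rfl
    have h2 : 1 ≤ 1 / ε ^ 3 := by
      rw [one_le_div (by positivity)]
      exact pow_le_one₀ hε0.le hε1.le
    exact one_le_mul_of_one_le_of_one_le h2 h1
  · have h := one_sub_sum_le_sampleProb (ℓ := 1) (∅ : Finset Unit) hn (fun _ _ => True)
      (fun ω => IsSparsifier R ε (bundle (sampleInstance ω)) ∧
        ∀ ψ : Fin n → D, symSat (Sym R) (sampleInstance ω) ψ ∈
          Set.Icc ((1 - ε) * sat R (complete n k) ψ) ((1 + ε) * sat R (complete n k) ψ))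
      (fun ω _ => isSparsifier_and_of_const R hv hn le_rfl ω hε0.le)
    refine le_trans ?_ h
    simp

theorem exists_of_sampleProb_pos {ℓ : ℕ} {A : (Fin ℓ → RSet n r) → Prop}
    (h : 0 < sampleProb n r ℓ A) : ∃ ω, A ω := by
  classical
  by_contra! hA
  unfold sampleProb at h
  rw [Finset.filter_false_of_mem fun ω _ => hA ω] at h
  simp at h

theorem exists_sparsifier_of_marginallyUniform (R : ValuedRel D r)
    (hR : PreciselyPlentiful (Sym R) k) (hu : MarginallyUniform (Sym R) k) :
    ∃ κ : ℝ, 0 < κ ∧ ∃ N : ℕ, ∀ n : ℕ, N ≤ n → ∀ ε : ℝ, 0 < ε → ε < 1 →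
      ∃ C' : Instance n r, IsSparsifier R ε C' ∧ (numConstraints C' : ℝ) ≤
        κ * ((n : ℝ) ^ (r - k) / ε ^ 3) * Real.log ((n : ℝ) ^ (r - k) + 2) := by
  obtain ⟨κ, hκ, N, h⟩ := exists_sampling R hR hu 1
  refine ⟨r ! * κ, by positivity, N + 2, fun n hn ε hε0 hε1 => ?_⟩
  obtain ⟨ℓ, hℓ1, hℓ, hprob⟩ := h n (by omega) ε hε0 hε1
  have hn2 : (2 : ℝ) ≤ n := by exact_mod_cast (by omega : 2 ≤ n)
  obtain ⟨ω, hω⟩ := exists_of_sampleProb_pos (lt_of_lt_of_le (by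
    rw [sub_pos, pow_one, div_lt_one (by linarith)]
    linarith) hprob)
  refine ⟨_, hω.1, ?_⟩
  calc (numConstraints (bundle (sampleInstance ω)) : ℝ) ≤ r ! * ℓ := by
        exact_mod_cast numConstraints_bundle_le ω
    _ ≤ r ! * (κ * ((n : ℝ) ^ (r - k) / ε ^ 3) * Real.log ((n : ℝ) ^ (r - k) + 2)) := by
        gcongr
    _ = _ := by ring

/-- With one more factor `n`, all frequencies of histograms are accurate enough. -/
theorem abs_sum_sub_le_of_plentiful {S : SymRel D r} (hkr : k ≤ r) (hS : Plentiful S k) :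
    ∃ η : ℝ, 0 < η ∧ ∀ n : ℕ, 1 ≤ n → r ≤ n → Fintype.card D * r ≤ n → ∀ ε : ℝ, 0 < ε → ε < 1 →
      ∀ w : RSet n r → ℝ,
      (∀ (χ : Fin n → D) (g : Hist D r), |mass w χ g - prob χ g| ≤
        2 * (√(prob χ g * (η * ε ^ 2 / (n : ℝ) ^ (r - k))) +
          η * ε ^ 2 / (n : ℝ) ^ (r - k))) →
      ∀ ψ : Fin n → D, |∑ g, (S g : ℝ) * mass w ψ g - ∑ g, (S g : ℝ) * prob ψ g| ≤
        ε * ∑ g, (S g : ℝ) * prob ψ g := by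
  obtain ⟨B, hB⟩ : ∃ B : ℝ, B = ∑ g, (S g : ℝ) := ⟨_, rfl⟩
  have hB0 : 0 ≤ B := by
    rw [hB]
    exact Finset.sum_nonneg fun g _ => Nat.cast_nonneg _
  obtain ⟨c, hc⟩ : ∃ c : ℝ, c = 1 / (8 * (B + 1)) := ⟨_, rfl⟩
  have hc0 : 0 < c := by
    rw [hc]
    positivity
  have hc1 : c ≤ 1 := by
    rw [hc, div_le_one (by positivity)]
    linarith
  have hcB : 8 * (B + 1) * c = 1 := by
    rw [hc]
    field_simp
  refine ⟨c ^ 2 / (boundConst D r + 1), by positivity,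
    fun n hn1 hn hmn ε hε0 hε1 w hdev ψ => ?_⟩
  have hn0 : (0 : ℝ) < n := by exact_mod_cast hn1
  by_cases hex : ∃ h : Hist D r, S h ≠ 0 ∧ ∀ e, h.1 e ≤ colorCount ψ e
  swap
  · have hz : ∀ g : Hist D r, (S g : ℝ) * mass w ψ g = 0 ∧ (S g : ℝ) * prob ψ g = 0 := by
      intro g
      by_cases hg : S g = 0
      · simp [hg]
      · have hg' : ¬ ∀ e, g.1 e ≤ colorCount ψ e := fun h => hex ⟨g, hg, h⟩
        rw [mass_eq_zero w ψ g hg', prob_eq_zero ψ g hg']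
        simp
    rw [Finset.sum_eq_zero fun g _ => (hz g).1, Finset.sum_eq_zero fun g _ => (hz g).2]
    simp
  obtain ⟨h₀, hh₀, hfit₀⟩ := hex
  have hne : Nonempty D := ⟨ψ ⟨0, hn1⟩⟩
  obtain ⟨d, hd⟩ := exists_large_color ψ
  have hrd : r ≤ colorCount ψ d := Nat.le_of_mul_le_mul_left (hmn.trans hd) Fintype.card_pos
  obtain ⟨h, hh, -, hkh, hfit⟩ := hS.exists_fits hrd hh₀ hfit₀
  have hval := pow_le_value hn hd hh hfit
  obtain ⟨p, hp⟩ : ∃ p, p = value S ψ := ⟨_, rfl⟩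
  have hp0 : 0 ≤ p := hp ▸ value_nonneg S ψ
  rw [← hp] at hval
  obtain ⟨s, hs⟩ : ∃ s : ℝ, s = c ^ 2 / (boundConst D r + 1) * ε ^ 2 / (n : ℝ) ^ (r - k) :=
    ⟨_, rfl⟩
  rw [← hs] at hdev
  have hX0 : 0 < (n : ℝ) ^ (r - k) := by positivity
  have hs0 : 0 ≤ s := by
    rw [hs]
    positivity
  have hsp : s ≤ c ^ 2 * (ε ^ 2 * p) := by
    have h1 : (n : ℝ) ^ k * 1 ≤ (n : ℝ) ^ k * (boundConst D r * (p * (n : ℝ) ^ (r - k))) := by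
      have h2 : (n : ℝ) ^ k ≤ (n : ℝ) ^ h.1 d :=
        pow_le_pow_right₀ (by exact_mod_cast hn1) hkh
      have h3 : (n : ℝ) ^ r = (n : ℝ) ^ k * (n : ℝ) ^ (r - k) := by
        rw [← pow_add]
        congr 1
        omega
      rw [mul_one]
      refine h2.trans (hval.trans (le_of_eq ?_))
      rw [h3]
      ring
    have h4 := le_of_mul_le_mul_left h1 (by positivity)
    have h5 : 0 ≤ p * (n : ℝ) ^ (r - k) := by positivity
    rw [hs, div_le_iff₀ hX0, div_mul_eq_mul_div, div_le_iff₀ (by positivity)]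
    calc c ^ 2 * ε ^ 2 = c ^ 2 * ε ^ 2 * 1 := by ring
      _ ≤ c ^ 2 * ε ^ 2 * ((boundConst D r + 1) * (p * (n : ℝ) ^ (r - k))) := by
          apply mul_le_mul_of_nonneg_left _ (by positivity)
          linarith
      _ = _ := by ring
  obtain ⟨y, hy⟩ : ∃ y : ℝ, y = c * ε * p := ⟨_, rfl⟩
  have hy0 : 0 ≤ y := by
    rw [hy]
    positivity
  have hsy : s ≤ y := by
    refine hsp.trans ?_
    calc c ^ 2 * (ε ^ 2 * p) = c * ε * y := by
          rw [hy]
          ring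
      _ ≤ y := mul_le_of_le_one_left hy0 (mul_le_one₀ hc1 hε0.le hε1.le)
  have hbound : ∀ g, S g ≠ 0 → |mass w ψ g - prob ψ g| ≤ 4 * y := by
    intro g hg
    refine (hdev ψ g).trans (two_mul_sqrt_add_le hy0 ?_ hsy)
    calc prob ψ g * s ≤ p * (c ^ 2 * (ε ^ 2 * p)) :=
          mul_le_mul (hp ▸ prob_le_value ψ hg) hsp hs0 hp0
      _ = y ^ 2 := by rw [hy]; ring
  have hfinal := abs_sum_sub_le_of_collapse (Finset.mem_singleton_self d) S w ψ ∅ (by simp)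
    (by simp) (fun g hg _ => hbound g hg) (b := 4 * y) (by positivity)
  refine hfinal.trans ?_
  change _ ≤ ε * value S ψ
  rw [← hp, ← hB]
  have h2 : 0 ≤ ε * p := by positivity
  have h4 : 0 ≤ c * (ε * p) := by positivity
  calc 2 * (B * (4 * y)) = (8 * (B + 1) * c) * (ε * p) - 8 * (c * (ε * p)) := by
        rw [hy]
        ring
    _ ≤ ε * p := by
        rw [hcB]
        linarith

theorem exists_sparsifier_of_plentiful (R : ValuedRel D r) (hkr : k ≤ r)
    (hS : Plentiful (Sym R) k) :
    ∃ κ : ℝ, 0 < κ ∧ ∃ N : ℕ, ∀ n : ℕ, N ≤ n → ∀ ε : ℝ, 0 < ε → ε < 1 →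
      ∃ C' : Instance n r, IsSparsifier R ε C' ∧
        (numConstraints C' : ℝ) ≤ κ * ((n : ℝ) ^ (r - k + 1) / ε ^ 2) := by
  obtain ⟨η, hη, hdet⟩ := abs_sum_sub_le_of_plentiful hkr hS
  obtain ⟨A, hA⟩ : ∃ A : ℝ, A = Fintype.card D + 2 * Fintype.card (Hist D r) + 1 := ⟨_, rfl⟩
  have hA0 : 0 < A := by
    rw [hA]
    positivity
  refine ⟨r ! * (A / η + 1), by positivity, r + Fintype.card D * r + 1,
    fun n hn ε hε0 hε1 => ?_⟩
  have hrn : r ≤ n := by omega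
  have hDn : Fintype.card D * r ≤ n := by omega
  have hn1 : 1 ≤ n := by omega
  have hn1' : (1 : ℝ) ≤ n := by exact_mod_cast hn1
  have hn0 : (0 : ℝ) < n := by linarith
  obtain ⟨X, hX⟩ : ∃ X : ℝ, X = (n : ℝ) ^ (r - k) := ⟨_, rfl⟩
  have hX1 : 1 ≤ X := by
    rw [hX]
    exact one_le_pow₀ hn1'
  have hX0 : 0 < X := by linarith
  obtain ⟨ℓ, hℓ⟩ : ∃ ℓ : ℕ, ℓ = ⌈A * n * X / (η * ε ^ 2)⌉₊ := ⟨_, rfl⟩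
  have hℓle : A * n * X / (η * ε ^ 2) ≤ ℓ := by
    rw [hℓ]
    exact Nat.le_ceil _
  have hℓ1 : 1 ≤ ℓ := by
    rw [hℓ, Nat.one_le_ceil_iff]
    positivity
  obtain ⟨s, hs⟩ : ∃ s : ℝ, s = η * ε ^ 2 / X := ⟨_, rfl⟩
  have hs0 : 0 < s := by rw [hs]; positivity
  have hunion := one_sub_sum_le_sampleProb (ℓ := ℓ)
    (Finset.univ : Finset ((Fin n → D) × Hist D r)) hrn
    (fun i ω => |mass (freq ω) i.1 i.2 - prob i.1 i.2| ≤ 2 * (√(prob i.1 i.2 * s) + s))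
    (fun ω => IsSparsifier R ε (bundle (sampleInstance ω)))
    (fun ω hω => (isSparsifier_and_of_abs_sub_le R hrn ω
      (hdet n hn1 hrn hDn ε hε0 hε1 (freq ω) (fun χ g => by
        rw [← hX, ← hs]
        exact hω (χ, g) (Finset.mem_univ _)))).1)
  have hexp : Real.exp (-(ℓ * s)) ≤ Real.exp (-(A * n)) := by
    apply Real.exp_le_exp.2
    have : A * n ≤ ℓ * s := by
      calc A * n = A * n * X / (η * ε ^ 2) * s := by
            rw [hs]
            field_simp
        _ ≤ _ := mul_le_mul_of_nonneg_right hℓle hs0.le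
    linarith
  have hsum : ∑ i : (Fin n → D) × Hist D r, sampleProb n r ℓ (fun ω =>
      ¬ |mass (freq ω) i.1 i.2 - prob i.1 i.2| ≤ 2 * (√(prob i.1 i.2 * s) + s)) < 1 := by
    have h1 : (Fintype.card D : ℝ) ^ n ≤ Real.exp (Fintype.card D * n) := by
      rw [mul_comm, Real.exp_nat_mul]
      apply pow_le_pow_left₀ (by positivity)
      linarith [Real.add_one_le_exp (Fintype.card D : ℝ)]
    have h2 : 2 * (Fintype.card (Hist D r) : ℝ) ≤ Real.exp (2 * Fintype.card (Hist D r) * n) := by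
      have h3 := Real.add_one_le_exp (2 * (Fintype.card (Hist D r) : ℝ) * n)
      have h4 : 2 * (Fintype.card (Hist D r) : ℝ) ≤ 2 * Fintype.card (Hist D r) * n :=
        le_mul_of_one_le_right (by positivity) hn1'
      linarith
    calc _ ≤ ∑ i : (Fin n → D) × Hist D r, 2 * Real.exp (-(A * n)) :=
          Finset.sum_le_sum fun i _ => (sampleProb_deviation hrn hℓ1 i.1 i.2 hs0).trans (by
            gcongr)
      _ = (Fintype.card D : ℝ) ^ n * (2 * Fintype.card (Hist D r)) * Real.exp (-(A * n)) := by
          rw [Finset.sum_const, Finset.card_univ, nsmul_eq_mul, Fintype.card_prod,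
            Fintype.card_fun, Fintype.card_fin]
          push_cast
          ring
      _ ≤ Real.exp (Fintype.card D * n) * Real.exp (2 * Fintype.card (Hist D r) * n) *
          Real.exp (-(A * n)) := by gcongr
      _ = Real.exp (-n) := by
          rw [← Real.exp_add, ← Real.exp_add, hA]
          congr 1
          ring
      _ < 1 := by
          rw [Real.exp_lt_one_iff]
          linarith
  obtain ⟨ω, hω⟩ := exists_of_sampleProb_pos (lt_of_lt_of_le (sub_pos.2 hsum) hunion)
  refine ⟨_, hω, ?_⟩
  have h1 : (ℓ : ℝ) ≤ A * n * X / (η * ε ^ 2) + 1 := by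
    rw [hℓ]
    exact (Nat.ceil_lt_add_one (by positivity)).le
  have h2 : 1 ≤ n * X / ε ^ 2 := by
    rw [one_le_div (by positivity)]
    have h3 : ε ^ 2 ≤ 1 := pow_le_one₀ hε0.le hε1.le
    have h4 : 1 ≤ n * X := one_le_mul_of_one_le_of_one_le hn1' hX1
    linarith
  calc (numConstraints (bundle (sampleInstance ω)) : ℝ) ≤ r ! * ℓ := by
        exact_mod_cast numConstraints_bundle_le ω
    _ ≤ r ! * (A / η * (n * X / ε ^ 2) + n * X / ε ^ 2) := by
        gcongr
        calc (ℓ : ℝ) ≤ A * n * X / (η * ε ^ 2) + 1 := h1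
          _ = A / η * (n * X / ε ^ 2) + 1 := by field_simp
          _ ≤ _ := by linarith
    _ = _ := by
        rw [pow_succ (n : ℝ), ← hX]
        ring

end UpperBounds

/-! ### Planted assignments and lower bounds -/

section Counting

variable {n r : ℕ}

theorem card_filter_superset (U : Finset (Fin n)) (hU : U.card ≤ r) :
    (Finset.univ.filter fun T : RSet n r => U ⊆ T.1).card
      = (n - U.card).choose (r - U.card) := by
  have h : (n - U.card).choose (r - U.card) = (Finset.powersetCard (r - U.card) Uᶜ).card := by
    rw [Finset.card_powersetCard, Finset.card_compl, Fintype.card_fin]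
  rw [h]
  refine Finset.card_bij (fun T _ => T.1 \ U) ?_ ?_ ?_
  · intro T hT
    rw [Finset.mem_powersetCard]
    refine ⟨fun i hi => Finset.mem_compl.2 (Finset.mem_sdiff.1 hi).2, ?_⟩
    rw [Finset.card_sdiff_of_subset (Finset.mem_filter.1 hT).2, T.2]
  · intro T hT T' hT' heq
    apply Subtype.ext
    rw [← Finset.sdiff_union_of_subset (Finset.mem_filter.1 hT).2, heq,
      Finset.sdiff_union_of_subset (Finset.mem_filter.1 hT').2]
  · intro P hP
    obtain ⟨hPU, hPc⟩ := Finset.mem_powersetCard.1 hP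
    have hdisj : Disjoint P U := Finset.disjoint_left.2 fun i hi =>
      Finset.mem_compl.1 (hPU hi)
    refine ⟨⟨P ∪ U, ?_⟩, ?_, ?_⟩
    · rw [Finset.card_union_of_disjoint hdisj, hPc]
      omega
    · exact Finset.mem_filter.2 ⟨Finset.mem_univ _, Finset.subset_union_right⟩
    · exact Finset.union_sdiff_cancel_right hdisj

/-- If every `g`-set of variables lies in at least `B` present clauses, there are many of them. -/
theorem choose_mul_le_numConstraints (C : Instance n r) (g : ℕ) (B : ℝ)
    (hB : ∀ U : Finset (Fin n), U.card = g →
      B ≤ ((Finset.univ.filter fun x => C x ≠ 0 ∧ U ⊆ (varSet x).1).card : ℝ)) :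
    (n.choose g : ℝ) * B ≤ numConstraints C * r.choose g := by
  classical
  have h := Finset.sum_card_bipartiteAbove_eq_sum_card_bipartiteBelow
    (s := Finset.powersetCard g (Finset.univ : Finset (Fin n)))
    (t := Finset.univ.filter fun x => C x ≠ 0) (fun U x => U ⊆ (varSet x).1)
  have h1 : ∀ x : Fin r ↪ Fin n, (Finset.bipartiteBelow (fun U x => U ⊆ (varSet x).1)
      (Finset.powersetCard g (Finset.univ : Finset (Fin n))) x).card = r.choose g := by
    intro x
    have h2 : Finset.bipartiteBelow (fun U x => U ⊆ (varSet x).1)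
        (Finset.powersetCard g (Finset.univ : Finset (Fin n))) x =
        Finset.powersetCard g (varSet x).1 := by
      ext U
      simp [Finset.bipartiteBelow, Finset.mem_powersetCard, and_comm]
    rw [h2, Finset.card_powersetCard, (varSet x).2]
  rw [Finset.sum_congr rfl fun x _ => h1 x, Finset.sum_const, smul_eq_mul] at h
  calc (n.choose g : ℝ) * B
      = ∑ U ∈ Finset.powersetCard g (Finset.univ : Finset (Fin n)), B := by
        rw [Finset.sum_const, Finset.card_powersetCard, Finset.card_univ, Fintype.card_fin,
          nsmul_eq_mul]
    _ ≤ ∑ U ∈ Finset.powersetCard g (Finset.univ : Finset (Fin n)),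
        ((Finset.bipartiteAbove (fun U x => U ⊆ (varSet x).1)
          (Finset.univ.filter fun x => C x ≠ 0) U).card : ℝ) := by
        refine Finset.sum_le_sum fun U hU => ?_
        have h2 := hB U (Finset.mem_powersetCard.1 hU).2
        rw [← Finset.filter_filter] at h2
        exact h2
    _ = _ := by
        rw [← Nat.cast_sum, h, Nat.cast_mul, numConstraints]

theorem exists_coloring {α D : Type*} [DecidableEq α] [Fintype D] [DecidableEq D] [Nonempty D]
    (U : Finset α) : ∀ f : D → ℕ, ∑ d, f d = U.card →
      ∃ c : α → D, ∀ d, (U.filter fun i => c i = d).card = f d := by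
  induction U using Finset.induction_on with
  | empty =>
    intro f hf
    refine ⟨fun _ => Classical.arbitrary D, fun d => ?_⟩
    rw [Finset.card_empty, Finset.sum_eq_zero_iff] at hf
    simp [hf d (Finset.mem_univ d)]
  | insert a U ha ih =>
    intro f hf
    rw [Finset.card_insert_of_notMem ha] at hf
    obtain ⟨d₀, hd₀⟩ : ∃ d, f d ≠ 0 := by
      by_contra! h
      rw [Finset.sum_eq_zero fun d _ => h d] at hf
      omega
    obtain ⟨c, hc⟩ := ih (fun d => if d = d₀ then f d - 1 else f d) (by
      rw [← Finset.add_sum_erase _ _ (Finset.mem_univ d₀)] at hf ⊢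
      have h1 : ∑ d ∈ Finset.univ.erase d₀, (if d = d₀ then f d - 1 else f d) =
          ∑ d ∈ Finset.univ.erase d₀, f d :=
        Finset.sum_congr rfl fun d hd => if_neg (Finset.ne_of_mem_erase hd)
      rw [h1]
      simp only [if_true]
      omega)
    refine ⟨Function.update c a d₀, fun d => ?_⟩
    have h1 : (U.filter fun i => Function.update c a d₀ i = d) = U.filter fun i => c i = d := by
      refine Finset.filter_congr fun i hi => ?_
      have hia : i ≠ a := fun h => ha (h ▸ hi)
      rw [Function.update_of_ne hia]
    rw [Finset.filter_insert, Function.update_self, h1]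
    have h2 := hc d
    split_ifs with h
    · subst h
      rw [Finset.card_insert_of_notMem (fun h => ha (Finset.mem_filter.1 h).1), h2, if_pos rfl]
      omega
    · rw [h2, if_neg (Ne.symm h)]

end Counting

section Planted

variable {D : Type*} [Fintype D] [DecidableEq D] {n r k : ℕ}

/-- The assignment that colors the planted set `U` by `c` and the other variables by `χ`. -/
def planted (U : Finset (Fin n)) (c χ : Fin n → D) (i : Fin n) : D := if i ∈ U then c i else χ i

/-- `c` gives to the set `U` the colors that `h` has outside `E`. -/
def PlantsOff (E : Finset D) (h : Hist D r) (U : Finset (Fin n)) (c : Fin n → D) : Prop :=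
  (∀ i ∈ U, c i ∉ E) ∧ ∀ e, e ∉ E → (U.filter fun i => c i = e).card = h.1 e

theorem exists_plantsOff [Nonempty D] {E : Finset D} {h : Hist D r} (hE : ∑ e ∈ E, h.1 e = k)
    {U : Finset (Fin n)} (hU : U.card = r - k) : ∃ c, PlantsOff E h U c := by
  obtain ⟨c, hc⟩ := exists_coloring U (fun e => if e ∈ E then 0 else h.1 e) (by
    have h1 := Finset.sum_add_sum_compl E h.1
    have h2 := h.2
    have h3 : ∑ e ∈ Eᶜ, (if e ∈ E then 0 else h.1 e) = ∑ e ∈ Eᶜ, h.1 e :=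
      Finset.sum_congr rfl fun e he => if_neg (Finset.mem_compl.1 he)
    rw [← Finset.sum_add_sum_compl E, Finset.sum_eq_zero fun e he => if_pos he, h3]
    omega)
  refine ⟨c, fun i hi hiE => ?_, fun e he => ?_⟩
  · have h1 := hc (c i)
    rw [if_pos hiE, Finset.card_eq_zero, Finset.filter_eq_empty_iff] at h1
    exact h1 hi rfl
  · rw [hc, if_neg he]

theorem filter_planted_of_notMem {D : Type*} [DecidableEq D] {E : Finset D} {U : Finset (Fin n)}
    {c χ : Fin n → D} (hχ : ∀ i, χ i ∈ E) (T : Finset (Fin n)) {e : D} (he : e ∉ E) :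
    T.filter (fun i => planted U c χ i = e) = (T ∩ U).filter fun i => c i = e := by
  ext i
  rw [Finset.mem_filter, Finset.mem_filter, Finset.mem_inter]
  unfold planted
  by_cases hi : i ∈ U
  · simp [hi]
  · simp only [hi, if_false, and_false, false_and, iff_false, not_and]
    rintro - rfl
    exact he (hχ i)

/-- Rigidity: a set that contributes to the value of a planted assignment contains the
planted set. -/
theorem Rigid.subset_of_ne_zero {S : SymRel D r} {d : D} {E : Finset D} {h : Hist D r}
    (hr : Rigid S d E h) {U : Finset (Fin n)} {c χ : Fin n → D} (hc : PlantsOff E h U c)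
    (hχ : ∀ i, χ i ∈ E) {T : RSet n r} (hT : S (histOn (planted U c χ) T.1 T.2) ≠ 0) :
    U ⊆ T.1 := by
  have hcard : ∀ e, e ∉ E → (histOn (planted U c χ) T.1 T.2).1 e =
      ((T.1 ∩ U).filter fun i => c i = e).card := fun e he =>
    congrArg Finset.card (filter_planted_of_notMem hχ T.1 he)
  have hle : LeOff E (histOn (planted U c χ) T.1 T.2) h := by
    intro e he
    rw [hcard e he, ← hc.2 e he]
    exact Finset.card_le_card (Finset.filter_subset_filter _ Finset.inter_subset_right)
  have hsum := hr.2.2.2 _ hT hle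
  have hsum' := hr.2.2.2 h hr.1 fun _ _ => le_rfl
  have heq := hle.eq_of_sum_le (hsum.trans hsum'.symm).le
  intro i hi
  have h1 := heq (c i) (hc.1 i hi)
  rw [hcard _ (hc.1 i hi), ← hc.2 _ (hc.1 i hi)] at h1
  have h2 := Finset.eq_of_subset_of_card_le
    (Finset.filter_subset_filter (fun j => c j = c i) (Finset.inter_subset_right (s₁ := T.1)
      (s₂ := U))) h1.ge
  have h3 : i ∈ (T.1 ∩ U).filter fun j => c j = c i := by
    rw [h2]
    exact Finset.mem_filter.2 ⟨hi, rfl⟩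
  exact (Finset.mem_inter.1 (Finset.mem_filter.1 h3).1).1

theorem Rigid.subset_varSet {R : ValuedRel D r} {d : D} {E : Finset D} {h : Hist D r}
    (hr : Rigid (Sym R) d E h) {U : Finset (Fin n)} {c χ : Fin n → D} (hc : PlantsOff E h U c)
    (hχ : ∀ i, χ i ∈ E) {x : Fin r ↪ Fin n} (hx : R (fun i => planted U c χ (x i)) ≠ 0) :
    U ⊆ (varSet x).1 := by
  apply hr.subset_of_ne_zero hc hχ
  rw [histOn_varSet]
  exact sym_hist_ne_zero R _ hx

/-- On a set that contains the planted set, the histogram is glued from the histogram of `χ` on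
the remaining `k` variables and from `h`. -/
theorem histOn_planted {E : Finset D} {h : Hist D r} (hE : ∑ e ∈ E, h.1 e = k)
    {U : Finset (Fin n)} {c χ : Fin n → D} (hc : PlantsOff E h U c) (hχ : ∀ i, χ i ∈ E)
    {T : RSet n r} (hT : U ⊆ T.1) (x : Fin k ↪ Fin n) (hx : Finset.univ.map x = T.1 \ U)
    (t : Fin k → E) (ht : ∀ j, χ (x j) = (t j).1) :
    histOn (planted U c χ) T.1 T.2 = glue h E hE (hist t) := by
  apply Subtype.ext
  funext e
  change (T.1.filter fun i => planted U c χ i = e).card = _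
  simp only [glue]
  split_ifs with he
  · have h1 : (T.1.filter fun i => planted U c χ i = e) =
        (T.1 \ U).filter fun i => χ i = e := by
      ext i
      rw [Finset.mem_filter, Finset.mem_filter, Finset.mem_sdiff]
      unfold planted
      by_cases hi : i ∈ U
      · simp only [hi, if_true, not_true, and_false, false_and, iff_false, not_and]
        rintro - rfl
        exact hc.1 i hi he
      · simp [hi]
    rw [h1, ← hx, Finset.filter_map, Finset.card_map]
    change _ = (Finset.univ.filter fun j => t j = ⟨e, he⟩).card
    congr 1
    refine Finset.filter_congr fun j _ => ?_
    rw [Function.comp_apply, ht, Subtype.ext_iff]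
  · rw [filter_planted_of_notMem hχ T.1 he, Finset.inter_eq_right.2 hT, hc.2 e he]

theorem rigid_singleton {D : Type*} [Fintype D] {S : SymRel D r} {d : D} {h : Hist D r}
    (ht : Tight S d k h) :
    Rigid S d {d} h := by
  refine ⟨ht.1, Finset.mem_singleton_self d, fun e he hed => ?_, fun g hg hle => ?_⟩
  · exact absurd (Finset.mem_singleton.1 he) hed
  · rw [ht.2.1 g hg hle, Finset.sum_singleton]

/-- Every set of `r - k` variables can be planted so that only the clauses that contain it count;
a sparsifier needs one of them. -/
theorem numConstraints_ge (R : ValuedRel D r) (hR : PreciselyPlentiful (Sym R) k) :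
    ∃ δ : ℝ, 0 < δ ∧ ∃ N : ℕ, ∀ n : ℕ, N ≤ n → ∀ ε : ℝ, 0 < ε → ε < 1 →
      ∀ C' : Instance n r, IsSparsifier R ε C' →
        δ * (n : ℝ) ^ (r - k) ≤ (numConstraints C' : ℝ) := by
  obtain ⟨d, h, ht⟩ := hR.exists_tight
  have hkr := hR.le
  have hne : Nonempty D := ⟨d⟩
  have hr := rigid_singleton ht
  have hsum := sum_eq_of_tight_of_rigid ht hr
  have hrpos : 0 < r ^ (r - k) * (r - k)! := by
    apply Nat.mul_pos _ (Nat.factorial_pos _)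
    rcases Nat.eq_zero_or_pos r with h0 | h0
    · simp [h0]
    · exact pow_pos h0 _
  have hcpos : 0 < r.choose (r - k) := Nat.choose_pos (Nat.sub_le _ _)
  refine ⟨1 / ((r ^ (r - k) * (r - k)! : ℕ) * r.choose (r - k)), by positivity, r,
    fun n hn ε hε0 hε1 C' hC' => ?_⟩
  have key := choose_mul_le_numConstraints C' (r - k) 1 (fun U hU => by
    obtain ⟨c, hc⟩ := exists_plantsOff hsum hU
    have hχ : ∀ i : Fin n, (fun _ => d : Fin n → D) i ∈ ({d} : Finset D) := fun i =>
      Finset.mem_singleton_self d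
    -- The planted assignment has positive value.
    have hpos : 0 < sat R (complete n r) (planted U c fun _ => d) := by
      obtain ⟨T, hUT, hT⟩ := Finset.exists_superset_card_eq (s := U) (n := r) (by omega)
        (by simpa using hn)
      have hcard : (T \ U).card = k := by
        rw [Finset.card_sdiff_of_subset hUT]
        omega
      have hglue := histOn_planted hsum hc hχ (T := ⟨T, hT⟩) hUT
        ((T \ U).orderEmbOfFin hcard).toEmbedding (by simp)
        (fun _ => ⟨d, Finset.mem_singleton_self d⟩) (fun _ => rfl)
      have hh : histOn (planted U c fun _ => d) T hT = h := by
        rw [hglue]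
        apply Subtype.ext
        funext e
        simp only [glue]
        split_ifs with he
        · obtain rfl := Finset.mem_singleton.1 he
          rw [ht.2.2]
          simp [hist, histOn]
        · rfl
      rw [sat_complete]
      refine lt_of_lt_of_le ?_ (Finset.single_le_sum
        (f := fun T : RSet n r => (Sym R (histOn (planted U c fun _ => d) T.1 T.2) : ℝ))
        (fun _ _ => Nat.cast_nonneg _) (Finset.mem_univ ⟨T, hT⟩))
      simp only [hh]
      exact_mod_cast Nat.pos_of_ne_zero ht.1
    have h1 := (hC' (planted U c fun _ => d)).1
    have h2 : 0 < sat R C' (planted U c fun _ => d) :=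
      lt_of_lt_of_le (mul_pos (by linarith) hpos) h1
    obtain ⟨x, -, hx⟩ := Finset.exists_ne_zero_of_sum_ne_zero h2.ne'
    have hx1 : C' x ≠ 0 := by
      intro h0
      rw [h0] at hx
      simp at hx
    have hx2 : R (fun i => planted U c (fun _ => d) (x i)) ≠ 0 := by
      intro h0
      rw [h0] at hx
      simp at hx
    have h3 : 0 < (Finset.univ.filter fun x => C' x ≠ 0 ∧ U ⊆ (varSet x).1).card :=
      Finset.card_pos.2 ⟨x, Finset.mem_filter.2 ⟨Finset.mem_univ _, hx1,
        hr.subset_varSet hc hχ hx2⟩⟩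
    exact_mod_cast h3)
  have hch : ((n : ℝ) ^ (r - k)) ≤ (r ^ (r - k) * (r - k)! : ℕ) * n.choose (r - k) := by
    have := pow_le_pow_mul_choose (n := n) (r := r) (g := r - k) (by omega) (by omega)
    rw [← mul_assoc] at this
    exact_mod_cast this
  have hrpos' : (0 : ℝ) < (r ^ (r - k) * (r - k)! : ℕ) := by exact_mod_cast hrpos
  have hcpos' : (0 : ℝ) < r.choose (r - k) := by exact_mod_cast hcpos
  rw [div_mul_eq_mul_div, one_mul, div_le_iff₀ (by positivity)]
  calc (n : ℝ) ^ (r - k) ≤ (r ^ (r - k) * (r - k)! : ℕ) * (n.choose (r - k) * 1) := by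
        rw [mul_one]
        exact hch
    _ ≤ (r ^ (r - k) * (r - k)! : ℕ) * (numConstraints C' * r.choose (r - k)) :=
        mul_le_mul_of_nonneg_left key hrpos'.le
    _ = _ := by ring

end Planted

/-! ### Random colorings of the free variables -/

section Average

variable {F : Type*} [Fintype F] [DecidableEq F] {n k : ℕ}

/-- The expected value of `Q` on `k` independent colors with distribution `α`. -/
noncomputable def average (Q : SymRel F k) (α : F → ℝ) : ℝ :=
  ∑ t : Fin k → F, (∏ j, α (t j)) * (Q (hist t) : ℝ)

theorem exists_hist_eq [Nonempty F] (g : Hist F k) : ∃ t : Fin k → F, hist t = g := by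
  obtain ⟨t, ht⟩ := exists_coloring (Finset.univ : Finset (Fin k)) g.1 (by rw [g.2]; simp)
  exact ⟨t, Subtype.ext (funext ht)⟩

/-- If all color distributions give the same average, `Q` is constant: the average is
a polynomial whose coefficients are multiples of the values of `Q`. -/
theorem uniform_of_average_eq [Nonempty F] (Q : SymRel F k) (q : ℝ)
    (h : ∀ α : F → ℝ, (∀ v, 0 ≤ α v) → ∑ v, α v = 1 → average Q α = q) : Uniform Q := by
  have hp : (∑ t : Fin k → F, MvPolynomial.monomial (∑ j, Finsupp.single (t j) 1)
      ((Q (hist t) : ℝ) - q) : MvPolynomial F ℝ) = 0 := by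
    apply MvPolynomial.funext_set (fun _ => Set.Ioi 0) (fun _ => Set.Ioi_infinite 0)
    intro x hx
    have hx' : ∀ v, 0 < x v := fun v => hx v (Set.mem_univ v)
    have hs : 0 < ∑ v, x v := Finset.sum_pos (fun v _ => hx' v) Finset.univ_nonempty
    have h1 := h (fun v => x v / ∑ v, x v) (fun v => (div_pos (hx' v) hs).le) (by
      rw [← Finset.sum_div, div_self hs.ne'])
    have h2 : ∑ t : Fin k → F, (∏ j, x (t j)) * (Q (hist t) : ℝ) = (∑ v, x v) ^ k * q := by
      rw [← h1, average, Finset.mul_sum]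
      refine Finset.sum_congr rfl fun t _ => ?_
      rw [Finset.prod_div_distrib, Finset.prod_const, Finset.card_univ, Fintype.card_fin]
      field_simp
    rw [map_zero, map_sum]
    have h3 : ∀ t : Fin k → F, MvPolynomial.eval x
        (MvPolynomial.monomial (∑ j, Finsupp.single (t j) 1) ((Q (hist t) : ℝ) - q)) =
        (∏ j, x (t j)) * (Q (hist t) : ℝ) - (∏ j, x (t j)) * q := by
      intro t
      rw [MvPolynomial.monomial_sum_index, map_mul, MvPolynomial.eval_C, map_prod]
      have h4 : ∀ j, MvPolynomial.eval x (MvPolynomial.monomial (Finsupp.single (t j) 1) 1) =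
          x (t j) := fun j => MvPolynomial.eval_X _
      rw [Finset.prod_congr rfl fun j _ => h4 j]
      ring
    rw [Finset.sum_congr rfl fun t _ => h3 t, Finset.sum_sub_distrib, h2, ← Finset.sum_mul,
      Fintype.sum_pow, sub_self]
  have hval : ∀ g, (Q g : ℝ) = q := by
    intro g
    have h1 := congrArg (MvPolynomial.coeff (Finsupp.equivFunOnFinite.symm g.1)) hp
    have h2 : ∀ t : Fin k → F,
        (∑ j, Finsupp.single (t j) 1) = Finsupp.equivFunOnFinite.symm g.1 ↔ hist t = g := by
      intro t
      rw [Subtype.ext_iff, Equiv.eq_symm_apply]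
      have : Finsupp.equivFunOnFinite (∑ j, Finsupp.single (t j) 1) = (hist t).1 := by
        funext v
        change (∑ j, Finsupp.single (t j) 1) v = (Finset.univ.filter fun j => t j = v).card
        rw [Finset.card_filter, Finsupp.finsetSum_apply]
        exact Finset.sum_congr rfl fun j _ => Finsupp.single_apply
      rw [this]
    rw [MvPolynomial.coeff_sum, MvPolynomial.coeff_zero] at h1
    simp only [MvPolynomial.coeff_monomial, h2] at h1
    rw [← Finset.sum_filter, Finset.sum_congr rfl (g := fun _ => (Q g : ℝ) - q)
      (fun t ht => by rw [(Finset.mem_filter.1 ht).2]), Finset.sum_const, nsmul_eq_mul] at h1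
    obtain ⟨t, ht⟩ := exists_hist_eq g
    have h3 : ((Finset.univ.filter fun t : Fin k → F => hist t = g).card : ℝ) ≠ 0 := by
      rw [Nat.cast_ne_zero]
      exact (Finset.card_pos.2 ⟨t, by simpa using ht⟩).ne'
    exact sub_eq_zero.1 ((mul_eq_zero.1 h1).resolve_left h3)
  intro g g'
  exact_mod_cast (hval g).trans (hval g').symm

theorem average_nonneg (Q : SymRel F k) {α : F → ℝ} (hα : ∀ v, 0 ≤ α v) : 0 ≤ average Q α :=
  Finset.sum_nonneg fun _ _ => mul_nonneg (Finset.prod_nonneg fun _ _ => hα _) (Nat.cast_nonneg _)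

theorem average_le (Q : SymRel F k) {α : F → ℝ} (hα : ∀ v, 0 ≤ α v) (h1 : ∑ v, α v = 1) {M : ℝ}
    (hM : ∀ g, (Q g : ℝ) ≤ M) : average Q α ≤ M := by
  calc average Q α ≤ ∑ t : Fin k → F, (∏ j, α (t j)) * M :=
        Finset.sum_le_sum fun t _ =>
          mul_le_mul_of_nonneg_left (hM _) (Finset.prod_nonneg fun j _ => hα _)
    _ = M := by rw [← Finset.sum_mul, ← Fintype.sum_pow, h1, one_pow, one_mul]

/-- Under independent colors, a function of `k` of them has the expectation of `k` independent
colors. -/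
theorem sum_prod_mul_comp {α : F → ℝ} (h1 : ∑ v, α v = 1) (x : Fin k ↪ Fin n)
    (G : (Fin k → F) → ℝ) :
    ∑ χ : Fin n → F, (∏ i, α (χ i)) * G (fun j => χ (x j)) =
      ∑ t : Fin k → F, (∏ j, α (t j)) * G t := by
  classical
  have key : ∀ t : Fin k → F, ∑ χ : Fin n → F,
      (if (fun j => χ (x j)) = t then ∏ i, α (χ i) else 0) = ∏ j, α (t j) := by
    intro t
    have e1 : ∀ χ : Fin n → F, (if (fun j => χ (x j)) = t then ∏ i, α (χ i) else 0) =
        ∏ i, (if ∀ j, x j = i → t j = χ i then α (χ i) else 0) := by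
      intro χ
      split_ifs with h
      · refine Finset.prod_congr rfl fun i _ => ?_
        rw [if_pos]
        rintro j rfl
        exact (congrFun h j).symm
      · obtain ⟨j, hj⟩ := Function.ne_iff.1 h
        symm
        apply Finset.prod_eq_zero (Finset.mem_univ (x j))
        rw [if_neg]
        exact fun h' => hj (h' j rfl).symm
    rw [Finset.sum_congr rfl fun χ _ => e1 χ]
    have e2 := Finset.prod_univ_sum (fun _ : Fin n => (Finset.univ : Finset F))
      (fun i v => if ∀ j, x j = i → t j = v then α v else 0)
    rw [Fintype.piFinset_univ] at e2
    rw [← e2, ← Finset.prod_subset (Finset.subset_univ (Finset.univ.map x)), Finset.prod_map]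
    · refine Finset.prod_congr rfl fun j _ => ?_
      rw [Finset.sum_eq_single_of_mem (t j) (Finset.mem_univ _)]
      · rw [if_pos]
        intro j' hj'
        rw [x.injective hj']
      · intro v _ hv
        rw [if_neg]
        exact fun h => hv (h j rfl).symm
    · intro i _ hi
      rw [← h1]
      refine Finset.sum_congr rfl fun v _ => if_pos ?_
      rintro j rfl
      exact absurd (Finset.mem_map_of_mem x (Finset.mem_univ j)) hi
  calc _ = ∑ χ : Fin n → F, ∑ t : Fin k → F,
        (if (fun j => χ (x j)) = t then ∏ i, α (χ i) else 0) * G t := by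
        refine Finset.sum_congr rfl fun χ _ => ?_
        simp only [ite_mul, zero_mul]
        rw [Finset.sum_ite_eq]
        simp
    _ = _ := by
        rw [Finset.sum_comm]
        refine Finset.sum_congr rfl fun t _ => ?_
        rw [← Finset.sum_mul, key]

end Average

section Link

variable {D : Type*} [Fintype D] [DecidableEq D] {n r k : ℕ}

/-- The variables in `W` are touched by the sparsifier, so that it does not see the colors of the
others; comparing two color distributions on these bounds the difference of their averages. -/
theorem card_mul_average_sub_le {R : ValuedRel D r} {d : D} {E : Finset D} {h : Hist D r}
    (hr : Rigid (Sym R) d E h) (hE : ∑ e ∈ E, h.1 e = k) (hkr : k ≤ r) {U W : Finset (Fin n)}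
    (hU : U.card = r - k)
    {c : Fin n → D} (hc : PlantsOff E h U c) {ε : ℝ} (hε0 : 0 ≤ ε) (hε1 : ε ≤ 1)
    {C' : Instance n r} (hC' : IsSparsifier R ε C')
    (hW : ∀ x, C' x ≠ 0 → U ⊆ (varSet x).1 → (varSet x).1 \ U ⊆ W) {M : ℝ}
    (hM : ∀ g, (Sym R g : ℝ) ≤ M) {α β : E → ℝ} (hα : ∀ v, 0 ≤ α v) (hα1 : ∑ v, α v = 1)
    (hβ : ∀ v, 0 ≤ β v) (hβ1 : ∑ v, β v = 1) :
    ((Finset.univ.filter fun T : RSet n r => U ⊆ T.1 ∧ Disjoint (T.1 \ U) W).card : ℝ) *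
        (average (marginal (Sym R) h E hE) α - average (marginal (Sym R) h E hE) β) ≤
      2 * M * (ε * (Finset.univ.filter fun T : RSet n r =>
          U ⊆ T.1 ∧ Disjoint (T.1 \ U) W).card +
        (Finset.univ.filter fun T : RSet n r => U ⊆ T.1 ∧ ¬ Disjoint (T.1 \ U) W).card) := by
  have hdE : d ∈ E := hr.2.1
  obtain ⟨χ', hχ'⟩ : ∃ χ' : (Fin n → E) → Fin n → D,
      χ' = fun χ i => if i ∈ W then d else (χ i).1 := ⟨_, rfl⟩
  have hχE : ∀ χ i, χ' χ i ∈ E := by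
    intro χ i
    rw [hχ']
    dsimp only
    split_ifs
    · exact hdE
    · exact (χ i).2
  obtain ⟨ψ, hψ⟩ : ∃ ψ : (Fin n → E) → Fin n → D, ψ = fun χ => planted U c (χ' χ) := ⟨_, rfl⟩
  -- The sparsifier does not see the random colors.
  have hV : ∀ χ₁ χ₂, sat R C' (ψ χ₁) = sat R C' (ψ χ₂) := by
    intro χ₁ χ₂
    refine Finset.sum_congr rfl fun x _ => ?_
    by_cases hx : C' x = 0
    · simp [hx]
    by_cases hUx : U ⊆ (varSet x).1
    · have h1 : (fun i => ψ χ₁ (x i)) = fun i => ψ χ₂ (x i) := by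
        funext i
        rw [hψ, hχ']
        simp only [planted]
        split_ifs with h1 h2
        · rfl
        · rfl
        · exact absurd (hW x hx hUx (Finset.mem_sdiff.2 ⟨by simp [varSet], h1⟩)) h2
      rw [h1]
    · have h1 : ∀ χ, R (fun i => ψ χ (x i)) = 0 := by
        intro χ
        by_contra h0
        rw [hψ] at h0
        exact hUx (hr.subset_varSet hc (hχE χ) h0)
      rw [h1, h1]
  -- Averages of the complete instance.
  have hwn : ∀ γ : E → ℝ, (∀ v, 0 ≤ γ v) → ∀ χ : Fin n → E, 0 ≤ ∏ i, γ (χ i) :=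
    fun γ hγ χ => Finset.prod_nonneg fun i _ => hγ _
  have hw1 : ∀ γ : E → ℝ, ∑ v, γ v = 1 → ∑ χ : Fin n → E, ∏ i, γ (χ i) = 1 := by
    intro γ hγ
    rw [← Fintype.sum_pow, hγ, one_pow]
  obtain ⟨a, ha⟩ : ∃ a : (E → ℝ) → RSet n r → ℝ, a = fun γ T =>
      ∑ χ : Fin n → E, (∏ i, γ (χ i)) * (Sym R (histOn (ψ χ) T.1 T.2) : ℝ) := ⟨_, rfl⟩
  have hA : ∀ γ, ∑ χ : Fin n → E, (∏ i, γ (χ i)) * sat R (complete n r) (ψ χ) = ∑ T, a γ T := by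
    intro γ
    rw [ha, Finset.sum_comm]
    refine Finset.sum_congr rfl fun χ _ => ?_
    rw [sat_complete, Finset.mul_sum]
  have ha0 : ∀ γ : E → ℝ, (∀ v, 0 ≤ γ v) → ∀ T, 0 ≤ a γ T := by
    intro γ hγ T
    rw [ha]
    exact Finset.sum_nonneg fun χ _ => mul_nonneg (hwn γ hγ χ) (Nat.cast_nonneg _)
  have haM : ∀ γ : E → ℝ, (∀ v, 0 ≤ γ v) → ∑ v, γ v = 1 → ∀ T, a γ T ≤ M := by
    intro γ hγ hγ1 T
    rw [ha]
    calc _ ≤ ∑ χ : Fin n → E, (∏ i, γ (χ i)) * M :=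
          Finset.sum_le_sum fun χ _ => mul_le_mul_of_nonneg_left (hM _) (hwn γ hγ χ)
      _ = M := by rw [← Finset.sum_mul, hw1 γ hγ1, one_mul]
  have haU : ∀ γ T, ¬ U ⊆ T.1 → a γ T = 0 := by
    intro γ T hT
    rw [ha]
    refine Finset.sum_eq_zero fun χ _ => ?_
    have : Sym R (histOn (ψ χ) T.1 T.2) = 0 := by
      by_contra h0
      rw [hψ] at h0
      exact hT (hr.subset_of_ne_zero hc (hχE χ) h0)
    rw [this, Nat.cast_zero, mul_zero]
  have hagood : ∀ γ : E → ℝ, ∑ v, γ v = 1 → ∀ T : RSet n r, U ⊆ T.1 → Disjoint (T.1 \ U) W →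
      a γ T = average (marginal (Sym R) h E hE) γ := by
    intro γ hγ1 T hUT hTW
    have hcard : (T.1 \ U).card = k := by
      rw [Finset.card_sdiff_of_subset hUT, T.2]
      omega
    have hx : Finset.univ.map ((T.1 \ U).orderEmbOfFin hcard).toEmbedding = T.1 \ U := by simp
    rw [ha, average, ← sum_prod_mul_comp hγ1 ((T.1 \ U).orderEmbOfFin hcard).toEmbedding]
    refine Finset.sum_congr rfl fun χ _ => ?_
    rw [hψ, marginal, ← histOn_planted hE hc (hχE χ) hUT _ hx]
    intro j
    rw [hχ']
    dsimp only
    rw [if_neg]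
    apply Finset.disjoint_left.1 hTW
    have hj := Finset.mem_map_of_mem ((T.1 \ U).orderEmbOfFin hcard).toEmbedding
      (Finset.mem_univ j)
    rwa [hx] at hj
  obtain ⟨n₁, hn₁⟩ : ∃ n₁ : ℝ, n₁ = ((Finset.univ.filter fun T : RSet n r =>
    U ⊆ T.1 ∧ Disjoint (T.1 \ U) W).card : ℝ) := ⟨_, rfl⟩
  obtain ⟨n₂, hn₂⟩ : ∃ n₂ : ℝ, n₂ = ((Finset.univ.filter fun T : RSet n r =>
    U ⊆ T.1 ∧ ¬ Disjoint (T.1 \ U) W).card : ℝ) := ⟨_, rfl⟩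
  have hn₁0 : 0 ≤ n₁ := hn₁ ▸ Nat.cast_nonneg _
  have hn₂0 : 0 ≤ n₂ := hn₂ ▸ Nat.cast_nonneg _
  have hsplit : ∀ γ : E → ℝ, ∑ v, γ v = 1 → ∑ T, a γ T =
      n₁ * average (marginal (Sym R) h E hE) γ +
      ∑ T ∈ Finset.univ.filter (fun T : RSet n r => U ⊆ T.1 ∧ ¬ Disjoint (T.1 \ U) W), a γ T := by
    intro γ hγ1
    rw [← Finset.sum_filter_add_sum_filter_not Finset.univ (fun T : RSet n r => U ⊆ T.1),
      Finset.sum_eq_zero (s := Finset.univ.filter fun T : RSet n r => ¬ U ⊆ T.1)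
        (fun T hT => haU γ T (Finset.mem_filter.1 hT).2), add_zero,
      ← Finset.sum_filter_add_sum_filter_not _ (fun T : RSet n r => Disjoint (T.1 \ U) W),
      Finset.filter_filter, Finset.filter_filter]
    congr 1
    rw [Finset.sum_congr rfl fun T hT => hagood γ hγ1 T (Finset.mem_filter.1 hT).2.1
      (Finset.mem_filter.1 hT).2.2, Finset.sum_const, nsmul_eq_mul, hn₁]
  obtain ⟨qα, hqα⟩ : ∃ q, q = average (marginal (Sym R) h E hE) α := ⟨_, rfl⟩
  obtain ⟨qβ, hqβ⟩ : ∃ q, q = average (marginal (Sym R) h E hE) β := ⟨_, rfl⟩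
  have hQM : ∀ g, (marginal (Sym R) h E hE g : ℝ) ≤ M := fun g => hM _
  have hqα0 : 0 ≤ qα := hqα ▸ average_nonneg _ hα
  have hqβ0 : 0 ≤ qβ := hqβ ▸ average_nonneg _ hβ
  have hqαM : qα ≤ M := hqα ▸ average_le _ hα hα1 hQM
  have hqβM : qβ ≤ M := hqβ ▸ average_le _ hβ hβ1 hQM
  have hlow : n₁ * qα ≤ ∑ T, a α T := by
    rw [hsplit α hα1, hqα]
    exact le_add_of_nonneg_right (Finset.sum_nonneg fun T _ => ha0 α hα T)
  have hup : ∑ T, a β T ≤ n₁ * qβ + n₂ * M := by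
    rw [hsplit β hβ1, hqβ, hn₂, ← nsmul_eq_mul _ M]
    gcongr
    exact Finset.sum_le_card_nsmul _ _ _ fun T _ => haM β hβ hβ1 T
  let χ₀ : Fin n → E := fun _ => ⟨d, hdE⟩
  have hVα : (1 - ε) * ∑ T, a α T ≤ sat R C' (ψ χ₀) := by
    have e1 : sat R C' (ψ χ₀) = ∑ χ : Fin n → E, (∏ i, α (χ i)) * sat R C' (ψ χ₀) := by
      rw [← Finset.sum_mul, hw1 α hα1, one_mul]
    rw [← hA, Finset.mul_sum, e1]
    refine Finset.sum_le_sum fun χ _ => ?_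
    rw [hV χ₀ χ, mul_left_comm]
    exact mul_le_mul_of_nonneg_left (hC' (ψ χ)).1 (hwn α hα χ)
  have hVβ : sat R C' (ψ χ₀) ≤ (1 + ε) * ∑ T, a β T := by
    have e1 : sat R C' (ψ χ₀) = ∑ χ : Fin n → E, (∏ i, β (χ i)) * sat R C' (ψ χ₀) := by
      rw [← Finset.sum_mul, hw1 β hβ1, one_mul]
    rw [← hA, Finset.mul_sum, e1]
    refine Finset.sum_le_sum fun χ _ => ?_
    rw [hV χ₀ χ, mul_left_comm (1 + ε)]
    exact mul_le_mul_of_nonneg_left (hC' (ψ χ)).2 (hwn β hβ χ)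
  have h1 : (1 - ε) * (n₁ * qα) ≤ (1 + ε) * (n₁ * qβ + n₂ * M) :=
    (mul_le_mul_of_nonneg_left hlow (by linarith)).trans (hVα.trans (hVβ.trans
      (mul_le_mul_of_nonneg_left hup (by linarith))))
  have hM0 : 0 ≤ M := hqα0.trans hqαM
  have h2 : ε * n₁ * (qα + qβ) ≤ ε * n₁ * (2 * M) :=
    mul_le_mul_of_nonneg_left (by linarith) (by positivity)
  have h3 : ε * (n₂ * M) ≤ 1 * (n₂ * M) := mul_le_mul_of_nonneg_right hε1 (by positivity)
  rw [← hqα, ← hqβ, ← hn₁, ← hn₂]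
  linarith

/-- The sets that contain `U` and meet `W` elsewhere are few. -/
theorem card_meet_mul_le (U W : Finset (Fin n)) (hk : 1 ≤ k) (hkr : k ≤ r) (hU : U.card = r - k)
    (hn : r ≤ n) :
    (Finset.univ.filter fun T : RSet n r => U ⊆ T.1 ∧ ¬ Disjoint (T.1 \ U) W).card *
        (n - (r - k)) ≤ W.card * (k * (n - (r - k)).choose k) := by
  have h1 : (Finset.univ.filter fun T : RSet n r => U ⊆ T.1 ∧ ¬ Disjoint (T.1 \ U) W) ⊆
      (W \ U).biUnion fun v => Finset.univ.filter fun T : RSet n r => insert v U ⊆ T.1 := by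
    intro T hT
    obtain ⟨-, hUT, hTW⟩ := Finset.mem_filter.1 hT
    obtain ⟨v, hv, hvW⟩ := Finset.not_disjoint_iff.1 hTW
    obtain ⟨hvT, hvU⟩ := Finset.mem_sdiff.1 hv
    exact Finset.mem_biUnion.2 ⟨v, Finset.mem_sdiff.2 ⟨hvW, hvU⟩, Finset.mem_filter.2
      ⟨Finset.mem_univ _, Finset.insert_subset hvT hUT⟩⟩
  have h2 : ∀ v ∈ W \ U, (Finset.univ.filter fun T : RSet n r => insert v U ⊆ T.1).card =
      (n - (r - k) - 1).choose (k - 1) := by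
    intro v hv
    have h3 := Finset.card_insert_of_notMem (Finset.mem_sdiff.1 hv).2
    rw [card_filter_superset _ (by omega), h3, hU]
    congr 1
    omega
  have h4 := (Finset.card_le_card h1).trans Finset.card_biUnion_le
  rw [Finset.sum_congr rfl h2, Finset.sum_const, smul_eq_mul] at h4
  have h5 : (n - (r - k) - 1).choose (k - 1) * (n - (r - k)) = k * (n - (r - k)).choose k := by
    obtain ⟨m, hm⟩ : ∃ m, n - (r - k) = m + 1 := ⟨n - (r - k) - 1, by omega⟩
    obtain ⟨j, rfl⟩ : ∃ j, k = j + 1 := ⟨k - 1, by omega⟩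
    rw [hm]
    have := Nat.add_one_mul_choose_eq m j
    simp only [Nat.add_sub_cancel]
    linarith
  calc _ ≤ (W \ U).card * (n - (r - k) - 1).choose (k - 1) * (n - (r - k)) :=
        Nat.mul_le_mul_right _ h4
    _ = (W \ U).card * (k * (n - (r - k)).choose k) := by rw [mul_assoc, h5]
    _ ≤ _ := Nat.mul_le_mul_right _ (Finset.card_le_card Finset.sdiff_subset)

/-- Without marginal uniformity, each planted set must lie in linearly many present clauses: the
other variables are seen neither by these clauses nor by a rigid histogram alone. -/
theorem numConstraints_ge_of_not_marginallyUniform (R : ValuedRel D r)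
    (hR : PreciselyPlentiful (Sym R) k) (hu : ¬ MarginallyUniform (Sym R) k) :
    ∃ ε₀ : ℝ, 0 < ε₀ ∧ ∃ δ : ℝ, 0 < δ ∧ ∃ N : ℕ, ∀ n : ℕ, N ≤ n → ∀ ε : ℝ, 0 < ε → ε < ε₀ →
      ∀ C' : Instance n r, IsSparsifier R ε C' →
        δ * (n : ℝ) ^ (r - k + 1) ≤ (numConstraints C' : ℝ) := by
  classical
  have hkr := hR.le
  unfold MarginallyUniform at hu
  push Not at hu
  obtain ⟨d, E, h, ht, hr, hQ⟩ := hu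
  obtain ⟨hE, hhE⟩ : ∃ hE : ∑ e ∈ E, h.1 e = k, hE = sum_eq_of_tight_of_rigid ht hr := ⟨_, rfl⟩
  have hneD : Nonempty D := ⟨d⟩
  have hneE : Nonempty E := ⟨⟨d, hr.2.1⟩⟩
  have hk : 1 ≤ k := by
    by_contra hk0
    obtain rfl : k = 0 := by omega
    refine hQ fun g g' => ?_
    congr 1
    apply Subtype.ext
    funext e
    have h1 := g.apply_le e
    have h2 := g'.apply_le e
    omega
  -- Two color distributions with different averages.
  obtain ⟨α, β, hα, hα1, hβ, hβ1, hαβ⟩ : ∃ α β : E → ℝ, (∀ v, 0 ≤ α v) ∧ ∑ v, α v = 1 ∧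
      (∀ v, 0 ≤ β v) ∧ ∑ v, β v = 1 ∧ 0 < average (marginal (Sym R) h E hE) α -
        average (marginal (Sym R) h E hE) β := by
    by_contra! hcon
    obtain ⟨γ, hγ⟩ : ∃ γ : E → ℝ, γ = Pi.single ⟨d, hr.2.1⟩ 1 := ⟨_, rfl⟩
    have hγ0 : ∀ v, 0 ≤ γ v := fun v => by
      rw [hγ, Pi.single_apply]
      split_ifs <;> norm_num
    have hγ1 : ∑ v, γ v = 1 := by
      rw [hγ]
      simp
    apply hQ
    apply uniform_of_average_eq _ (average (marginal (Sym R) h E hE) γ)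
    intro α hα hα1
    exact le_antisymm (sub_nonpos.1 (hcon α γ hα hα1 hγ0 hγ1))
      (sub_nonpos.1 (hcon γ α hγ0 hγ1 hα hα1))
  obtain ⟨Δ, hΔ⟩ : ∃ Δ, Δ = average (marginal (Sym R) h E hE) α -
    average (marginal (Sym R) h E hE) β := ⟨_, rfl⟩
  rw [← hΔ] at hαβ
  obtain ⟨M, hMdef⟩ : ∃ M : ℝ, M = ∑ g, (Sym R g : ℝ) + 1 := ⟨_, rfl⟩
  have hM0 : 0 < M := by
    rw [hMdef]
    positivity
  have hM : ∀ g, (Sym R g : ℝ) ≤ M := by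
    intro g
    have := Finset.single_le_sum (f := fun g => (Sym R g : ℝ)) (fun _ _ => Nat.cast_nonneg _)
      (Finset.mem_univ g)
    linarith
  obtain ⟨θ, hθ⟩ : ∃ θ : ℝ, θ = Δ / (8 * M) := ⟨_, rfl⟩
  have hθ0 : 0 < θ := by
    rw [hθ]
    positivity
  have hθM : 2 * M * θ = Δ / 4 := by
    rw [hθ]
    field_simp
    norm_num
  have hr0 : (0 : ℝ) < r := by exact_mod_cast (by omega : 0 < r)
  have hk0 : (0 : ℝ) < k := by exact_mod_cast hk
  obtain ⟨δ₁, hδ₁⟩ : ∃ δ₁ : ℝ, δ₁ = θ / ((1 + θ) * (2 * (r * k))) := ⟨_, rfl⟩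
  have hδ₁0 : 0 < δ₁ := by
    rw [hδ₁]
    positivity
  have hδ₁eq : (1 + θ) * (2 * (r * k * δ₁)) = θ := by
    rw [hδ₁]
    field_simp
  have hc1 : (0 : ℝ) < (r ^ (r - k) * (r - k)! : ℕ) := by
    have : 0 < r := by omega
    positivity
  have hc2 : (0 : ℝ) < r.choose (r - k) := by
    exact_mod_cast Nat.choose_pos (Nat.sub_le _ _)
  refine ⟨min 1 θ, lt_min one_pos hθ0,
    δ₁ / ((r ^ (r - k) * (r - k)! : ℕ) * r.choose (r - k)), by positivity, 2 * r,
    fun n hn ε hε0 hε C' hC' => ?_⟩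
  have hε1 : ε ≤ 1 := hε.le.trans (min_le_left _ _)
  have hεθ : ε ≤ θ := hε.le.trans (min_le_right _ _)
  have hn0 : (0 : ℝ) < n := by exact_mod_cast (by omega : 0 < n)
  have key := choose_mul_le_numConstraints C' (r - k) (δ₁ * n) (fun U hU => by
    by_contra! hfew
    obtain ⟨c, hc⟩ := exists_plantsOff hE hU
    obtain ⟨L, hL⟩ : ∃ L, L = Finset.univ.filter fun x => C' x ≠ 0 ∧ U ⊆ (varSet x).1 :=
      ⟨_, rfl⟩
    rw [← hL] at hfew
    obtain ⟨W, hWdef⟩ : ∃ W, W = L.biUnion fun x => (varSet x).1 := ⟨_, rfl⟩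
    have hWcard : W.card ≤ L.card * r := by
      rw [hWdef]
      exact Finset.card_biUnion_le_card_mul _ _ _ fun x _ => (varSet x).2.le
    have hW : ∀ x, C' x ≠ 0 → U ⊆ (varSet x).1 → (varSet x).1 \ U ⊆ W := by
      intro x hx hUx i hi
      rw [hWdef, hL]
      exact Finset.mem_biUnion.2 ⟨x, Finset.mem_filter.2 ⟨Finset.mem_univ _, hx, hUx⟩,
        (Finset.mem_sdiff.1 hi).1⟩
    have hmain := card_mul_average_sub_le hr hE hkr hU hc hε0.le hε1 hC' hW hM hα hα1 hβ hβ1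
    have hmeet := card_meet_mul_le U W hk hkr hU (by omega)
    have htot : (Finset.univ.filter fun T : RSet n r => U ⊆ T.1 ∧ Disjoint (T.1 \ U) W).card +
        (Finset.univ.filter fun T : RSet n r => U ⊆ T.1 ∧ ¬ Disjoint (T.1 \ U) W).card =
        (n - (r - k)).choose k := by
      have h1 := card_filter_superset (r := r) U (by omega)
      rw [← Finset.card_filter_add_card_filter_not
        (fun T : RSet n r => Disjoint (T.1 \ U) W),
      Finset.filter_filter, Finset.filter_filter] at h1
      rw [h1, hU]
      congr 1
      omega
    rw [← htot] at hmeet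
    have hpos : 0 < (n - (r - k)).choose k := Nat.choose_pos (by omega)
    rw [← htot] at hpos
    rw [← hΔ] at hmain
    generalize (Finset.univ.filter fun T : RSet n r => U ⊆ T.1 ∧ Disjoint (T.1 \ U) W).card = n₁
      at hmain hmeet hpos
    generalize (Finset.univ.filter fun T : RSet n r => U ⊆ T.1 ∧ ¬ Disjoint (T.1 \ U) W).card = n₂
      at hmain hmeet hpos
    have hpos' : (0 : ℝ) < n₁ + n₂ := by exact_mod_cast hpos
    have hn₂0 : (0 : ℝ) ≤ n₂ := Nat.cast_nonneg _
    have hn₁0 : (0 : ℝ) ≤ n₁ := Nat.cast_nonneg _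
    have hW' : (W.card : ℝ) ≤ r * (δ₁ * n) := by
      have h1 : (W.card : ℝ) ≤ L.card * r := by exact_mod_cast hWcard
      have h2 := mul_le_mul_of_nonneg_right hfew.le hr0.le
      linarith
    have h1 : (n₂ : ℝ) * (n / 2) ≤ (r * (δ₁ * n)) * (k * (n₁ + n₂)) := by
      have h2 : (n₂ : ℝ) * ((n - (r - k) : ℕ) : ℝ) ≤ W.card * (k * (n₁ + n₂)) := by
        exact_mod_cast hmeet
      have h3 : (n : ℝ) / 2 ≤ ((n - (r - k) : ℕ) : ℝ) := by
        rw [div_le_iff₀ two_pos]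
        exact_mod_cast (by omega : n ≤ (n - (r - k)) * 2)
      calc (n₂ : ℝ) * (n / 2) ≤ n₂ * ((n - (r - k) : ℕ) : ℝ) := by gcongr
        _ ≤ W.card * (k * (n₁ + n₂)) := h2
        _ ≤ _ := by gcongr
    have h2 : (n₂ : ℝ) ≤ 2 * (r * k * δ₁) * (n₁ + n₂) := by
      have h3 : (n₂ : ℝ) * n ≤ (2 * (r * k * δ₁) * (n₁ + n₂)) * n := by linarith
      exact le_of_mul_le_mul_right h3 hn0
    have h3 : (n₂ : ℝ) ≤ θ * n₁ := by
      have h4 : (1 + θ) * (n₂ : ℝ) ≤ (1 + θ) * (2 * (r * k * δ₁) * (n₁ + n₂)) :=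
        mul_le_mul_of_nonneg_left h2 (by linarith)
      have h5 : (1 + θ) * (2 * (r * k * δ₁) * (n₁ + n₂)) = θ * ((n₁ : ℝ) + n₂) := by
        rw [← mul_assoc, hδ₁eq]
      linarith
    have hn₁pos : (0 : ℝ) < n₁ := by
      rcases hn₁0.lt_or_eq with h4 | h4
      · exact h4
      · rw [← h4] at h3 hpos'
        linarith
    have h4 : 2 * M * (ε * n₁ + n₂) ≤ 2 * M * (θ * n₁ + θ * n₁) := by gcongr
    have h5 : 2 * M * (θ * n₁ + θ * n₁) = Δ / 2 * n₁ := by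
      calc 2 * M * (θ * n₁ + θ * n₁) = 2 * (2 * M * θ) * n₁ := by ring
        _ = _ := by rw [hθM]; ring
    have h6 : 0 < Δ * n₁ := mul_pos hαβ hn₁pos
    linarith)
  have hch : ((n : ℝ) ^ (r - k)) ≤ (r ^ (r - k) * (r - k)! : ℕ) * n.choose (r - k) := by
    have := pow_le_pow_mul_choose (n := n) (r := r) (g := r - k) (by omega) (by omega)
    rw [← mul_assoc] at this
    exact_mod_cast this
  rw [div_mul_eq_mul_div, div_le_iff₀ (by positivity)]
  calc δ₁ * (n : ℝ) ^ (r - k + 1) = (n : ℝ) ^ (r - k) * (δ₁ * n) := by ring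
    _ ≤ ((r ^ (r - k) * (r - k)! : ℕ) * n.choose (r - k)) * (δ₁ * n) := by gcongr
    _ = (r ^ (r - k) * (r - k)! : ℕ) * (n.choose (r - k) * (δ₁ * n)) := by ring
    _ ≤ (r ^ (r - k) * (r - k)! : ℕ) * (numConstraints C' * r.choose (r - k)) :=
        mul_le_mul_of_nonneg_left key hc1.le
    _ = _ := by ring

end Link

end UniformCSP

theorem theorem7p9 {D : Type*} [Fintype D] [DecidableEq D] (r k : ℕ)
    (R : UniformCSP.ValuedRel D r) (hR : UniformCSP.PreciselyPlentiful (UniformCSP.Sym R) k) :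
    (UniformCSP.MarginallyUniform (UniformCSP.Sym R) k →
      -- independent sampling of bundles gives a sparsifier with high probability
      (∃ a : ℕ, ∀ c : ℕ, ∃ κ : ℝ, 0 < κ ∧ ∃ N : ℕ, ∀ n : ℕ, N ≤ n → ∀ ε : ℝ, 0 < ε → ε < 1 →
        ∃ ℓ : ℕ, 1 ≤ ℓ ∧
          (ℓ : ℝ) ≤ κ * ((n : ℝ) ^ (r - k) / ε ^ 3) * Real.log ((n : ℝ) ^ (r - k) + 2) ^ a ∧
          1 - 1 / (n : ℝ) ^ c ≤ UniformCSP.sampleProb n r ℓ (fun ω =>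
            UniformCSP.IsSparsifier R ε (UniformCSP.bundle (UniformCSP.sampleInstance ω)) ∧
            ∀ ψ : Fin n → D,
              UniformCSP.symSat (UniformCSP.Sym R) (UniformCSP.sampleInstance ω) ψ ∈
                Set.Icc ((1 - ε) * UniformCSP.sat R (UniformCSP.complete n r) ψ)
                  ((1 + ε) * UniformCSP.sat R (UniformCSP.complete n r) ψ))) ∧
      -- in particular, sparsifiers of this size exist
      (∃ a : ℕ, ∃ κ : ℝ, 0 < κ ∧ ∃ N : ℕ, ∀ n : ℕ, N ≤ n → ∀ ε : ℝ, 0 < ε → ε < 1 →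
        ∃ C' : UniformCSP.Instance n r, UniformCSP.IsSparsifier R ε C' ∧
          (UniformCSP.numConstraints C' : ℝ) ≤
            κ * ((n : ℝ) ^ (r - k) / ε ^ 3) * Real.log ((n : ℝ) ^ (r - k) + 2) ^ a) ∧
      -- and every sparsifier has at least about this size
      (∃ δ : ℝ, 0 < δ ∧ ∃ N : ℕ, ∀ n : ℕ, N ≤ n → ∀ ε : ℝ, 0 < ε → ε < 1 →
        ∀ C' : UniformCSP.Instance n r, UniformCSP.IsSparsifier R ε C' →
          δ * (n : ℝ) ^ (r - k) ≤ (UniformCSP.numConstraints C' : ℝ))) ∧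
    (¬ UniformCSP.MarginallyUniform (UniformCSP.Sym R) k →
      (∃ κ : ℝ, 0 < κ ∧ ∃ N : ℕ, ∀ n : ℕ, N ≤ n → ∀ ε : ℝ, 0 < ε → ε < 1 →
        ∃ C' : UniformCSP.Instance n r, UniformCSP.IsSparsifier R ε C' ∧
          (UniformCSP.numConstraints C' : ℝ) ≤ κ * ((n : ℝ) ^ (r - k + 1) / ε ^ 2)) ∧
      (∃ ε₀ : ℝ, 0 < ε₀ ∧ ∃ δ : ℝ, 0 < δ ∧ ∃ N : ℕ, ∀ n : ℕ, N ≤ n →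
        ∀ ε : ℝ, 0 < ε → ε < ε₀ →
        ∀ C' : UniformCSP.Instance n r, UniformCSP.IsSparsifier R ε C' →
          δ * (n : ℝ) ^ (r - k + 1) ≤ (UniformCSP.numConstraints C' : ℝ))) := by
  refine ⟨fun hu => ⟨⟨1, ?_⟩, ⟨1, ?_⟩, UniformCSP.numConstraints_ge R hR⟩, fun hu =>
    ⟨UniformCSP.exists_sparsifier_of_plentiful R hR.le hR.1,
      UniformCSP.numConstraints_ge_of_not_marginallyUniform R hR hu⟩⟩
  · simpa only [pow_one] using UniformCSP.exists_sampling R hR hu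
  · simpa only [pow_one] using UniformCSP.exists_sparsifier_of_marginallyUniform R hR hu
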